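/- **Setting.** Let $\mathbb T^3=\mathbb R^3/(2\mathbb Z)^3\cong[-1,1]^3$, with characters $e_k(x)=e^{i\pi k\cdot x}$, $k\in\mathbb Z^3$, and write $\hat u(k)$ for the Fourier coefficients of a distribution $u=\sum_k\hat u(k)e_k\in\mathcal S'(\mathbb T^3)$. Fourier multipliers are $m(D)u=\sum_k m(k)\hat u(k)e_k$. Let $(\chi,\theta)$ be a dyadic partition of unity on $\mathbb R^3$: $\chi,\theta$ are nonnegative, radial, smooth, with $\operatorname{supp}\chi$ in a ball and $\operatorname{supp}\theta$ in an annulus, $\chi+\sum_{j\ge0}\theta(2^{-j}\cdot)=1$, $\operatorname{supp}\chi\cap\operatorname{supp}\theta(2^{-j}\cdot)=\emptyset$ for $j\ge1$ and $\operatorname{supp}\theta(2^{-i}\cdot)\cap\operatorname{supp}\theta(2^{-j}\cdot)=\emptyset$ for $|i-j|>1$. Put $\Delta_{-1}=\chi(D)$, $\Delta_j=\theta(2^{-j}\cdot)(D)$ for $j\ge0$, $\|u\|_\alpha=\sup_{j\ge-1}2^{j\alpha}\|\Delta_ju\|_{L^\infty}$, $\mathcal C^\alpha=\{u\in\mathcal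 S'(\mathbb T^3):\|u\|_\alpha<\infty\}$, and $$\pi_<(u,v)=\sum_{j\ge-1}\ \sum_{-1\le i<j-1}\Delta_iu\,\Delta_jv .$$ For $N\ge1$ let $\varepsilon=\frac{2}{2N+1}$, $f(x)=\frac{4}{|x|^2}\sum_{l=1}^3\sin^2\frac{\pi x_l}{2}$ (with $|k|^2f(\varepsilon k)=0$ for $k=0$), and let $\varphi$ be a fixed smooth real function on $\mathbb R^3$ with $\varphi=1$ on $\{|x|_\infty\le1\}$ and support in $\{|x|\le1.8\}$. For $t>0$ define Fourier multipliers by - $P_N$ with symbol $1_{|k|_\infty\le N}$; - $\tilde P^\varepsilon_t$ with symbol $e^{-t|k|^2f(\varepsilon k)}\varphi(\varepsilon k)$, and $P^\varepsilon_t=P_N\tilde P^\varepsilon_t$; - $P_t=e^{t\Delta}$ with symbol $e^{-t\pi^2|k|^2}$. **Lemma 3.3.** Let $\alpha<1$, $\beta\in\mathbb R$, $\delta\ge\alpha+\beta$ and $\kappa>0$. There is a constant $C$, depending only on $\alpha,\beta,\delta,\kappa,\chi,\theta,\varphi$, such that for all $N\ge1$, $t>0$, $u\in\mathcal C^\alpha$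 and $v\in\mathcal C^\beta$ $$\|P_t^\varepsilon\pi_<(u,v)-P_N\pi_<(u,\tilde P_t^\varepsilon v)\|_{\delta-\kappa}\le C\,t^{\frac{\alpha+\beta-\delta}{2}}\|u\|_\alpha\|v\|_\beta .$$ If moreover $\kappa\le4$, there is such a constant $C$ for which also $$\big\|(P_t^\varepsilon-P_t)\pi_<(u,v)-\big(P_N\pi_<(u,\tilde P_t^\varepsilon v)-\pi_<(u,P_tv)\big)\big\|_{\delta-\kappa}\le C\,\varepsilon^{\kappa/2}\,t^{\frac{\alpha+\beta-\delta}{2}}\|u\|_\alpha\|v\|_\beta .$$ -/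

import Mathlib

open scoped NNReal ENNReal ContDiff

namespace LatticeHeat

/-- Points of the universal cover `ℝ³` of the torus `𝕋³ = ℝ³ / (2ℤ)³`, identified with `[-1,1]³`. -/
abbrev Pt := Fin 3 → ℝ

/-- Frequencies `k ∈ ℤ³`; the corresponding character is `x ↦ exp (i π k · x)`. -/
abbrev Freq := Fin 3 → ℤ

/-- The frequency space `ℝ³` with its Euclidean norm. -/
abbrev E3 := EuclideanSpace ℝ (Fin 3)

/-- A lattice frequency as a point of `ℝ³`. -/
noncomputable def Freq.toE3 (k : Freq) : E3 := WithLp.toLp 2 (fun i => (k i : ℝ))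

/-! ### Test functions and distributions on the torus -/

/-- `C^∞(𝕋³)`: smooth complex valued functions on `ℝ³` that are `2`-periodic in each variable. -/
def SmoothTorus : Submodule ℂ (Pt → ℂ) where
  carrier := {φ | ContDiff ℝ ∞ φ ∧ ∀ (x : Pt) (k : Freq), φ (x + fun i => 2 * (k i : ℝ)) = φ x}
  add_mem' := by
    rintro f g ⟨hf, hf'⟩ ⟨hg, hg'⟩
    exact ⟨hf.add hg, fun x k => by simp [hf' x k, hg' x k]⟩
  zero_mem' := ⟨contDiff_const, fun _ _ => rfl⟩
  smul_mem' := by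
    rintro c f ⟨hf, hf'⟩
    exact ⟨hf.const_smul c, fun x k => by simp [hf' x k]⟩

/-- The phase `k · x`. -/
noncomputable def phase (k : Freq) : Pt →L[ℝ] ℝ := ∑ i, (k i : ℝ) • ContinuousLinearMap.proj i

lemma phase_apply (k : Freq) (x : Pt) : phase k x = ∑ i, (k i : ℝ) * x i := by
  simp [phase]

/-- The character `x ↦ exp (i π k · x)`. -/
noncomputable def char (k : Freq) : SmoothTorus :=
  ⟨fun x => Complex.exp (Complex.I * (Real.pi : ℂ) * ((∑ i, (k i : ℝ) * x i : ℝ) : ℂ)), by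
    constructor
    · have h : ContDiff ℝ ∞ (fun x : Pt => ∑ i, (k i : ℝ) * x i) := by fun_prop
      have h2 : ContDiff ℝ ∞ (fun x : Pt => ((∑ i, (k i : ℝ) * x i : ℝ) : ℂ)) :=
        Complex.ofRealCLM.contDiff.comp h
      exact (contDiff_const.mul h2).cexp
    · intro x l
      rw [Complex.exp_eq_exp_iff_exists_int]
      refine ⟨∑ i, k i * l i, ?_⟩
      push_cast
      simp only [Pi.add_apply, Complex.ofReal_add, Complex.ofReal_mul, mul_add,
        Finset.sum_add_distrib, Finset.mul_sum, Finset.sum_mul]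
      push_cast
      congr 1
      refine Finset.sum_congr rfl fun i _ => ?_
      ring⟩

/-- `𝒮'(𝕋³)`: complex linear functionals on `C^∞(𝕋³)` that are continuous for the Fréchet topology
of uniform convergence of all derivatives, i.e. bounded by finitely many `C^m` seminorms. -/
def TorusDistribution : Submodule ℂ (SmoothTorus →ₗ[ℂ] ℂ) where
  carrier := {u | ∃ (m : ℕ) (C : ℝ), ∀ (φ : SmoothTorus) (M : ℝ),
    (∀ i ≤ m, ∀ x : Pt, ‖iteratedFDeriv ℝ i φ.1 x‖ ≤ M) → ‖u φ‖ ≤ C * M}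
  add_mem' := by
    rintro u v ⟨m, C, h⟩ ⟨m', C', h'⟩
    refine ⟨max m m', C + C', fun φ M hM => ?_⟩
    have h1 := h φ M fun i hi => hM i (hi.trans (le_max_left _ _))
    have h2 := h' φ M fun i hi => hM i (hi.trans (le_max_right _ _))
    calc ‖u φ + v φ‖ ≤ ‖u φ‖ + ‖v φ‖ := norm_add_le _ _
      _ ≤ (C + C') * M := by linarith
  zero_mem' := ⟨0, 0, fun φ M _ => by simp⟩
  smul_mem' := by
    rintro c u ⟨m, C, h⟩
    refine ⟨m, ‖c‖ * C, fun φ M hM => ?_⟩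
    have h1 := h φ M hM
    simp only [LinearMap.smul_apply, norm_smul]
    nlinarith [norm_nonneg c]

/-- Fourier coefficients, normalised so that `u = ∑ₖ û(k) exp (i π k · x)`. -/
noncomputable def distCoeff (u : TorusDistribution) (k : Freq) : ℂ := (1 / 8) * u.1 (char (-k))

/-- The integral over the torus `[-1,1]³`. -/
noncomputable def integralTorus (f : Pt → ℂ) : ℂ := ∫ x in Set.Icc (-1 : Pt) 1, f x

lemma continuous_torus (φ : SmoothTorus) : Continuous φ.1 := φ.2.1.continuous

lemma norm_char (k : Freq) (x : Pt) : ‖(char k).1 x‖ = 1 := by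
  have : (char k).1 x = Complex.exp (((Real.pi * ∑ i, (k i : ℝ) * x i : ℝ) : ℂ) * Complex.I) := by
    simp only [char]
    congr 1
    push_cast
    ring
  rw [this, Complex.norm_exp_ofReal_mul_I]

lemma char_mul (k l : Freq) (x : Pt) : (char k).1 x * (char l).1 x = (char (k + l)).1 x := by
  simp only [char]
  rw [← Complex.exp_add]
  congr 1
  simp only [Pi.add_apply]
  push_cast
  simp only [add_mul, Finset.sum_add_distrib]
  ring

lemma norm_integralTorus_le (f : Pt → ℂ) (M : ℝ) (hM : ∀ x, ‖f x‖ ≤ M) :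
    ‖integralTorus f‖ ≤ 8 * M := by
  have hv : (MeasureTheory.volume : MeasureTheory.Measure Pt).real (Set.Icc (-1 : Pt) 1) = 8 := by
    rw [MeasureTheory.measureReal_def, Real.volume_Icc_pi]
    simp
    norm_num
  have := MeasureTheory.norm_setIntegral_le_of_norm_le_const (μ := MeasureTheory.volume)
    (s := Set.Icc (-1 : Pt) 1) (f := f) (C := M)
    (by exact isCompact_Icc.measure_lt_top) (fun x _ => hM x)
  rw [hv] at this
  unfold integralTorus
  linarith

lemma integrableOn_torus {f : Pt → ℂ} (hf : Continuous f) :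
    MeasureTheory.IntegrableOn f (Set.Icc (-1 : Pt) 1) :=
  hf.continuousOn.integrableOn_compact isCompact_Icc

/-- The integral of a partial derivative of a smooth periodic function vanishes. -/
lemma integralTorus_deriv (φ : SmoothTorus) (i : Fin 3) :
    integralTorus (fun x => fderiv ℝ φ.1 x (Pi.single i 1)) = 0 := by
  classical
  have hd : Differentiable ℝ φ.1 := φ.2.1.differentiable (by simp)
  have hc : Continuous (fderiv ℝ φ.1) := φ.2.1.continuous_fderiv (by simp)
  have key := MeasureTheory.integral_divergence_of_hasFDerivAt_off_countable' (E := ℂ)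
    (-1 : Fin (2 + 1) → ℝ) 1 (by intro j; simp)
    (fun j x => if j = i then φ.1 x else 0) (fun j x => if j = i then fderiv ℝ φ.1 x else 0)
    ∅ Set.countable_empty
    (by
      intro j
      by_cases h : j = i
      · simpa [h] using (continuous_torus φ).continuousOn
      · simpa [h] using continuousOn_const)
    (by
      intro x _ j
      by_cases h : j = i
      · simpa [h] using (hd x).hasFDerivAt
      · simpa [h] using hasFDerivAt_const (0 : ℂ) x)
    (by
      apply integrableOn_torus
      refine continuous_finsetSum _ fun j _ => ?_
      by_cases h : j = i
      · simpa [h] using hc.clm_apply continuous_const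
      · simpa [h] using continuous_const)
  have e1 : ∀ x : Pt, (∑ j : Fin 3, (if j = i then fderiv ℝ φ.1 x else 0) (Pi.single j 1))
      = fderiv ℝ φ.1 x (Pi.single i 1) := by
    intro x
    rw [Finset.sum_eq_single i]
    · simp
    · intro j _ hj
      simp [hj]
    · simp
  unfold integralTorus
  simp only [e1] at key
  rw [key]
  refine Finset.sum_eq_zero fun j _ => ?_
  by_cases h : j = i
  · subst h
    simp only [if_true]
    rw [sub_eq_zero]
    congr 1
    funext y
    have := φ.2.2 (j.insertNth ((-1 : Fin 3 → ℝ) j) y) (Pi.single j 1)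
    rw [← this]
    have e2 : (j.insertNth ((1 : Fin 3 → ℝ) j) y : Fin 3 → ℝ) =
        (j.insertNth ((-1 : Fin 3 → ℝ) j) y : Fin 3 → ℝ) +
          fun i => 2 * ((Pi.single j 1 : Freq) i : ℝ) := by
      funext l
      refine Fin.succAboveCases j ?_ (fun l => ?_) l
      · simp; norm_num
      · simp
    exact congrArg φ.1 e2
  · simp [h]

/-- The partial derivative of a test function. -/
noncomputable def partialDeriv (φ : SmoothTorus) (i : Fin 3) : SmoothTorus :=
  ⟨fun x => fderiv ℝ φ.1 x (Pi.single i 1), by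
    constructor
    · exact (φ.2.1.fderiv_right (m := ∞) (by simp)).clm_apply contDiff_const
    · intro x k
      have : (fun y => φ.1 (y + fun i => 2 * (k i : ℝ))) = φ.1 := funext fun y => φ.2.2 y k
      have h2 := fderiv_comp_add_right (𝕜 := ℝ) (f := φ.1) (x := x) (fun i => 2 * (k i : ℝ))
      rw [this] at h2
      simp only [h2]⟩

/-- The pointwise product of test functions. -/
noncomputable def mulTorus (φ ψ : SmoothTorus) : SmoothTorus :=
  ⟨fun x => φ.1 x * ψ.1 x, φ.2.1.mul ψ.2.1, fun x k => by simp [φ.2.2 x k, ψ.2.2 x k]⟩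

lemma hasFDerivAt_char (k : Freq) (x : Pt) :
    HasFDerivAt (char k).1 ((char k).1 x •
      ((Complex.I * (Real.pi : ℂ)) • Complex.ofRealCLM.comp (phase k))) x := by
  have h1 : HasFDerivAt (fun x : Pt => ((∑ i, (k i : ℝ) * x i : ℝ) : ℂ))
      (Complex.ofRealCLM.comp (phase k)) x := by
    have := (Complex.ofRealCLM.comp (phase k)).hasFDerivAt (x := x)
    convert this using 2 with y
    simp [phase_apply]
  exact (h1.const_mul (Complex.I * (Real.pi : ℂ))).cexp

lemma phase_single (k : Freq) (i : Fin 3) : phase k (Pi.single i 1) = k i := by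
  simp [phase_apply, Pi.single_apply]

lemma integralTorus_char_partial (φ : SmoothTorus) (k : Freq) (i : Fin 3) :
    integralTorus (fun x => (char k).1 x * (partialDeriv φ i).1 x) =
      -(Complex.I * Real.pi * k i) * integralTorus (fun x => (char k).1 x * φ.1 x) := by
  have hd : Differentiable ℝ φ.1 := φ.2.1.differentiable (by simp)
  have h0 := integralTorus_deriv (mulTorus (char k) φ) i
  have e : (fun x => fderiv ℝ (mulTorus (char k) φ).1 x (Pi.single i 1)) = fun x =>
      (char k).1 x * (partialDeriv φ i).1 x +
        (Complex.I * Real.pi * k i) * ((char k).1 x * φ.1 x) := by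
    funext x
    have := ((hasFDerivAt_char k x).mul (hd x).hasFDerivAt).fderiv
    simp only [mulTorus]
    erw [this]
    simp [partialDeriv, phase_single]
    ring
  rw [e] at h0
  unfold integralTorus at *
  rw [MeasureTheory.integral_add, MeasureTheory.integral_const_mul] at h0
  · linear_combination h0
  · exact integrableOn_torus ((continuous_torus (char k)).mul (continuous_torus (partialDeriv φ i)))
  · exact integrableOn_torus (continuous_const.mul ((continuous_torus (char k)).mul (continuous_torus φ)))

lemma norm_iteratedFDeriv_partial_le (φ : SmoothTorus) (i : Fin 3) (p : ℕ) (x : Pt) :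
    ‖iteratedFDeriv ℝ p (partialDeriv φ i).1 x‖ ≤ ‖iteratedFDeriv ℝ (p + 1) φ.1 x‖ := by
  have h : ContDiff ℝ ∞ (fderiv ℝ φ.1) := φ.2.1.fderiv_right (m := ∞) (by simp)
  have := norm_iteratedFDeriv_clm_apply_const (𝕜 := ℝ) (f := fderiv ℝ φ.1) (c := Pi.single i 1)
    (x := x) (N := ∞) (n := p) h.contDiffAt (by exact_mod_cast le_top)
  rw [norm_iteratedFDeriv_fderiv] at this
  refine this.trans ?_
  simp [Pi.norm_single]

lemma norm_integralTorus_char_pow (k : Freq) (i : Fin 3) (p : ℕ) :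
    ∀ (φ : SmoothTorus) (M : ℝ), (∀ x : Pt, ‖iteratedFDeriv ℝ p φ.1 x‖ ≤ M) →
      (Real.pi * |(k i : ℝ)|) ^ p * ‖integralTorus (fun x => (char k).1 x * φ.1 x)‖ ≤ 8 * M := by
  induction p with
  | zero =>
    intro φ M hM
    simp only [pow_zero, one_mul]
    refine norm_integralTorus_le _ _ fun x => ?_
    rw [norm_mul, norm_char, one_mul]
    simpa using hM x
  | succ p ih =>
    intro φ M hM
    have := ih (partialDeriv φ i) M fun x => (norm_iteratedFDeriv_partial_le φ i p x).trans (hM x)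
    rw [integralTorus_char_partial] at this
    have e : ‖-(Complex.I * Real.pi * k i)‖ = Real.pi * |(k i : ℝ)| := by
      simp [abs_of_pos Real.pi_pos]
    rw [norm_mul, e] at this
    calc _ = _ := by ring
      _ ≤ _ := this

/-- Rapid decay of the Fourier coefficients of a test function. -/
lemma norm_integralTorus_char_le (m : ℕ) (k : Freq) (φ : SmoothTorus) (M : ℝ)
    (hM : ∀ i ≤ m, ∀ x : Pt, ‖iteratedFDeriv ℝ i φ.1 x‖ ≤ M) :
    (1 + ‖k‖) ^ m * ‖integralTorus (fun x => (char k).1 x * φ.1 x)‖ ≤ 2 ^ m * 16 * M := by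
  set I := ‖integralTorus (fun x => (char k).1 x * φ.1 x)‖
  have hI : 0 ≤ I := norm_nonneg _
  have h0 : I ≤ 8 * M := by simpa using norm_integralTorus_char_pow k 0 0 φ M (hM 0 (by simp))
  obtain ⟨i, hi⟩ : ∃ i, ‖k‖ = |(k i : ℝ)| := by
    obtain ⟨i, hi⟩ := Finite.exists_max (fun i => ‖k i‖)
    refine ⟨i, le_antisymm ?_ ?_⟩
    · exact (pi_norm_le_iff_of_nonneg (norm_nonneg (k i))).2 hi
    · exact norm_le_pi_norm k i
  have h1 := norm_integralTorus_char_pow k i m φ M (hM m le_rfl)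
  have h2 : ‖k‖ ^ m * I ≤ 8 * M := by
    refine le_trans ?_ h1
    gcongr
    rw [hi]
    nlinarith [abs_nonneg (k i : ℝ), Real.pi_gt_three]
  have h3 : (1 + ‖k‖) ^ m ≤ 2 ^ m * (1 + ‖k‖ ^ m) := by
    have hk := norm_nonneg k
    rcases le_total ‖k‖ 1 with h | h
    · calc (1 + ‖k‖) ^ m ≤ 2 ^ m := by gcongr; linarith
        _ ≤ _ := by nlinarith [pow_nonneg hk m, pow_pos (two_pos (α := ℝ)) m]
    · calc (1 + ‖k‖) ^ m ≤ (2 * ‖k‖) ^ m := by gcongr; linarith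
        _ ≤ _ := by rw [mul_pow]; nlinarith [pow_pos (two_pos (α := ℝ)) m]
  calc (1 + ‖k‖) ^ m * I ≤ 2 ^ m * (1 + ‖k‖ ^ m) * I := by gcongr
    _ = 2 ^ m * (I + ‖k‖ ^ m * I) := by ring
    _ ≤ 2 ^ m * (8 * M + 8 * M) := by gcongr
    _ = _ := by ring

lemma norm_iteratedFDeriv_char_le (k : Freq) (p : ℕ) (x : Pt) :
    ‖iteratedFDeriv ℝ p (char k).1 x‖ ≤ (10 * (1 + ‖k‖)) ^ p := by
  have hph : ‖phase k‖ ≤ 3 * ‖k‖ := by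
    refine ContinuousLinearMap.opNorm_le_bound _ (by positivity) fun y => ?_
    rw [phase_apply]
    refine (norm_sum_le _ _).trans ?_
    calc ∑ i : Fin 3, ‖(k i : ℝ) * y i‖ ≤ ∑ i : Fin 3, ‖k‖ * ‖y‖ := by
          refine Finset.sum_le_sum fun i _ => ?_
          rw [norm_mul]
          exact mul_le_mul (norm_le_pi_norm k i) (norm_le_pi_norm y i) (norm_nonneg _)
            (norm_nonneg _)
      _ = 3 * ‖k‖ * ‖y‖ := by simp; ring
  set g : ℝ → ℂ := fun s => Complex.exp (Complex.I * Real.pi * s) with hg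
  have hgc : ContDiff ℝ ∞ g := (contDiff_const.mul Complex.ofRealCLM.contDiff).cexp
  have hgd : ∀ q : ℕ, iteratedDeriv q g = fun s => (Complex.I * Real.pi) ^ q * g s := by
    intro q
    induction q with
    | zero => simp
    | succ q ih =>
      rw [iteratedDeriv_succ, ih]
      funext s
      have h1 : HasDerivAt g (g s * (Complex.I * Real.pi * 1)) s :=
        ((Complex.ofRealCLM.hasDerivAt (x := s)).const_mul (Complex.I * Real.pi)).cexp
      rw [(h1.const_mul _).deriv]
      ring
  have e : (char k).1 = g ∘ phase k := by
    funext y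
    simp [char, hg, phase_apply]
  rw [e, (phase k).iteratedFDeriv_comp_right hgc x (i := p) (by exact_mod_cast le_top)]
  refine (ContinuousMultilinearMap.norm_compContinuousLinearMap_le _ _).trans ?_
  rw [norm_iteratedFDeriv_eq_norm_iteratedDeriv, hgd]
  have h1 : ‖g (phase k x)‖ = 1 := by
    have : g (phase k x) = Complex.exp (((Real.pi * phase k x : ℝ) : ℂ) * Complex.I) := by
      simp only [hg]
      congr 1
      push_cast
      ring
    rw [this, Complex.norm_exp_ofReal_mul_I]
  rw [norm_mul, h1, norm_pow]
  simp only [Complex.norm_mul, Complex.norm_I, Complex.norm_real, Real.norm_eq_abs,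
    abs_of_pos Real.pi_pos, Finset.prod_const, Finset.card_univ, Fintype.card_fin, mul_one, one_mul]
  rw [← mul_pow]
  have := Real.pi_lt_d2
  have h3 := norm_nonneg k
  refine pow_le_pow_left₀ (by positivity) ?_ p
  nlinarith [Real.pi_pos, norm_nonneg (phase k)]

/-- The Fourier coefficients of a distribution grow at most polynomially. -/
lemma exists_norm_distCoeff_le (u : TorusDistribution) :
    ∃ (m : ℕ) (C : ℝ), 0 ≤ C ∧ ∀ k, ‖distCoeff u k‖ ≤ C * (1 + ‖k‖) ^ m := by
  obtain ⟨m, C, h⟩ := u.2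
  refine ⟨m, |C| * 10 ^ m, by positivity, fun k => ?_⟩
  have hk := norm_nonneg k
  have h1 := h (char (-k)) ((10 * (1 + ‖k‖)) ^ m) fun i hi x => by
    refine (norm_iteratedFDeriv_char_le (-k) i x).trans ?_
    rw [norm_neg]
    exact pow_le_pow_right₀ (by linarith) hi
  unfold distCoeff
  rw [norm_mul]
  have h2 : ‖(1 / 8 : ℂ)‖ ≤ 1 := by norm_num
  calc ‖(1 / 8 : ℂ)‖ * ‖u.1 (char (-k))‖ ≤ 1 * ‖u.1 (char (-k))‖ := by gcongr
    _ ≤ C * (10 * (1 + ‖k‖)) ^ m := by rw [one_mul]; exact h1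
    _ ≤ |C| * (10 * (1 + ‖k‖)) ^ m := by gcongr; exact le_abs_self C
    _ = _ := by rw [mul_pow]; ring

lemma summable_freq : Summable fun k : Freq => ((1 + ‖k‖) ^ 6)⁻¹ := by
  have h1 : Summable fun n : ℤ => ((1 + |(n : ℝ)|) ^ 2)⁻¹ := by
    have hN : Summable fun n : ℕ => ((1 + (n : ℝ)) ^ 2)⁻¹ := by
      have := (summable_nat_add_iff 1).2 (Real.summable_nat_pow_inv.2 (by norm_num : 1 < 2))
      refine this.congr fun n => ?_
      push_cast
      rw [add_comm]
    refine Summable.of_nat_of_neg (by simpa using hN) (by simpa using hN)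
  have h2 := (h1.mul_of_nonneg (h1.mul_of_nonneg h1 (fun n => by positivity)
    (fun n => by positivity)) (fun n => by positivity) (fun n => by positivity))
  have h3 : Function.Injective fun k : Freq => (k 0, (k 1, k 2)) := by
    intro k l h
    simp only [Prod.mk.injEq] at h
    funext i
    fin_cases i
    · exact h.1
    · exact h.2.1
    · exact h.2.2
  refine Summable.of_nonneg_of_le (fun k => by positivity) (fun k => ?_) (h2.comp_injective h3)
  simp only [Function.comp]
  rw [← mul_inv, ← mul_inv]
  have hk : ∀ i, |(k i : ℝ)| ≤ ‖k‖ := fun i => norm_le_pi_norm k i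
  apply inv_anti₀ (by positivity)
  calc _ ≤ (1 + ‖k‖) ^ 2 * ((1 + ‖k‖) ^ 2 * (1 + ‖k‖) ^ 2) := by
        gcongr <;> exact hk _
    _ = _ := by ring

/-! ### Fourier multipliers -/

lemma exists_multiplier_bound (m : Freq → ℂ) (hm : ∃ C : ℝ, ∀ k, ‖m k‖ ≤ C)
    (u : TorusDistribution) : ∃ (p : ℕ) (C : ℝ), 0 ≤ C ∧ ∀ (φ : SmoothTorus) (M : ℝ),
      (∀ i ≤ p, ∀ x : Pt, ‖iteratedFDeriv ℝ i φ.1 x‖ ≤ M) → ∀ k,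
      ‖m k * distCoeff u k * integralTorus (fun x => (char k).1 x * φ.1 x)‖
        ≤ C * M * ((1 + ‖k‖) ^ 6)⁻¹ := by
  obtain ⟨A, hA⟩ := hm
  obtain ⟨p, C, hC, h⟩ := exists_norm_distCoeff_le u
  refine ⟨p + 6, |A| * C * (2 ^ (p + 6) * 16), by positivity, fun φ M hM k => ?_⟩
  have h1 := norm_integralTorus_char_le (p + 6) k φ M hM
  set J := ‖integralTorus (fun x => (char k).1 x * φ.1 x)‖
  have hk : 0 < 1 + ‖k‖ := by positivity
  rw [norm_mul, norm_mul, ← div_eq_mul_inv, le_div_iff₀ (by positivity)]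
  calc ‖m k‖ * ‖distCoeff u k‖ * J * (1 + ‖k‖) ^ 6
      ≤ |A| * (C * (1 + ‖k‖) ^ p) * J * (1 + ‖k‖) ^ 6 := by
        gcongr
        · exact (hA k).trans (le_abs_self A)
        · exact h k
    _ = |A| * C * ((1 + ‖k‖) ^ (p + 6) * J) := by ring
    _ ≤ |A| * C * (2 ^ (p + 6) * 16 * M) := by gcongr
    _ = _ := by ring

lemma exists_deriv_bound (φ : SmoothTorus) (p : ℕ) :
    ∃ M : ℝ, ∀ i ≤ p, ∀ x : Pt, ‖iteratedFDeriv ℝ i φ.1 x‖ ≤ M := by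
  have h1 : ∀ i : ℕ, ∃ M : ℝ, ∀ x : Pt, ‖iteratedFDeriv ℝ i φ.1 x‖ ≤ M := by
    intro i
    have hc : Continuous (iteratedFDeriv ℝ i φ.1) :=
      φ.2.1.continuous_iteratedFDeriv (by exact_mod_cast le_top)
    obtain ⟨M, hM⟩ := (isCompact_Icc (a := (-1 : Pt)) (b := 1)).exists_bound_of_continuousOn
      hc.continuousOn
    refine ⟨M, fun x => ?_⟩
    set k : Freq := fun j => -⌊(x j + 1) / 2⌋ with hk
    have hper : (fun y => φ.1 (y + fun i => 2 * (k i : ℝ))) = φ.1 := funext fun y => φ.2.2 y k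
    rw [← hper, iteratedFDeriv_comp_add_right]
    refine hM _ ⟨fun j => ?_, fun j => ?_⟩
    · have := Int.floor_le ((x j + 1) / 2)
      simp only [hk, Pi.add_apply, Pi.neg_apply, Pi.one_apply]
      push_cast
      linarith
    · have := Int.lt_floor_add_one ((x j + 1) / 2)
      simp only [hk, Pi.add_apply, Pi.one_apply]
      push_cast
      linarith
  choose M hM using h1
  refine ⟨∑ i ∈ Finset.range (p + 1), |M i|, fun i hi x => (hM i x).trans ((le_abs_self _).trans ?_)⟩
  exact Finset.single_le_sum (f := fun i => |M i|) (fun i _ => abs_nonneg _)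
    (Finset.mem_range.2 (by omega))

lemma integralTorus_mul_add (f φ ψ : SmoothTorus) :
    integralTorus (fun x => f.1 x * (φ + ψ).1 x) =
      integralTorus (fun x => f.1 x * φ.1 x) + integralTorus (fun x => f.1 x * ψ.1 x) := by
  unfold integralTorus
  have h := MeasureTheory.integral_add
    (f := fun x => f.1 x * φ.1 x) (g := fun x => f.1 x * ψ.1 x)
    (integrableOn_torus ((continuous_torus f).mul (continuous_torus φ)))
    (integrableOn_torus ((continuous_torus f).mul (continuous_torus ψ)))
  rw [← h]
  congr 1
  funext x
  simp [mul_add]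

lemma integralTorus_mul_smul (f : SmoothTorus) (c : ℂ) (φ : SmoothTorus) :
    integralTorus (fun x => f.1 x * (c • φ).1 x) =
      c * integralTorus (fun x => f.1 x * φ.1 x) := by
  unfold integralTorus
  rw [← MeasureTheory.integral_const_mul]
  congr 1
  funext x
  simp
  ring

/-- A functional given by an absolutely convergent series of integrals against smooth functions. -/
noncomputable def ofSeries {ι : Type} (c : ι → ℂ) (f : ι → SmoothTorus) (w : ι → ℝ)
    (hw : Summable w)
    (h : ∃ (p : ℕ) (C : ℝ), ∀ (φ : SmoothTorus) (M : ℝ),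
      (∀ i ≤ p, ∀ x : Pt, ‖iteratedFDeriv ℝ i φ.1 x‖ ≤ M) → ∀ k,
      ‖c k * integralTorus (fun x => (f k).1 x * φ.1 x)‖ ≤ C * M * w k) : TorusDistribution :=
  have hs : ∀ φ : SmoothTorus,
      Summable fun k => c k * integralTorus (fun x => (f k).1 x * φ.1 x) := by
    obtain ⟨p, C, h⟩ := h
    intro φ
    obtain ⟨M, hM⟩ := exists_deriv_bound φ p
    exact Summable.of_norm_bounded (hw.mul_left (C * M)) (h φ M hM)
  ⟨{ toFun := fun φ => ∑' k, c k * integralTorus (fun x => (f k).1 x * φ.1 x)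
     map_add' := fun φ ψ => by
      rw [← (hs φ).tsum_add (hs ψ)]
      congr 1
      funext k
      rw [integralTorus_mul_add, mul_add]
     map_smul' := fun a φ => by
      rw [RingHom.id_apply, smul_eq_mul, ← tsum_mul_left]
      congr 1
      funext k
      rw [integralTorus_mul_smul]
      ring }, by
    obtain ⟨p, C, h⟩ := h
    refine ⟨p, C * ∑' k, w k, fun φ M hM => ?_⟩
    have := tsum_of_norm_bounded (hw.hasSum.mul_left (C * M)) (h φ M hM)
    calc _ ≤ _ := this
      _ = _ := by ring⟩

/-- The Fourier multiplier `m(D) u = ∑ₖ m(k) û(k) exp (i π k · x)`, as a distribution: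
its value at `φ` is `∑ₖ m(k) û(k) ∫ exp (i π k · x) φ(x) dx`. -/
noncomputable def multiplier (m : Freq → ℂ) (hm : ∃ C : ℝ, ∀ k, ‖m k‖ ≤ C)
    (u : TorusDistribution) : TorusDistribution :=
  ofSeries (fun k => m k * distCoeff u k) char _ summable_freq (by
    obtain ⟨p, C, _, h⟩ := exists_multiplier_bound m hm u
    exact ⟨p, C, h⟩)

/-! ### Littlewood-Paley theory -/

/-- Dyadic partitions of unity `(χ, θ)` on `ℝ³`. -/
structure DyadicPartition where
  χ : E3 → ℝ
  θ : E3 → ℝ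
  smooth_χ : ContDiff ℝ ∞ χ
  smooth_θ : ContDiff ℝ ∞ θ
  nonneg_χ : ∀ ξ, 0 ≤ χ ξ
  nonneg_θ : ∀ ξ, 0 ≤ θ ξ
  radial_χ : ∀ ξ η, ‖ξ‖ = ‖η‖ → χ ξ = χ η
  radial_θ : ∀ ξ η, ‖ξ‖ = ‖η‖ → θ ξ = θ η
  ball_χ : ∃ R : ℝ, tsupport χ ⊆ {ξ | ‖ξ‖ ≤ R}
  annulus_θ : ∃ a b : ℝ, 0 < a ∧ tsupport θ ⊆ {ξ | a ≤ ‖ξ‖ ∧ ‖ξ‖ ≤ b}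
  sum_eq_one : ∀ ξ, HasSum (fun j : ℕ => θ (((2 : ℝ) ^ j)⁻¹ • ξ)) (1 - χ ξ)
  disjoint_χ : ∀ j : ℕ, 1 ≤ j →
    Disjoint (tsupport χ) (tsupport fun ξ => θ (((2 : ℝ) ^ j)⁻¹ • ξ))
  disjoint_θ : ∀ i j : ℕ, i + 1 < j →
    Disjoint (tsupport fun ξ => θ (((2 : ℝ) ^ i)⁻¹ • ξ))
      (tsupport fun ξ => θ (((2 : ℝ) ^ j)⁻¹ • ξ))

namespace DyadicPartition

variable (D : DyadicPartition)

/-- The symbol of the Littlewood-Paley block `Δ_{n-1}`: it is `χ` for `n = 0` and `θ(2^{-j} ·)` for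
`n = j + 1`. All dyadic indices are shifted by one in this way. -/
noncomputable def symbol : ℕ → E3 → ℝ
  | 0 => D.χ
  | j + 1 => fun ξ => D.θ (((2 : ℝ) ^ j)⁻¹ • ξ)

/-- The Littlewood-Paley block `Δ_{n-1} u = ∑ₖ ρ_{n-1}(k) û(k) exp (i π k · x)`, a finite sum. -/
noncomputable def block (n : ℕ) (u : TorusDistribution) : SmoothTorus :=
  ∑ᶠ k : Freq, ((D.symbol n k.toE3 : ℂ) * distCoeff u k) • char k

/-- The Hölder-Besov norm `‖u‖_α = sup_{j ≥ -1} 2^{jα} ‖Δ_j u‖_{L^∞}` of `𝒞^α = B^α_{∞,∞}(𝕋³)`.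
The blocks are continuous functions, so their `L^∞` norms are suprema. -/
noncomputable def besovNorm (α : ℝ) (u : TorusDistribution) : ℝ≥0∞ :=
  ⨆ n : ℕ, ENNReal.ofReal ((2 : ℝ) ^ (((n : ℝ) - 1) * α)) * ⨆ x : Pt, ‖(D.block n u).1 x‖ₑ

/-- `S_{j-1} u = ∑_{i < j-1} Δ_i u` for `j = n - 1`. -/
noncomputable def lowPart (n : ℕ) (u : TorusDistribution) : SmoothTorus :=
  ∑ m ∈ Finset.range (n - 1), D.block m u

lemma symbol_nonneg (n : ℕ) (ξ : E3) : 0 ≤ D.symbol n ξ := by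
  cases n with
  | zero => exact D.nonneg_χ ξ
  | succ j => exact D.nonneg_θ _

lemma symbol_le_one (n : ℕ) (ξ : E3) : D.symbol n ξ ≤ 1 := by
  have h := D.sum_eq_one ξ
  cases n with
  | zero =>
    have := h.nonneg fun j => D.nonneg_θ _
    simp only [symbol]
    linarith
  | succ j =>
    have := le_hasSum h j fun i _ => D.nonneg_θ _
    have h2 := D.nonneg_χ ξ
    simp only [symbol]
    linarith

lemma symbol_neg (n : ℕ) (ξ : E3) : D.symbol n (-ξ) = D.symbol n ξ := by
  cases n with
  | zero => exact D.radial_χ _ _ (norm_neg ξ)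
  | succ j => exact D.radial_θ _ _ (by simp)

lemma exists_norm_le : ∃ B : ℝ, 0 < B ∧ ∀ n ξ, D.symbol n ξ ≠ 0 → ‖ξ‖ ≤ B * 2 ^ n := by
  obtain ⟨R, hR⟩ := D.ball_χ
  obtain ⟨a, b, ha, hab⟩ := D.annulus_θ
  refine ⟨max (max R b) 1, by positivity, fun n ξ h => ?_⟩
  cases n with
  | zero =>
    have : ‖ξ‖ ≤ R := hR (subset_tsupport _ h)
    simp only [pow_zero, mul_one]
    exact this.trans ((le_max_left _ _).trans (le_max_left _ _))
  | succ j =>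
    have h1 := (hab (subset_tsupport _ h)).2
    rw [norm_smul, norm_inv, norm_pow, Real.norm_ofNat, inv_mul_le_iff₀ (by positivity)] at h1
    have h2 : (2 : ℝ) ^ (j + 1) = 2 * 2 ^ j := by ring
    have h3 : (0 : ℝ) < 2 ^ j := by positivity
    have h4 : b ≤ max (max R b) 1 := (le_max_right _ _).trans (le_max_left _ _)
    have h5 : 1 ≤ max (max R b) 1 := le_max_right _ _
    rw [h2]
    nlinarith

lemma exists_le_norm : ∃ a : ℝ, 0 < a ∧ ∀ j ξ, D.symbol (j + 1) ξ ≠ 0 → a * 2 ^ j ≤ ‖ξ‖ := by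
  obtain ⟨a, b, ha, hab⟩ := D.annulus_θ
  refine ⟨a, ha, fun j ξ h => ?_⟩
  have h1 := (hab (subset_tsupport _ h)).1
  rw [norm_smul, norm_inv, norm_pow, Real.norm_ofNat, le_inv_mul_iff₀ (by positivity)] at h1
  linarith

lemma exists_separation {f g : E3 → ℝ} (hf : ∃ R : ℝ, tsupport f ⊆ {ξ | ‖ξ‖ ≤ R})
    (hfg : Disjoint (tsupport f) (tsupport g)) :
    ∃ r : ℝ, 0 < r ∧ ∀ ξ η, f ξ ≠ 0 → g η ≠ 0 → r ≤ ‖ξ - η‖ := by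
  obtain ⟨R, hR⟩ := hf
  have hc : IsCompact (tsupport f) := by
    refine (isCompact_closedBall (0 : E3) R).of_isClosed_subset (isClosed_tsupport f) ?_
    intro ξ hξ
    simpa using hR hξ
  obtain ⟨r, hr, h⟩ := Metric.exists_pos_forall_lt_edist hc (isClosed_tsupport g) hfg
  refine ⟨r, hr, fun ξ η h1 h2 => ?_⟩
  have := h ξ (subset_tsupport _ h1) η (subset_tsupport _ h2)
  rw [edist_nndist, ENNReal.coe_lt_coe] at this
  rw [← dist_eq_norm]
  exact_mod_cast this.le

lemma exists_separation_step (d : ℕ) : ∃ c : ℝ, 0 < c ∧ ∀ m ξ η,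
    D.symbol m ξ ≠ 0 → D.symbol (m + d + 2) η ≠ 0 → c * 2 ^ m ≤ ‖ξ + η‖ := by
  obtain ⟨r, hr, h⟩ := exists_separation D.ball_χ (D.disjoint_χ (d + 1) (by omega))
  obtain ⟨a, b, ha, hab⟩ := D.annulus_θ
  have h0 := D.disjoint_θ 0 (d + 2) (by omega)
  simp only [pow_zero, inv_one, one_smul] at h0
  obtain ⟨s, hs, h'⟩ := exists_separation ⟨b, fun ξ hξ => (hab hξ).2⟩ h0
  refine ⟨min r (s / 2), by positivity, fun m ξ η h1 h2 => ?_⟩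
  rw [← D.symbol_neg] at h2
  cases m with
  | zero =>
    have := h ξ (-η) h1 (by simpa [symbol] using h2)
    rw [sub_neg_eq_add] at this
    simp only [pow_zero, mul_one]
    exact (min_le_left _ _).trans this
  | succ i =>
    have e : i + 1 + d + 2 = (i + (d + 2)) + 1 := by omega
    rw [e] at h2
    have := h' (((2 : ℝ) ^ i)⁻¹ • ξ) (((2 : ℝ) ^ i)⁻¹ • (-η)) h1 (by
      simp only [symbol] at h2
      rwa [smul_smul, ← mul_inv, ← pow_add, add_comm (d + 2) i])
    rw [← smul_sub, sub_neg_eq_add, norm_smul, norm_inv, norm_pow, Real.norm_ofNat,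
      le_inv_mul_iff₀ (by positivity)] at this
    have h3 : min r (s / 2) ≤ s / 2 := min_le_right _ _
    have h4 : (0 : ℝ) < 2 ^ i := by positivity
    rw [pow_succ]
    nlinarith

/-- The products `S_{j-1} u Δ_j v` have their Fourier support in an annulus of size `2^j`. -/
lemma exists_annulus : ∃ c : ℝ, 0 < c ∧ ∀ m n ξ η, m + 1 < n →
    D.symbol m ξ ≠ 0 → D.symbol n η ≠ 0 → c * 2 ^ n ≤ ‖ξ + η‖ := by
  obtain ⟨B, hB, hB'⟩ := D.exists_norm_le
  obtain ⟨a, ha, ha'⟩ := D.exists_le_norm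
  have step : ∀ K : ℕ, ∃ c : ℝ, 0 < c ∧ ∀ d < K, ∀ m ξ η,
      D.symbol m ξ ≠ 0 → D.symbol (m + d + 2) η ≠ 0 → c * 2 ^ m ≤ ‖ξ + η‖ := by
    intro K
    induction K with
    | zero => exact ⟨1, one_pos, fun d hd => absurd hd (by omega)⟩
    | succ K ih =>
      obtain ⟨c, hc, h⟩ := ih
      obtain ⟨c', hc', h'⟩ := D.exists_separation_step K
      refine ⟨min c c', by positivity, fun d hd m ξ η h1 h2 => ?_⟩
      rcases Nat.lt_succ_iff_lt_or_eq.1 hd with hd | rfl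
      · refine le_trans ?_ (h d hd m ξ η h1 h2)
        gcongr
        exact min_le_left _ _
      · refine le_trans ?_ (h' m ξ η h1 h2)
        gcongr
        exact min_le_right _ _
  obtain ⟨K, hK⟩ := pow_unbounded_of_one_lt (B / a) (one_lt_two (α := ℝ))
  rw [div_lt_iff₀ ha] at hK
  obtain ⟨c, hc, h⟩ := step K
  refine ⟨min (c / 2 ^ (K + 2)) (a / 4), by positivity, fun m n ξ η hmn h1 h2 => ?_⟩
  obtain ⟨d, rfl⟩ : ∃ d, n = m + d + 2 := ⟨n - m - 2, by omega⟩
  rcases lt_or_ge d K with hd | hd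
  · refine le_trans ?_ (h d hd m ξ η h1 h2)
    calc min (c / 2 ^ (K + 2)) (a / 4) * 2 ^ (m + d + 2)
        ≤ c / 2 ^ (K + 2) * 2 ^ (m + (K + 2)) := by
          have h3 : (2 : ℝ) ^ (m + d + 2) ≤ 2 ^ (m + (K + 2)) :=
            pow_le_pow_right₀ one_le_two (by omega)
          gcongr
          exact min_le_left _ _
      _ = c * 2 ^ m := by rw [pow_add 2 m (K + 2)]; field_simp
  · have h3 := hB' m ξ h1
    have h4 := ha' (m + d + 1) η h2
    have h5 : ‖η‖ ≤ ‖ξ + η‖ + ‖ξ‖ := by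
      have := norm_sub_le (ξ + η) ξ
      simpa using this
    have h6 : B * 2 ^ m ≤ a * 2 ^ (m + d) := by
      have : (2 : ℝ) ^ K ≤ 2 ^ d := pow_le_pow_right₀ one_le_two hd
      rw [pow_add]
      have h7 : (0 : ℝ) < 2 ^ m := by positivity
      have h8 : B ≤ a * 2 ^ d := by nlinarith
      nlinarith
    have h9 : min (c / 2 ^ (K + 2)) (a / 4) * 2 ^ (m + d + 2) ≤ a / 4 * 2 ^ (m + d + 2) := by
      gcongr
      exact min_le_right _ _
    have e1 : (2 : ℝ) ^ (m + d + 2) = 4 * 2 ^ (m + d) := by ring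
    have e2 : (2 : ℝ) ^ (m + d + 1) = 2 * 2 ^ (m + d) := by ring
    rw [e1] at h9 ⊢
    rw [e2] at h4
    linarith

end DyadicPartition

lemma norm_le_norm_toE3 (k : Freq) : ‖k‖ ≤ ‖k.toE3‖ :=
  (pi_norm_le_iff_of_nonneg (norm_nonneg _)).2 fun i => PiLp.norm_apply_le k.toE3 i

lemma norm_toE3_le (k : Freq) : ‖k.toE3‖ ≤ 2 * ‖k‖ := by
  rw [EuclideanSpace.norm_eq]
  refine Real.sqrt_le_iff.2 ⟨by positivity, ?_⟩
  have hk : ∀ i, ‖k.toE3 i‖ ^ 2 ≤ ‖k‖ ^ 2 := fun i => by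
    gcongr
    exact norm_le_pi_norm k i
  rw [Fin.sum_univ_three]
  nlinarith [hk 0, hk 1, hk 2, norm_nonneg k]

lemma toE3_add (k l : Freq) : (k + l).toE3 = k.toE3 + l.toE3 := by
  ext i
  simp [Freq.toE3]

namespace DyadicPartition

variable (D : DyadicPartition)

lemma finite_freq (n : ℕ) : {k : Freq | D.symbol n k.toE3 ≠ 0}.Finite := by
  obtain ⟨B, hB, h⟩ := D.exists_norm_le
  obtain ⟨K, hK⟩ := exists_nat_ge (B * 2 ^ n)
  refine (Set.finite_Icc (fun _ => -(K : ℤ)) (fun _ => (K : ℤ))).subset fun k hk => ?_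
  have h1 : ∀ i, |k i| ≤ (K : ℤ) := fun i => by
    have : |(k i : ℝ)| ≤ (K : ℝ) :=
      ((norm_le_pi_norm k i).trans (norm_le_norm_toE3 k)).trans ((h n _ hk).trans hK)
    exact_mod_cast this
  exact ⟨fun i => (abs_le.1 (h1 i)).1, fun i => (abs_le.1 (h1 i)).2⟩

lemma block_eq_sum (n : ℕ) (u : TorusDistribution) : D.block n u =
    ∑ k ∈ (D.finite_freq n).toFinset, ((D.symbol n k.toE3 : ℂ) * distCoeff u k) • char k := by
  refine finsum_eq_sum_of_support_subset _ fun k hk => ?_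
  simp only [Set.Finite.coe_toFinset, Set.mem_ofPred_eq]
  intro h0
  exact hk (by simp [h0])

lemma norm_paraproduct_term_le (u v : TorusDistribution) :
    ∃ (p : ℕ) (C : ℝ), ∀ (φ : SmoothTorus) (M : ℝ),
      (∀ i ≤ p, ∀ x : Pt, ‖iteratedFDeriv ℝ i φ.1 x‖ ≤ M) → ∀ n,
      ‖1 * integralTorus (fun x => (mulTorus (D.lowPart n u) (D.block n v)).1 x * φ.1 x)‖
        ≤ C * M * (1 / 2 : ℝ) ^ n := by
  obtain ⟨p, Cu, hCu, hu⟩ := exists_norm_distCoeff_le u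
  obtain ⟨q, Cv, hCv, hv⟩ := exists_norm_distCoeff_le v
  obtain ⟨B, hB, hB'⟩ := D.exists_norm_le
  obtain ⟨c, hc, hc'⟩ := D.exists_annulus
  set r := p + q + 14 with hr
  set S := ∑' k : Freq, ((1 + ‖k‖) ^ 6)⁻¹ with hS
  have hS0 : 0 ≤ S := tsum_nonneg fun k => by positivity
  set Q := Cu * Cv * (1 + B) ^ (p + q + 12) * (2 ^ r * 16) * ((c / 2) ^ r)⁻¹ with hQ
  have hQ0 : 0 ≤ Q := by positivity
  refine ⟨r, Q * S * S, fun φ M hM n => ?_⟩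
  have hM0 : 0 ≤ M := (norm_nonneg _).trans (hM 0 (by simp) 0)
  -- the bilinear estimate of a single pair of frequencies
  have term : ∀ m, m + 1 < n → ∀ l k : Freq, D.symbol m l.toE3 ≠ 0 → D.symbol n k.toE3 ≠ 0 →
      ‖distCoeff u l‖ * ‖distCoeff v k‖ *
        ‖integralTorus (fun x => (char (l + k)).1 x * φ.1 x)‖ ≤
      Q * M * (((2 : ℝ) ^ n) ^ 2)⁻¹ * ((1 + ‖l‖) ^ 6)⁻¹ * ((1 + ‖k‖) ^ 6)⁻¹ := by
    intro m hm l k hl hk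
    have hX : (1 : ℝ) ≤ 2 ^ n := one_le_pow₀ one_le_two
    have h1 : 1 + ‖l‖ ≤ (1 + B) * 2 ^ n := by
      have h2 := (norm_le_norm_toE3 l).trans (hB' m _ hl)
      have h3 : (2 : ℝ) ^ m ≤ 2 ^ n := pow_le_pow_right₀ one_le_two (by omega)
      nlinarith
    have h2 : 1 + ‖k‖ ≤ (1 + B) * 2 ^ n := by
      have h2 := (norm_le_norm_toE3 k).trans (hB' n _ hk)
      nlinarith
    have h3 : c / 2 * 2 ^ n ≤ 1 + ‖l + k‖ := by
      have h2 := hc' m n _ _ hm hl hk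
      rw [← toE3_add] at h2
      have h4 := norm_toE3_le (l + k)
      linarith
    have h4 := norm_integralTorus_char_le r (l + k) φ M hM
    set J := ‖integralTorus (fun x => (char (l + k)).1 x * φ.1 x)‖
    have hJ : 0 ≤ J := norm_nonneg _
    set X : ℝ := 2 ^ n
    have hX0 : 0 < X := by linarith
    have h5 : X ^ r * J ≤ (2 ^ r * 16 * M) * ((c / 2) ^ r)⁻¹ := by
      rw [← div_eq_mul_inv, le_div_iff₀ (by positivity)]
      calc X ^ r * J * (c / 2) ^ r = (c / 2 * X) ^ r * J := by rw [mul_pow]; ring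
        _ ≤ (1 + ‖l + k‖) ^ r * J := by gcongr
        _ ≤ _ := h4
    have hl0 : 0 < 1 + ‖l‖ := by positivity
    have hk0 : 0 < 1 + ‖k‖ := by positivity
    rw [← div_eq_mul_inv, ← div_eq_mul_inv, ← div_eq_mul_inv, le_div_iff₀ (by positivity),
      le_div_iff₀ (by positivity), le_div_iff₀ (by positivity)]
    calc ‖distCoeff u l‖ * ‖distCoeff v k‖ * J * (1 + ‖k‖) ^ 6 * (1 + ‖l‖) ^ 6 * X ^ 2
        ≤ (Cu * (1 + ‖l‖) ^ p) * (Cv * (1 + ‖k‖) ^ q) * J * (1 + ‖k‖) ^ 6 * (1 + ‖l‖) ^ 6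
            * X ^ 2 := by
          gcongr
          · exact hu l
          · exact hv k
      _ = Cu * Cv * ((1 + ‖l‖) ^ (p + 6) * (1 + ‖k‖) ^ (q + 6)) * (J * X ^ 2) := by ring
      _ ≤ Cu * Cv * (((1 + B) * X) ^ (p + 6) * ((1 + B) * X) ^ (q + 6)) * (J * X ^ 2) := by
          gcongr
      _ = Cu * Cv * (1 + B) ^ (p + q + 12) * (X ^ r * J) := by
          rw [hr, mul_pow, mul_pow]; ring
      _ ≤ Cu * Cv * (1 + B) ^ (p + q + 12) * ((2 ^ r * 16 * M) * ((c / 2) ^ r)⁻¹) := by gcongr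
      _ = Q * M := by rw [hQ]; ring
  -- expansion of the product of trigonometric polynomials
  have expand : integralTorus (fun x => (mulTorus (D.lowPart n u) (D.block n v)).1 x * φ.1 x) =
      ∑ m ∈ Finset.range (n - 1), ∑ l ∈ (D.finite_freq m).toFinset,
        ∑ k ∈ (D.finite_freq n).toFinset,
          ((D.symbol m l.toE3 : ℂ) * distCoeff u l) *
            ((D.symbol n k.toE3 : ℂ) * distCoeff v k) *
              integralTorus (fun x => (char (l + k)).1 x * φ.1 x) := by
    have e : ∀ x, (mulTorus (D.lowPart n u) (D.block n v)).1 x * φ.1 x =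
        ∑ m ∈ Finset.range (n - 1), ∑ l ∈ (D.finite_freq m).toFinset,
        ∑ k ∈ (D.finite_freq n).toFinset,
          ((D.symbol m l.toE3 : ℂ) * distCoeff u l) *
            ((D.symbol n k.toE3 : ℂ) * distCoeff v k) *
              ((char (l + k)).1 x * φ.1 x) := by
      intro x
      simp only [mulTorus, lowPart, block_eq_sum, Submodule.coe_sum, Submodule.coe_smul,
        Finset.sum_apply, Pi.smul_apply, smul_eq_mul, Finset.sum_mul, ← char_mul]
      refine Finset.sum_congr rfl fun m _ => Finset.sum_congr rfl fun l _ => ?_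
      rw [Finset.mul_sum, Finset.sum_mul]
      refine Finset.sum_congr rfl fun k _ => ?_
      ring
    have hi : ∀ (a : ℂ) (k : Freq), MeasureTheory.IntegrableOn
        (fun x => a * ((char k).1 x * φ.1 x)) (Set.Icc (-1 : Pt) 1) := fun a k =>
      integrableOn_torus (continuous_const.mul ((continuous_torus _).mul (continuous_torus φ)))
    unfold integralTorus
    simp only [e]
    rw [MeasureTheory.integral_finsetSum _ fun m _ => MeasureTheory.integrable_finsetSum _
      fun l _ => MeasureTheory.integrable_finsetSum _ fun k _ => hi _ _]
    refine Finset.sum_congr rfl fun m _ => ?_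
    rw [MeasureTheory.integral_finsetSum _ fun l _ => MeasureTheory.integrable_finsetSum _
      fun k _ => hi _ _]
    refine Finset.sum_congr rfl fun l _ => ?_
    rw [MeasureTheory.integral_finsetSum _ fun k _ => hi _ _]
    refine Finset.sum_congr rfl fun k _ => ?_
    rw [MeasureTheory.integral_const_mul]
  rw [one_mul, expand]
  have hsum : ∀ F : Finset Freq, ∑ k ∈ F, ((1 + ‖k‖) ^ 6)⁻¹ ≤ S := fun F =>
    summable_freq.sum_le_tsum F fun k _ => by positivity
  have hn : ((n - 1 : ℕ) : ℝ) ≤ 2 ^ n := by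
    have h1 : n < 2 ^ n := Nat.lt_two_pow_self
    have h2 : n - 1 ≤ 2 ^ n := by omega
    exact_mod_cast h2
  calc _ ≤ ∑ m ∈ Finset.range (n - 1), ∑ l ∈ (D.finite_freq m).toFinset,
        ∑ k ∈ (D.finite_freq n).toFinset,
          Q * M * (((2 : ℝ) ^ n) ^ 2)⁻¹ * ((1 + ‖l‖) ^ 6)⁻¹ * ((1 + ‖k‖) ^ 6)⁻¹ := by
        refine (norm_sum_le _ _).trans (Finset.sum_le_sum fun m hm => ?_)
        refine (norm_sum_le _ _).trans (Finset.sum_le_sum fun l hl => ?_)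
        refine (norm_sum_le _ _).trans (Finset.sum_le_sum fun k hk => ?_)
        refine le_trans ?_ (term m (by have := Finset.mem_range.1 hm; omega) l k
          (by simpa using hl) (by simpa using hk))
        have hs : ∀ n ξ, ‖(D.symbol n ξ : ℂ)‖ ≤ 1 := fun n ξ => by
          rw [Complex.norm_real, Real.norm_of_nonneg (D.symbol_nonneg n ξ)]
          exact D.symbol_le_one n ξ
        rw [norm_mul, norm_mul, norm_mul, norm_mul]
        gcongr
        · exact mul_le_of_le_one_left (norm_nonneg _) (hs _ _)
        · exact mul_le_of_le_one_left (norm_nonneg _) (hs _ _)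
    _ ≤ ∑ m ∈ Finset.range (n - 1), Q * M * (((2 : ℝ) ^ n) ^ 2)⁻¹ * S * S := by
        refine Finset.sum_le_sum fun m _ => ?_
        simp only [← Finset.mul_sum, ← Finset.sum_mul]
        gcongr
        · exact hsum _
        · exact hsum _
    _ = ((n - 1 : ℕ) : ℝ) * (Q * M * (((2 : ℝ) ^ n) ^ 2)⁻¹ * S * S) := by simp
    _ ≤ 2 ^ n * (Q * M * (((2 : ℝ) ^ n) ^ 2)⁻¹ * S * S) := by gcongr
    _ = Q * S * S * M * (1 / 2 : ℝ) ^ n := by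
        rw [one_div, inv_pow]
        field_simp

/-- Bony's paraproduct `π_<(u, v) = ∑_{j ≥ -1} ∑_{i < j-1} Δ_i u Δ_j v`, as a distribution: its value
at `φ` is `∑_j ∫ (∑_{i < j-1} Δ_i u(x)) Δ_j v(x) φ(x) dx`. -/
noncomputable def paraproduct (u v : TorusDistribution) : TorusDistribution :=
  ofSeries (fun _ : ℕ => 1) (fun n => mulTorus (D.lowPart n u) (D.block n v)) _
    (summable_geometric_two) (D.norm_paraproduct_term_le u v)

end DyadicPartition

/-! ### The approximated operators -/

/-- Smooth cutoffs `φ` on `ℝ³`, equal to `1` on `{|x|_∞ ≤ 1}` and supported in `{|x| ≤ 1.8}`. -/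
structure Cutoff where
  toFun : E3 → ℝ
  smooth : ContDiff ℝ ∞ toFun
  eq_one : ∀ x : E3, (∀ i, |x i| ≤ 1) → toFun x = 1
  support : tsupport toFun ⊆ {x | ‖x‖ ≤ 1.8}

/-- The mesh size `ε = 2 / (2N + 1)`. -/
noncomputable def mesh (N : ℕ) : ℝ := 2 / (2 * N + 1)

/-- `f(x) = 4 |x|⁻² (sin²(π x₁ / 2) + sin²(π x₂ / 2) + sin²(π x₃ / 2))`. It only enters through
`|k|² f(εk)`, which vanishes for `k = 0`. -/
noncomputable def latticeF (x : E3) : ℝ :=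
  4 / ‖x‖ ^ 2 * ∑ i, Real.sin (x i * Real.pi / 2) ^ 2

/-- The symbol `exp(-t |k|² f(εk)) φ(εk)`. -/
noncomputable def tildeSymbol (φ : Cutoff) (N : ℕ) (t : ℝ≥0) (k : Freq) : ℂ :=
  ((Real.exp (-t * ‖k.toE3‖ ^ 2 * latticeF (mesh N • k.toE3)) * φ.toFun (mesh N • k.toE3) : ℝ) : ℂ)

lemma tildeSymbol_bounded (φ : Cutoff) (N : ℕ) (t : ℝ≥0) :
    ∃ C : ℝ, ∀ k, ‖tildeSymbol φ N t k‖ ≤ C := by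
  have hc : HasCompactSupport φ.toFun := by
    refine (isCompact_closedBall (0 : E3) 1.8).of_isClosed_subset (isClosed_tsupport _) ?_
    intro ξ hξ
    simpa using φ.support hξ
  obtain ⟨C, hC⟩ := hc.exists_bound_of_continuous φ.smooth.continuous
  refine ⟨C, fun k => ?_⟩
  rw [tildeSymbol, Complex.norm_real, norm_mul, Real.norm_of_nonneg (Real.exp_pos _).le]
  have h1 : Real.exp (-t * ‖k.toE3‖ ^ 2 * latticeF (mesh N • k.toE3)) ≤ 1 := by
    rw [Real.exp_le_one_iff]
    have : 0 ≤ latticeF (mesh N • k.toE3) := by unfold latticeF; positivity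
    have h2 : 0 ≤ (t : ℝ) * ‖k.toE3‖ ^ 2 * latticeF (mesh N • k.toE3) := by positivity
    linarith
  exact (mul_le_of_le_one_left (norm_nonneg _) h1).trans (hC _)

/-- `P̃_t^ε`, the Fourier multiplier with symbol `exp(-t |k|² f(εk)) φ(εk)`, where
`ε = 2 / (2N + 1)`. -/
noncomputable def tildeHeat (φ : Cutoff) (N : ℕ) (t : ℝ≥0) :
    TorusDistribution → TorusDistribution :=
  multiplier (tildeSymbol φ N t) (tildeSymbol_bounded φ N t)

/-- The spectral projection `P_N`, the Fourier multiplier with symbol `1_{|k|_∞ ≤ N}`. -/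
noncomputable def specProj (N : ℕ) : TorusDistribution → TorusDistribution :=
  multiplier (fun k => if ∀ i, |k i| ≤ (N : ℤ) then 1 else 0)
    ⟨1, fun k => by split_ifs <;> simp⟩

/-- The discrete heat semigroup `P_t^ε = P_N P̃_t^ε`. -/
noncomputable def discreteHeat (φ : Cutoff) (N : ℕ) (t : ℝ≥0) (u : TorusDistribution) :
    TorusDistribution := specProj N (tildeHeat φ N t u)

/-- The heat semigroup `P_t = e^{tΔ}` on `𝕋³ = ℝ³ / (2ℤ)³`, for which `exp (i π k · x)` is an
eigenfunction with eigenvalue `exp(-t π² |k|²)`. -/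
noncomputable def heat (t : ℝ≥0) : TorusDistribution → TorusDistribution :=
  multiplier (fun k => ((Real.exp (-t * Real.pi ^ 2 * ‖k.toE3‖ ^ 2) : ℝ) : ℂ)) ⟨1, fun k => by
    rw [Complex.norm_real, Real.norm_of_nonneg (Real.exp_pos _).le, Real.exp_le_one_iff]
    have : 0 ≤ (t : ℝ) * Real.pi ^ 2 * ‖k.toE3‖ ^ 2 := by positivity
    linarith⟩

end LatticeHeat

open LatticeHeat

/-! Every expression is a sum over dyadic levels `m` of bilinear terms in `S_{m-1} u` and `Δ_m v`.
If `σ` is the symbol of a semigroup, the pair of frequencies `(l, k)` carries the factor `σ(l + k) -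
σ(k)`, so each level is a commutator of `σ(D)` with multiplication by `S_{m-1} u`, followed by
`P_N`. In a paraproduct both `k` and `l + k` lie in an annulus of size `r = 2^m`.

After rescaling by `r`, `σ` becomes a smooth function on a fixed annulus that depends on `s = t r²`
and `h = ε r`. Its kernel `K` has first moment at most `C (1 + s)^p exp(-c s)` (`exists_kernel`,
`exists_heat_commutatorBound`). The exponential survives on the lattice because `4 sin²(πx/2) ≥ c
x²` for `|x| ≤ 1.8`, hence on the support of the cutoff. The commutator is the integral of `K(y)`
against the increment of `S_{m-1} u` over a distance of order `|y| / r` times a translate of `Δ_m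
v`. It is therefore bounded by the Lipschitz constant `r^(1-α)` of the low part, divided by `r`,
times `r^(-β)`; the condition `α < 1` makes the sum of the low blocks geometric
(`exists_lipschitz_lowPart`). As `δ ≥ α + β`, the exponential is at most a multiple of
`s^(-(δ-α-β)/2)`, and the powers combine to `t^((α+β-δ)/2) r^(-δ)`. `P_N` is not uniformly bounded
on `L^∞`, but on frequencies up to order `r` it costs at most `r^κ`
(`exists_multiplierBound_specSymbol`). This is the loss in the statement.

For the second bound the level `m` splits as `P_N [lattice - heat] - (1 - P_N) [heat]`, where
brackets denote commutators. The first has a gain `min(1, h²) ≤ h^(κ/2)`, from differentiating along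
a path between the two exponents and from `κ ≤ 4`. The second vanishes unless `h` is bounded below,
so a factor `h^(κ/2)` is free. Each projection now costs only `r^(κ/2)`, and `h^(κ/2) r^(κ/2) =
ε^(κ/2) r^κ`. -/

namespace LatticeHeat

/-! ### Integrable kernels of compactly supported symbols. -/

open MeasureTheory Real FourierTransform in
/-- A smooth symbol supported in a fixed ball is the inverse Fourier transform of an integrable
kernel whose first moment is controlled by finitely many derivatives of the symbol. -/
lemma exists_kernel (b : ℝ) : ∃ C : ℝ, 0 ≤ C ∧ ∀ (M : E3 → ℝ) (G : ℝ), ContDiff ℝ ∞ M →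
    (∀ ξ, b < ‖ξ‖ → M ξ = 0) → (∀ i ≤ 5, ∀ ξ, ‖iteratedFDeriv ℝ i M ξ‖ ≤ G) →
    ∃ K : E3 → ℂ, Continuous K ∧ Integrable (fun y => (1 + ‖y‖) * ‖K y‖) ∧
      ∫ y, (1 + ‖y‖) * ‖K y‖ ≤ C * G ∧
      ∀ ξ, (M ξ : ℂ) = ∫ y, Complex.exp (((2 * π * inner ℝ y ξ : ℝ) : ℂ) * Complex.I) * K y := by
  set V : ℝ := volume.real (Metric.closedBall (0 : E3) b) with hV
  have hV0 : 0 ≤ V := measureReal_nonneg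
  set W : ℝ := ∫ y : E3, (1 + ‖y‖) ^ (-(4 : ℝ)) with hW
  have hWi : Integrable (fun y : E3 => (1 + ‖y‖) ^ (-(4 : ℝ))) := by
    apply integrable_one_add_norm
    simp
    norm_num
  have hW0 : 0 ≤ W := integral_nonneg fun y => by positivity
  -- The outer 32 is from `(1 + x)^5 ≤ 32 (1 + x^5)`; the inner `32 * 6` is `2^5` times the number
  -- of derivative orders `0, ..., 5`, each contributing at most `G V`.
  refine ⟨32 * (V + 32 * (6 * V)) * W, by positivity, fun M G hM hsupp hG => ?_⟩
  set f : E3 → ℂ := fun ξ => (M ξ : ℂ) with hf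
  have hfc : ContDiff ℝ ∞ f := Complex.ofRealCLM.contDiff.comp hM
  have hts : tsupport f ⊆ Metric.closedBall 0 b := by
    refine closure_minimal (fun ξ hξ => ?_) Metric.isClosed_closedBall
    by_contra h
    refine hξ ?_
    simp only [Metric.mem_closedBall, dist_zero_right, not_le] at h
    simp [hf, hsupp ξ h]
  have hcs : HasCompactSupport f :=
    (isCompact_closedBall (0 : E3) b).of_isClosed_subset (isClosed_tsupport _) hts
  have hfG : ∀ i ≤ 5, ∀ ξ, ‖iteratedFDeriv ℝ i f ξ‖ ≤ G := by
    intro i hi ξ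
    have h1 := Complex.ofRealCLM.norm_iteratedFDeriv_comp_left (f := M) (x := ξ) (N := ∞) (n := i)
      hM.contDiffAt (by exact_mod_cast le_top)
    refine h1.trans ?_
    rw [Complex.ofRealCLM_norm, one_mul]
    exact hG i hi ξ
  have hint : ∀ i : ℕ, Integrable (fun ξ => ‖iteratedFDeriv ℝ i f ξ‖) := by
    intro i
    have h1 : Continuous (iteratedFDeriv ℝ i f) := hfc.continuous_iteratedFDeriv (by exact_mod_cast le_top)
    exact (h1.integrable_of_hasCompactSupport (hcs.iteratedFDeriv i)).norm
  have hIle : ∀ i ≤ 5, ∫ ξ, ‖iteratedFDeriv ℝ i f ξ‖ ≤ G * V := by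
    intro i hi
    have h0 : ∀ ξ, ξ ∉ Metric.closedBall (0 : E3) b → ‖iteratedFDeriv ℝ i f ξ‖ = 0 := by
      intro ξ hξ
      rw [norm_eq_zero]
      by_contra h
      exact hξ (hts (support_iteratedFDeriv_subset i h))
    rw [← setIntegral_eq_integral_of_forall_compl_eq_zero h0]
    have h1 := norm_setIntegral_le_of_norm_le_const (μ := volume)
      (s := Metric.closedBall (0 : E3) b) (f := fun ξ => ‖iteratedFDeriv ℝ i f ξ‖) (C := G)
      (isCompact_closedBall _ _).measure_lt_top (fun ξ _ => by simpa using hfG i hi ξ)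
    exact (le_abs_self _).trans h1
  have hmom : ∀ (k n : ℕ), (k : ℕ∞) ≤ 0 → (n : ℕ∞) ≤ 5 →
      Integrable (fun v : E3 => ‖v‖ ^ k * ‖iteratedFDeriv ℝ n f v‖) := by
    intro k n hk _
    have : k = 0 := by simpa using hk
    simpa [this] using hint n
  have hK : ∀ n ≤ 5, ∀ w, ‖w‖ ^ n * ‖𝓕 f w‖ ≤ 2 ^ n * (6 * (G * V)) := by
    intro n hn w
    have hG0 : 0 ≤ G := (norm_nonneg _).trans (hfG 0 (by simp) 0)
    have h1 := pow_mul_norm_iteratedFDeriv_fourier_le (K := 0) (N := 5) (hfc.of_le (by norm_cast))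
      hmom (k := 0) (n := n) (by simp) (by exact_mod_cast hn) w
    simp only [norm_iteratedFDeriv_zero, pow_zero, Nat.cast_zero, mul_zero, zero_add, one_mul,
      Finset.range_one, Finset.singleton_product, Finset.sum_map, Function.Embedding.coeFn_mk] at h1
    refine h1.trans ?_
    gcongr
    calc ∑ x ∈ Finset.range (n + 1), ∫ v, ‖iteratedFDeriv ℝ x f v‖
        ≤ ∑ x ∈ Finset.range (n + 1), G * V :=
          Finset.sum_le_sum fun i hi => hIle i (by have := Finset.mem_range.1 hi; omega)
      _ = (n + 1) * (G * V) := by simp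
      _ ≤ 6 * (G * V) := by
          gcongr
          have : (n : ℝ) ≤ 5 := by exact_mod_cast hn
          linarith
  have hK0 : ∀ w, ‖𝓕 f w‖ ≤ G * V := by
    intro w
    refine (VectorFourier.norm_fourierIntegral_le_integral_norm _ _ _ _ _).trans ?_
    simpa using hIle 0 (by simp)
  have hKc : Continuous (𝓕 f) :=
    VectorFourier.fourierIntegral_continuous continuous_fourierChar
      (by exact continuous_inner) (hfc.continuous.integrable_of_hasCompactSupport hcs)
  -- Five derivatives give decay `(1 + ‖w‖)^(-5)`. One power pays for the first moment, and the
  -- remaining four exceed the dimension 3.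
  have hKb : ∀ w, (1 + ‖w‖) * ‖𝓕 f w‖ ≤ (32 * (V + 32 * (6 * V)) * G) * (1 + ‖w‖) ^ (-(4 : ℝ)) := by
    intro w
    have hw := norm_nonneg w
    rw [Real.rpow_neg (by positivity), ← div_eq_mul_inv, le_div_iff₀ (by positivity)]
    have e : (1 + ‖w‖) ^ (4 : ℝ) = (1 + ‖w‖) ^ 4 := by norm_cast
    rw [e]
    have h5 : (1 + ‖w‖) ^ 5 ≤ 32 * (1 + ‖w‖ ^ 5) := by
      rcases le_total ‖w‖ 1 with h | h
      · calc (1 + ‖w‖) ^ 5 ≤ 2 ^ 5 := by gcongr; linarith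
          _ ≤ _ := by nlinarith [pow_nonneg hw 5]
      · calc (1 + ‖w‖) ^ 5 ≤ (2 * ‖w‖) ^ 5 := by gcongr; linarith
          _ ≤ _ := by rw [mul_pow]; nlinarith [pow_nonneg hw 5]
    calc (1 + ‖w‖) * ‖𝓕 f w‖ * (1 + ‖w‖) ^ 4 = (1 + ‖w‖) ^ 5 * ‖𝓕 f w‖ := by ring
      _ ≤ 32 * (1 + ‖w‖ ^ 5) * ‖𝓕 f w‖ := by gcongr
      _ = 32 * (‖𝓕 f w‖ + ‖w‖ ^ 5 * ‖𝓕 f w‖) := by ring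
      _ ≤ 32 * (G * V + 2 ^ 5 * (6 * (G * V))) := by
          exact mul_le_mul_of_nonneg_left (add_le_add (hK0 w) (hK 5 le_rfl w)) (by norm_num)
      _ = _ := by ring
  have hKi : Integrable (fun w => (1 + ‖w‖) * ‖𝓕 f w‖) := by
    refine (hWi.const_mul (32 * (V + 32 * (6 * V)) * G)).mono' ((by fun_prop : Continuous _).aestronglyMeasurable) ?_
    refine Filter.Eventually.of_forall fun w => ?_
    rw [Real.norm_of_nonneg (by positivity)]
    exact hKb w
  have hKi' : Integrable (𝓕 f) := by
    refine hKi.mono' hKc.aestronglyMeasurable (Filter.Eventually.of_forall fun w => ?_)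
    nlinarith [norm_nonneg w, norm_nonneg (𝓕 f w)]
  refine ⟨𝓕 f, hKc, hKi, ?_, fun ξ => ?_⟩
  · calc _ ≤ ∫ w : E3, (32 * (V + 32 * (6 * V)) * G) * (1 + ‖w‖) ^ (-(4 : ℝ)) :=
          integral_mono hKi (hWi.const_mul _) hKb
      _ = _ := by rw [integral_const_mul]; ring
  · have h1 := congrFun (hfc.continuous.fourierInv_fourier_eq
      (hfc.continuous.integrable_of_hasCompactSupport hcs) hKi') ξ
    rw [Real.fourierInv_eq'] at h1
    simp only [smul_eq_mul] at h1
    exact h1.symm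

/-! ### Multiplier bounds for trigonometric polynomials -/

lemma char_add_apply (k : Freq) (x y : Pt) :
    (char k).1 (x + y) = (char k).1 x * (char k).1 y := by
  simp only [char]
  rw [← Complex.exp_add]
  congr 1
  simp only [Pi.add_apply, mul_add, Finset.sum_add_distrib]
  push_cast
  ring

/-- The factor 2 in the dilation reconciles the characters `exp(iπ k·x)` with the `2π` convention of
the Fourier transform. -/
lemma char_dilate_apply (k : Freq) (r : ℝ) (y : E3) :
    (char k).1 ((2 / r) • y.ofLp) =
      Complex.exp (((2 * Real.pi * inner ℝ y (r⁻¹ • k.toE3) : ℝ) : ℂ) * Complex.I) := by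
  simp only [char]
  congr 1
  have h : ∑ i, (k i : ℝ) * ((2 / r) • y.ofLp) i = 2 * inner ℝ y (r⁻¹ • k.toE3) := by
    rw [inner_smul_right, PiLp.inner_apply]
    simp only [Pi.smul_apply, smul_eq_mul, Finset.mul_sum, Freq.toE3]
    refine Finset.sum_congr rfl fun i _ => ?_
    simp
    ring
  rw [h]
  push_cast
  ring

/-- `m(D)` is bounded by `C` in the supremum norm on trigonometric polynomials with frequencies
in `S`. -/
def MultiplierBound (S : Set Freq) (m : Freq → ℂ) (C : ℝ) : Prop :=
  ∀ (ι : Type) (I : Finset ι) (c : ι → ℂ) (κ : ι → Freq) (A : ℝ), (∀ i ∈ I, κ i ∈ S) →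
    (∀ x, ‖∑ i ∈ I, c i * (char (κ i)).1 x‖ ≤ A) →
    ∀ x, ‖∑ i ∈ I, m (κ i) * c i * (char (κ i)).1 x‖ ≤ C * A

lemma MultiplierBound.congr {S : Set Freq} {m m' : Freq → ℂ} {C : ℝ} (h : MultiplierBound S m C)
    (hm : ∀ k ∈ S, m' k = m k) : MultiplierBound S m' C := by
  intro ι I c κ A hI hA x
  have e : ∑ i ∈ I, m' (κ i) * c i * (char (κ i)).1 x =
      ∑ i ∈ I, m (κ i) * c i * (char (κ i)).1 x :=
    Finset.sum_congr rfl fun i hi => by rw [hm _ (hI i hi)]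
  rw [e]
  exact h ι I c κ A hI hA x

/-- The bound for `m'` holds at every point, so it is an admissible hypothesis for `m` with
coefficients `m' c`: operator norms are submultiplicative. -/
lemma MultiplierBound.mul {S : Set Freq} {m m' : Freq → ℂ} {C C' : ℝ} (h : MultiplierBound S m C)
    (h' : MultiplierBound S m' C') : MultiplierBound S (fun k => m k * m' k) (C * C') := by
  intro ι I c κ A hI hA x
  have h1 := h ι I (fun i => m' (κ i) * c i) κ (C' * A) hI (h' ι I c κ A hI hA) x
  simpa only [mul_assoc] using h1

lemma MultiplierBound.mono {S S' : Set Freq} {m : Freq → ℂ} {C C' : ℝ} (h : MultiplierBound S m C)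
    (hS : S' ⊆ S) (hC : C ≤ C') : MultiplierBound S' m C' := by
  intro ι I c κ A hI hA x
  have hA0 : 0 ≤ A := (norm_nonneg _).trans (hA x)
  exact (h ι I c κ A (fun i hi => hS (hI i hi)) hA x).trans (by gcongr)

lemma MultiplierBound.one (S : Set Freq) : MultiplierBound S (fun _ => 1) 1 := by
  intro ι I c κ A hI hA x
  simpa using hA x

lemma MultiplierBound.one_sub {S : Set Freq} {m : Freq → ℂ} {C : ℝ} (h : MultiplierBound S m C) :
    MultiplierBound S (fun k => 1 - m k) (1 + C) := by
  intro ι I c κ A hI hA x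
  simp only [sub_mul, one_mul, Finset.sum_sub_distrib]
  refine (norm_sub_le _ _).trans ?_
  rw [add_mul, one_mul]
  exact add_le_add (hA x) (h ι I c κ A hI hA x)

open MeasureTheory in
lemma integrable_of_moment {K : E3 → ℂ} (hc : Continuous K)
    (hi : Integrable (fun y => (1 + ‖y‖) * ‖K y‖)) : Integrable K := by
  refine hi.mono' hc.aestronglyMeasurable (Filter.Eventually.of_forall fun y => ?_)
  nlinarith [norm_nonneg y, norm_nonneg (K y)]

open MeasureTheory in
lemma integral_norm_le_moment {K : E3 → ℂ} (hc : Continuous K)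
    (hi : Integrable (fun y => (1 + ‖y‖) * ‖K y‖)) :
    ∫ y, ‖K y‖ ≤ ∫ y, (1 + ‖y‖) * ‖K y‖ := by
  refine integral_mono (integrable_of_moment hc hi).norm hi fun y => ?_
  show ‖K y‖ ≤ (1 + ‖y‖) * ‖K y‖
  nlinarith [norm_nonneg y, norm_nonneg (K y)]

open MeasureTheory in
lemma continuous_char_dilate (k : Freq) (x : Pt) (r : ℝ) :
    Continuous fun y : E3 => (char k).1 (x + (2 / r) • y.ofLp) := by
  refine (continuous_torus (char k)).comp ?_
  have : Continuous fun y : E3 => y.ofLp := PiLp.continuous_ofLp 2 _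
  fun_prop

open MeasureTheory in
lemma integrable_char_mul {K : E3 → ℂ} (hc : Integrable K) (k : Freq) (x : Pt) (r : ℝ) :
    Integrable fun y => (char k).1 (x + (2 / r) • y.ofLp) * K y := by
  refine hc.bdd_mul (c := 1) (continuous_char_dilate k x r).aestronglyMeasurable ?_
  exact Filter.Eventually.of_forall fun y => by rw [norm_char]

-- Fourier inversion turns a rescaled multiplier into an average of translates at scale `1 / r`,
-- weighted by a kernel that does not depend on `r`.
open MeasureTheory in
lemma symbol_mul_char {M : E3 → ℝ} {K : E3 → ℂ}
    (hM : ∀ ξ, (M ξ : ℂ) =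
      ∫ y, Complex.exp (((2 * Real.pi * inner ℝ y ξ : ℝ) : ℂ) * Complex.I) * K y)
    (k : Freq) (x : Pt) (r : ℝ) :
    (M (r⁻¹ • k.toE3) : ℂ) * (char k).1 x = ∫ y, (char k).1 (x + (2 / r) • y.ofLp) * K y := by
  rw [hM, mul_comm, ← integral_const_mul]
  congr 1
  funext y
  rw [char_add_apply, char_dilate_apply]
  ring

open MeasureTheory in
/-- Rescaled smooth symbols supported in a fixed ball define bounded multipliers. -/
lemma exists_multiplierBound (b : ℝ) : ∃ C : ℝ, 0 ≤ C ∧ ∀ (M : E3 → ℝ) (G : ℝ), ContDiff ℝ ∞ M →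
    (∀ ξ, b < ‖ξ‖ → M ξ = 0) → (∀ i ≤ 5, ∀ ξ, ‖iteratedFDeriv ℝ i M ξ‖ ≤ G) →
    ∀ (r : ℝ) (S : Set Freq), MultiplierBound S (fun k => (M (r⁻¹ • k.toE3) : ℂ)) (C * G) := by
  obtain ⟨C, hC, h⟩ := exists_kernel b
  refine ⟨C, hC, fun M G h1 h2 h3 r S ι I c κ A _ hA x => ?_⟩
  obtain ⟨K, hK, hKi, hKC, hKM⟩ := h M G h1 h2 h3
  have hKi' := integrable_of_moment hK hKi
  have hA0 : 0 ≤ A := (norm_nonneg _).trans (hA x)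
  have e : ∑ i ∈ I, (M (r⁻¹ • (κ i).toE3) : ℂ) * c i * (char (κ i)).1 x =
      ∫ y, (∑ i ∈ I, c i * (char (κ i)).1 (x + (2 / r) • y.ofLp)) * K y := by
    simp only [Finset.sum_mul, mul_assoc]
    rw [integral_finsetSum _ fun i _ => (integrable_char_mul hKi' (κ i) x r).const_mul (c i)]
    refine Finset.sum_congr rfl fun i _ => ?_
    rw [integral_const_mul, ← symbol_mul_char hKM]
    ring
  rw [e]
  calc _ ≤ ∫ y, A * ‖K y‖ := by
        refine norm_integral_le_of_norm_le (hKi'.norm.const_mul A)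
          (Filter.Eventually.of_forall fun y => ?_)
        rw [norm_mul]
        gcongr
        exact hA _
    _ = A * ∫ y, ‖K y‖ := integral_const_mul _ _
    _ ≤ A * (C * G) := by
        gcongr
        exact (integral_norm_le_moment hK hKi).trans hKC
    _ = _ := by ring

open MeasureTheory in
/-- The commutator of a rescaled smooth multiplier and the multiplication by a Lipschitz
trigonometric polynomial. -/
lemma exists_commutator_bound (b : ℝ) : ∃ C : ℝ, 0 ≤ C ∧ ∀ (M : E3 → ℝ) (G : ℝ), ContDiff ℝ ∞ M →
    (∀ ξ, b < ‖ξ‖ → M ξ = 0) → (∀ i ≤ 5, ∀ ξ, ‖iteratedFDeriv ℝ i M ξ‖ ≤ G) →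
    ∀ (r : ℝ), 0 < r → ∀ (ι ι' : Type) (I : Finset ι) (J : Finset ι') (a : ι → ℂ) (a' : ι' → ℂ)
      (κ : ι → Freq) (κ' : ι' → Freq) (L B : ℝ), 0 ≤ L →
      (∀ (x : Pt) (y : E3), ‖∑ i ∈ I, a i * (char (κ i)).1 (x + y.ofLp) -
        ∑ i ∈ I, a i * (char (κ i)).1 x‖ ≤ L * ‖y‖) →
      (∀ x, ‖∑ j ∈ J, a' j * (char (κ' j)).1 x‖ ≤ B) →
      ∀ x, ‖∑ p ∈ I ×ˢ J, ((M (r⁻¹ • (κ p.1 + κ' p.2).toE3) : ℂ) - M (r⁻¹ • (κ' p.2).toE3)) *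
        (a p.1 * a' p.2) * (char (κ p.1 + κ' p.2)).1 x‖ ≤ C * G * (L * B / r) := by
  obtain ⟨C, hC, h⟩ := exists_kernel b
  -- The 2 comes from the translation by `(2 / r) • y`.
  refine ⟨2 * C, by positivity, fun M G h1 h2 h3 r hr ι ι' I J a a' κ κ' L B hL hA hB x => ?_⟩
  obtain ⟨K, hK, hKi, hKC, hKM⟩ := h M G h1 h2 h3
  have hKi' := integrable_of_moment hK hKi
  have hB0 : 0 ≤ B := (norm_nonneg _).trans (hB x)
  have e : ∑ p ∈ I ×ˢ J, ((M (r⁻¹ • (κ p.1 + κ' p.2).toE3) : ℂ) - M (r⁻¹ • (κ' p.2).toE3)) *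
        (a p.1 * a' p.2) * (char (κ p.1 + κ' p.2)).1 x =
      ∫ y, (∑ i ∈ I, a i * (char (κ i)).1 (x + (2 / r) • y.ofLp) -
        ∑ i ∈ I, a i * (char (κ i)).1 x) *
          (∑ j ∈ J, a' j * (char (κ' j)).1 (x + (2 / r) • y.ofLp)) * K y := by
    -- Translating both factors produces `M` at the total frequency; translating only the second
    -- produces `M` at its own frequency. The difference isolates the increment of the first factor.
    have e1 : ∀ y : E3, (∑ i ∈ I, a i * (char (κ i)).1 (x + (2 / r) • y.ofLp) -
        ∑ i ∈ I, a i * (char (κ i)).1 x) *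
          (∑ j ∈ J, a' j * (char (κ' j)).1 (x + (2 / r) • y.ofLp)) * K y =
        ∑ p ∈ I ×ˢ J, (a p.1 * a' p.2 *
            ((char (κ p.1 + κ' p.2)).1 (x + (2 / r) • y.ofLp) * K y) -
          a p.1 * a' p.2 * (char (κ p.1)).1 x *
            ((char (κ' p.2)).1 (x + (2 / r) • y.ofLp) * K y)) := by
      intro y
      rw [← Finset.sum_sub_distrib, Finset.sum_mul_sum, ← Finset.sum_product', Finset.sum_mul]
      refine Finset.sum_congr rfl fun p _ => ?_
      rw [← char_mul]
      ring
    have hp : ∀ p : ι × ι', Integrable fun y : E3 => a p.1 * a' p.2 *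
            ((char (κ p.1 + κ' p.2)).1 (x + (2 / r) • y.ofLp) * K y) -
          a p.1 * a' p.2 * (char (κ p.1)).1 x *
            ((char (κ' p.2)).1 (x + (2 / r) • y.ofLp) * K y) := fun p =>
      ((integrable_char_mul hKi' _ x r).const_mul _).sub ((integrable_char_mul hKi' _ x r).const_mul _)
    simp only [e1]
    rw [integral_finsetSum _ fun p _ => hp p]
    refine Finset.sum_congr rfl fun p _ => ?_
    rw [integral_sub ((integrable_char_mul hKi' _ x r).const_mul _)
      ((integrable_char_mul hKi' _ x r).const_mul _), integral_const_mul, integral_const_mul,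
      ← symbol_mul_char hKM, ← symbol_mul_char hKM, ← char_mul]
    ring
  rw [e]
  calc _ ≤ ∫ y, (L * (2 / r) * B) * ((1 + ‖y‖) * ‖K y‖) := by
        refine norm_integral_le_of_norm_le (hKi.const_mul _)
          (Filter.Eventually.of_forall fun y => ?_)
        have h4 := hA x ((2 / r) • y)
        rw [norm_smul, Real.norm_of_nonneg (by positivity)] at h4
        rw [norm_mul, norm_mul]
        calc _ ≤ (L * (2 / r * ‖y‖)) * B * ‖K y‖ := by
              gcongr
              · exact h4
              · exact hB _
          _ = (L * (2 / r) * B) * (‖y‖ * ‖K y‖) := by ring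
          _ ≤ _ := by
              gcongr
              linarith
    _ = (L * (2 / r) * B) * ∫ y, (1 + ‖y‖) * ‖K y‖ := integral_const_mul _ _
    _ ≤ (L * (2 / r) * B) * (C * G) := by gcongr
    _ = _ := by ring

/-! ### The spectral projection -/

/-- The Dirichlet kernel `∑_{|q| ≤ N} exp (i π q y)`. -/
noncomputable def dirichlet (N : ℕ) (y : ℝ) : ℂ :=
  ∑ j ∈ Finset.range (2 * N + 1), Complex.exp (Complex.I * Real.pi * ((j : ℤ) - N : ℤ) * y)

lemma continuous_dirichlet (N : ℕ) : Continuous (dirichlet N) := by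
  unfold dirichlet
  fun_prop

lemma norm_exp_I_mul_pi (k : ℤ) (y : ℝ) :
    ‖Complex.exp (Complex.I * Real.pi * k * y)‖ = 1 := by
  have e : Complex.I * Real.pi * k * y = ((Real.pi * k * y : ℝ) : ℂ) * Complex.I := by
    push_cast
    ring
  rw [e, Complex.norm_exp_ofReal_mul_I]

lemma norm_dirichlet_le (N : ℕ) (y : ℝ) : ‖dirichlet N y‖ ≤ 2 * N + 1 := by
  refine (norm_sum_le _ _).trans ?_
  simp only [norm_exp_I_mul_pi]
  simp

/-- A geometric sum: multiplied by `z - 1` it has modulus at most 2, while `|z - 1| = 2 |sin(πy/2)|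
≥ 2|y|` by Jordan's inequality. -/
lemma norm_dirichlet_mul_abs_le (N : ℕ) {y : ℝ} (hy : |y| ≤ 1) :
    ‖dirichlet N y‖ * |y| ≤ 1 := by
  set z := Complex.exp (Complex.I * ((Real.pi * y : ℝ) : ℂ)) with hz
  have hz1 : ‖z‖ = 1 := by rw [hz, mul_comm, Complex.norm_exp_ofReal_mul_I]
  have h1 : dirichlet N y = Complex.exp (Complex.I * Real.pi * (-N : ℤ) * y) *
      ∑ j ∈ Finset.range (2 * N + 1), z ^ j := by
    rw [dirichlet, Finset.mul_sum]
    refine Finset.sum_congr rfl fun j _ => ?_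
    rw [hz, ← Complex.exp_nat_mul, ← Complex.exp_add]
    congr 1
    push_cast
    ring
  have h2 : ‖z - 1‖ * ‖dirichlet N y‖ ≤ 2 := by
    rw [h1, norm_mul, norm_exp_I_mul_pi, one_mul, ← norm_mul, mul_geom_sum]
    refine (norm_sub_le _ _).trans ?_
    rw [norm_pow, hz1]
    norm_num
  have h3 : 2 * |y| ≤ ‖z - 1‖ := by
    rw [hz, Complex.norm_exp_I_mul_ofReal_sub_one, norm_mul, Real.norm_eq_abs, Real.norm_eq_abs]
    have h4 := Real.mul_abs_le_abs_sin (x := Real.pi * y / 2) (by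
      rw [abs_div, abs_mul, abs_of_pos Real.pi_pos, abs_two]
      nlinarith [Real.pi_pos])
    rw [abs_div, abs_mul, abs_of_pos Real.pi_pos, abs_two] at h4
    have h5 : 2 / Real.pi * (Real.pi * |y| / 2) = |y| := by
      field_simp
    rw [h5] at h4
    rw [abs_two]
    linarith
  nlinarith [norm_nonneg (dirichlet N y)]

/-- Interpolation between the bounds `2N + 1` and `1 / |y|`. The resulting singularity is
integrable, and a small power of `N` replaces the sharp logarithm. -/
lemma norm_dirichlet_le_rpow (N : ℕ) {γ : ℝ} (h0 : 0 < γ) (h1 : γ ≤ 1) {y : ℝ} (hy : y ≠ 0)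
    (hy1 : |y| ≤ 1) : ‖dirichlet N y‖ ≤ (2 * N + 1) ^ γ * |y| ^ (γ - 1) := by
  have hy0 : 0 < |y| := abs_pos.2 hy
  rcases (norm_nonneg (dirichlet N y)).eq_or_lt with h | h
  · rw [← h]
    positivity
  calc ‖dirichlet N y‖ = ‖dirichlet N y‖ ^ γ * ‖dirichlet N y‖ ^ (1 - γ) := by
        rw [← Real.rpow_add h]
        simp
    _ ≤ (2 * N + 1) ^ γ * (|y|⁻¹) ^ (1 - γ) := by
        gcongr
        · exact norm_dirichlet_le N y
        · rw [← one_div, le_div_iff₀ hy0]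
          exact norm_dirichlet_mul_abs_le N hy1
    _ = _ := by
        rw [Real.inv_rpow hy0.le, ← Real.rpow_neg hy0.le]
        congr 2
        ring

lemma char_add_single (k : Freq) (x : Pt) (l : Fin 3) (y : ℝ) :
    (char k).1 (x + Pi.single l y) =
      Complex.exp (Complex.I * Real.pi * k l * y) * (char k).1 x := by
  rw [char_add_apply, mul_comm]
  congr 1
  simp only [char]
  congr 1
  simp [Pi.single_apply]
  ring

lemma integral_exp_int (q : ℤ) :
    ∫ y in (-1 : ℝ)..1, Complex.exp (Complex.I * Real.pi * q * y) = if q = 0 then 2 else 0 := by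
  split_ifs with h
  · simp [h]
    norm_num
  · have hq : Complex.I * Real.pi * q ≠ 0 := by
      simp [h, Real.pi_ne_zero]
    rw [integral_exp_mul_complex hq]
    have e : Complex.exp (Complex.I * Real.pi * q * (1 : ℝ)) =
        Complex.exp (Complex.I * Real.pi * q * (-1 : ℝ)) := by
      rw [Complex.exp_eq_exp_iff_exists_int]
      refine ⟨q, ?_⟩
      push_cast
      ring
    rw [e, sub_self, zero_div]

lemma integral_dirichlet_mul (N : ℕ) (k : ℤ) :
    ∫ y in (-1 : ℝ)..1, dirichlet N y * Complex.exp (Complex.I * Real.pi * k * y) =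
      if |k| ≤ (N : ℤ) then 2 else 0 := by
  have e : ∀ y : ℝ, dirichlet N y * Complex.exp (Complex.I * Real.pi * k * y) =
      ∑ j ∈ Finset.range (2 * N + 1),
        Complex.exp (Complex.I * Real.pi * (((j : ℤ) - N + k : ℤ)) * y) := by
    intro y
    rw [dirichlet, Finset.sum_mul]
    refine Finset.sum_congr rfl fun j _ => ?_
    rw [← Complex.exp_add]
    congr 1
    push_cast
    ring
  simp only [e]
  rw [intervalIntegral.integral_finsetSum fun j _ => by
    apply Continuous.intervalIntegrable
    fun_prop]
  simp only [integral_exp_int]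
  split_ifs with h
  · have h' := abs_le.1 h
    rw [Finset.sum_eq_single (N - k).toNat]
    · rw [if_pos (by omega)]
    · intro j _ hj
      rw [if_neg (by omega)]
    · intro hj
      rw [Finset.mem_range] at hj
      omega
  · refine Finset.sum_eq_zero fun j hj => ?_
    rw [Finset.mem_range] at hj
    rw [if_neg]
    intro h2
    exact h (abs_le.2 (by omega))

lemma norm_integral_dirichlet_mul_le (N : ℕ) {γ : ℝ} (h0 : 0 < γ) (h1 : γ ≤ 1) {f : ℝ → ℂ}
    (hf : Continuous f) {A : ℝ} (hA : ∀ y, ‖f y‖ ≤ A) :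
    ‖∫ y in (-1 : ℝ)..1, dirichlet N y * f y‖ ≤ 2 * ((2 * N + 1) ^ γ / γ * A) := by
  have hA0 : 0 ≤ A := (norm_nonneg _).trans (hA 0)
  -- The sign `s = ±1` treats both halves of `[-1, 1]` as integrals over `[0, 1]`.
  have half : ∀ g : ℝ → ℂ, (∀ y, ‖g y‖ ≤ A) → ∀ s : ℝ, |s| = 1 →
      ‖∫ y in (0 : ℝ)..1, dirichlet N (s * y) * g y‖ ≤ (2 * N + 1) ^ γ / γ * A := by
    intro g hg s hs
    have hi : IntervalIntegrable (fun y : ℝ => (2 * N + 1) ^ γ * A * y ^ (γ - 1))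
        MeasureTheory.volume 0 1 :=
      (intervalIntegral.intervalIntegrable_rpow' (by linarith)).const_mul _
    have h2 := intervalIntegral.norm_integral_le_of_norm_le (a := (0 : ℝ)) (b := 1)
      (f := fun y => dirichlet N (s * y) * g y)
      (g := fun y : ℝ => (2 * N + 1) ^ γ * A * y ^ (γ - 1)) zero_le_one
      (Filter.Eventually.of_forall fun y hy => by
        have hsy : |s * y| = y := by rw [abs_mul, hs, one_mul, abs_of_pos hy.1]
        have h3 := norm_dirichlet_le_rpow N h0 h1 (y := s * y)
          (by rw [← abs_pos, hsy]; exact hy.1) (by rw [hsy]; exact hy.2)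
        rw [hsy] at h3
        rw [norm_mul]
        calc _ ≤ (2 * N + 1) ^ γ * y ^ (γ - 1) * A := by
              have := hy.1
              gcongr
              exact hg y
          _ = _ := by ring) hi
    refine h2.trans (le_of_eq ?_)
    rw [intervalIntegral.integral_const_mul, integral_rpow (Or.inl (by linarith))]
    simp only [sub_add_cancel, Real.one_rpow, Real.zero_rpow h0.ne']
    ring
  have hc : Continuous fun y => dirichlet N y * f y := (continuous_dirichlet N).mul hf
  rw [← intervalIntegral.integral_add_adjacent_intervals (b := 0) (hc.intervalIntegrable _ _)
    (hc.intervalIntegrable _ _)]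
  have e := intervalIntegral.integral_comp_neg (a := (0 : ℝ)) (b := 1)
    (fun y => dirichlet N y * f y)
  rw [neg_zero] at e
  rw [← e, two_mul]
  refine (norm_add_le _ _).trans (add_le_add ?_ ?_)
  · simpa using half (fun y => f (-y)) (fun y => hA _) (-1) (by simp)
  · simpa using half f hA 1 (by simp)

/-- The projection in one coordinate is convolution with the Dirichlet kernel, normalised by the
period 2. -/
lemma multiplierBound_specProj_coord (N : ℕ) {γ : ℝ} (h0 : 0 < γ) (h1 : γ ≤ 1) (l : Fin 3) :
    MultiplierBound Set.univ (fun k => if |k l| ≤ (N : ℤ) then 1 else 0)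
      ((2 * N + 1) ^ γ / γ) := by
  intro ι I c κ A _ hA x
  have e : ∑ i ∈ I, (if |κ i l| ≤ (N : ℤ) then 1 else 0) * c i * (char (κ i)).1 x =
      (1 / 2) * ∫ y in (-1 : ℝ)..1,
        dirichlet N y * ∑ i ∈ I, c i * (char (κ i)).1 (x + Pi.single l y) := by
    have e1 : ∀ y : ℝ, dirichlet N y * ∑ i ∈ I, c i * (char (κ i)).1 (x + Pi.single l y) =
        ∑ i ∈ I, c i * (char (κ i)).1 x *
          (dirichlet N y * Complex.exp (Complex.I * Real.pi * κ i l * y)) := by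
      intro y
      rw [Finset.mul_sum]
      refine Finset.sum_congr rfl fun i _ => ?_
      rw [char_add_single]
      ring
    simp only [e1]
    rw [intervalIntegral.integral_finsetSum fun i _ => by
      apply Continuous.intervalIntegrable
      have := continuous_dirichlet N
      fun_prop, Finset.mul_sum]
    refine Finset.sum_congr rfl fun i _ => ?_
    rw [intervalIntegral.integral_const_mul, integral_dirichlet_mul]
    split_ifs
    · ring
    · ring
  rw [e, norm_mul]
  have hc : Continuous fun y : ℝ => ∑ i ∈ I, c i * (char (κ i)).1 (x + Pi.single l y) := by
    refine continuous_finsetSum _ fun i _ => continuous_const.mul ?_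
    simp only [char_add_single]
    fun_prop
  have h2 := norm_integral_dirichlet_mul_le N h0 h1 hc (fun y => hA _)
  have h3 : ‖(1 / 2 : ℂ)‖ = 1 / 2 := by norm_num
  rw [h3]
  linarith

/-- The symbol of `P_N`. -/
def specSymbol (N : ℕ) (k : Freq) : ℂ := if ∀ i, |k i| ≤ (N : ℤ) then 1 else 0

/-- The cube `|k|_∞ ≤ N` makes the projection a product of three one-dimensional ones, so each is
allowed the exponent `γ / 3`. -/
lemma multiplierBound_specSymbol (N : ℕ) {γ : ℝ} (h0 : 0 < γ) (h1 : γ ≤ 1) :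
    MultiplierBound Set.univ (specSymbol N) (((2 * N + 1) ^ (γ / 3) / (γ / 3)) ^ 3) := by
  have h := fun l => multiplierBound_specProj_coord N (γ := γ / 3) (by linarith) (by linarith) l
  refine (((h 0).mul ((h 1).mul (h 2))).congr fun k _ => ?_).mono le_rfl (le_of_eq (by ring))
  have e : (∀ i, |k i| ≤ (N : ℤ)) ↔ |k 0| ≤ (N : ℤ) ∧ |k 1| ≤ (N : ℤ) ∧ |k 2| ≤ (N : ℤ) := by
    simp [Fin.forall_fin_succ]
  rw [specSymbol]
  simp only [e]
  by_cases h0 : |k 0| ≤ (N : ℤ) <;> by_cases h1 : |k 1| ≤ (N : ℤ) <;>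
    by_cases h2 : |k 2| ≤ (N : ℤ) <;> simp [h0, h1, h2]

lemma specSymbol_eq_one {N : ℕ} {k : Freq} (h : ‖k.toE3‖ ≤ N) : specSymbol N k = 1 := by
  refine if_pos fun i => ?_
  have h1 : |(k i : ℝ)| ≤ N := (norm_le_pi_norm k i).trans ((norm_le_norm_toE3 k).trans h)
  exact_mod_cast h1

lemma mesh_pos (N : ℕ) : 0 < mesh N := by
  unfold mesh
  positivity

/-- The spectral projection loses an arbitrarily small power of the frequency. -/
lemma exists_multiplierBound_specSymbol {B γ : ℝ} (hB : 0 < B) (hγ : 0 < γ) :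
    ∃ C : ℝ, 0 ≤ C ∧ ∀ N n : ℕ, 1 ≤ N → MultiplierBound {k | ‖k.toE3‖ ≤ B * 2 ^ n} (specSymbol N)
      (C * ((2 : ℝ) ^ n) ^ γ) := by
  -- The Dirichlet kernel estimate needs an exponent at most 1; decreasing `γ` is harmless because
  -- `2^n ≥ 1`.
  set g := min γ 1
  have hg : 0 < g := by positivity
  refine ⟨1 + (3 * B) ^ g / (g / 3) ^ 3, by positivity, fun N n hN => ?_⟩
  have h2 : (1 : ℝ) ≤ 2 ^ n := one_le_pow₀ one_le_two
  have h3 : ((2 : ℝ) ^ n) ^ g ≤ ((2 : ℝ) ^ n) ^ γ :=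
    Real.rpow_le_rpow_of_exponent_le h2 (min_le_left _ _)
  have h4 : (1 : ℝ) ≤ ((2 : ℝ) ^ n) ^ γ := Real.one_le_rpow h2 hγ.le
  have hq : 0 ≤ (3 * B) ^ g / (g / 3) ^ 3 := by positivity
  -- Either all frequencies are below `N` and the projection acts as the identity, or `2N + 1 ≤ 3N <
  -- 3 B 2^n` and the power of `N` becomes a power of `2^n`.
  rcases le_or_gt (B * 2 ^ n) (N : ℝ) with h | h
  · refine ((MultiplierBound.one _).congr fun k hk => specSymbol_eq_one (le_trans hk h)).mono
      le_rfl ?_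
    nlinarith
  · refine (multiplierBound_specSymbol N hg (min_le_right _ _)).mono (Set.subset_univ _) ?_
    have hN' : (1 : ℝ) ≤ N := by exact_mod_cast hN
    calc ((2 * (N : ℝ) + 1) ^ (g / 3) / (g / 3)) ^ 3
        = (2 * (N : ℝ) + 1) ^ g / (g / 3) ^ 3 := by
          rw [div_pow, ← Real.rpow_natCast, ← Real.rpow_mul (by positivity)]
          norm_num
      _ ≤ (3 * B * 2 ^ n) ^ g / (g / 3) ^ 3 := by
          gcongr
          linarith
      _ = (3 * B) ^ g / (g / 3) ^ 3 * ((2 : ℝ) ^ n) ^ g := by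
          rw [Real.mul_rpow (by positivity) (by positivity)]
          ring
      _ ≤ (3 * B) ^ g / (g / 3) ^ 3 * ((2 : ℝ) ^ n) ^ γ := by gcongr
      _ ≤ _ := by nlinarith

/-- The complementary projection is small on frequencies below the lattice scale. -/
lemma exists_multiplierBound_one_sub_specSymbol {B γ η : ℝ} (hB : 0 < B) (hγ : 0 < γ)
    (hη : 0 ≤ η) : ∃ C : ℝ, 0 ≤ C ∧ ∀ N n : ℕ, 1 ≤ N →
      MultiplierBound {k | ‖k.toE3‖ ≤ B * 2 ^ n} (fun k => 1 - specSymbol N k)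
        (C * ((2 : ℝ) ^ n) ^ γ * (mesh N * 2 ^ n) ^ η) := by
  obtain ⟨C, hC, h⟩ := exists_multiplierBound_specSymbol hB hγ
  refine ⟨(1 + C) * (3 * B / 2) ^ η, by positivity, fun N n hN => ?_⟩
  have hm := mesh_pos N
  have h2 : (1 : ℝ) ≤ 2 ^ n := one_le_pow₀ one_le_two
  have h4 : (1 : ℝ) ≤ ((2 : ℝ) ^ n) ^ γ := Real.one_le_rpow h2 hγ.le
  -- In the first case `1 - P_N` annihilates everything. In the second `mesh N * 2^n` is bounded
  -- below, so any nonnegative power of it can be inserted at the price of a constant.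
  rcases le_or_gt (B * 2 ^ n) (N : ℝ) with h' | h'
  · intro ι I c κ A hI hA x
    have hA0 : 0 ≤ A := (norm_nonneg _).trans (hA x)
    rw [Finset.sum_eq_zero]
    · rw [norm_zero]
      positivity
    · intro i hi
      simp [specSymbol_eq_one (le_trans (hI i hi) h')]
  · refine (h N n hN).one_sub.mono le_rfl ?_
    have hN' : (1 : ℝ) ≤ N := by exact_mod_cast hN
    have h5 : 1 ≤ 3 * B / 2 * (mesh N * 2 ^ n) := by
      have e : 3 * B / 2 * (mesh N * 2 ^ n) = 3 * (B * 2 ^ n) / (2 * N + 1) := by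
        rw [mesh]
        field_simp
      rw [e, le_div_iff₀ (by positivity)]
      linarith
    have h6 : 1 ≤ (3 * B / 2) ^ η * (mesh N * 2 ^ n) ^ η := by
      rw [← Real.mul_rpow (by positivity) (by positivity)]
      exact Real.one_le_rpow h5 hη
    calc 1 + C * ((2 : ℝ) ^ n) ^ γ ≤ (1 + C) * ((2 : ℝ) ^ n) ^ γ * 1 := by nlinarith
      _ ≤ (1 + C) * ((2 : ℝ) ^ n) ^ γ * ((3 * B / 2) ^ η * (mesh N * 2 ^ n) ^ η) := by gcongr
      _ = _ := by ring

/-! ### Littlewood-Paley blocks -/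

lemma exists_bound_iteratedFDeriv {M : E3 → ℝ} (hM : ContDiff ℝ ∞ M) {b : ℝ}
    (hb : ∀ ξ, b < ‖ξ‖ → M ξ = 0) : ∃ G : ℝ, 0 ≤ G ∧ ∀ i ≤ 5, ∀ ξ, ‖iteratedFDeriv ℝ i M ξ‖ ≤ G := by
  have hcs : HasCompactSupport M := by
    refine HasCompactSupport.of_support_subset_isCompact (isCompact_closedBall (0 : E3) b)
      fun ξ hξ => ?_
    by_contra h
    simp only [Metric.mem_closedBall, dist_zero_right, not_le] at h
    exact hξ (hb ξ h)
  have h1 : ∀ i : ℕ, ∃ G : ℝ, ∀ ξ, ‖iteratedFDeriv ℝ i M ξ‖ ≤ G := fun i =>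
    (hcs.iteratedFDeriv i).exists_bound_of_continuous
      (hM.continuous_iteratedFDeriv (by exact_mod_cast le_top))
  choose G hG using h1
  refine ⟨∑ i ∈ Finset.range 6, |G i|, by positivity, fun i hi ξ => (hG i ξ).trans
    ((le_abs_self _).trans ?_)⟩
  exact Finset.single_le_sum (f := fun i => |G i|) (fun i _ => abs_nonneg _)
    (Finset.mem_range.2 (by omega))

lemma exists_multiplierBound_of_contDiff {M : E3 → ℝ} (hM : ContDiff ℝ ∞ M) {b : ℝ}
    (hb : ∀ ξ, b < ‖ξ‖ → M ξ = 0) : ∃ C : ℝ, 0 ≤ C ∧ ∀ (r : ℝ) (S : Set Freq),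
      MultiplierBound S (fun k => (M (r⁻¹ • k.toE3) : ℂ)) C := by
  obtain ⟨C, hC, h⟩ := exists_multiplierBound b
  obtain ⟨G, hG, hG'⟩ := exists_bound_iteratedFDeriv hM hb
  exact ⟨C * G, by positivity, fun r S => h M G hM hb hG' r S⟩

/-- Uniform in `n` because all blocks but the first are dilates of the single profile `θ`. -/
lemma DyadicPartition.exists_multiplierBound_symbol (D : DyadicPartition) :
    ∃ C : ℝ, 0 ≤ C ∧ ∀ (n : ℕ) (S : Set Freq),
      MultiplierBound S (fun k => (D.symbol n k.toE3 : ℂ)) C := by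
  obtain ⟨R, hR⟩ := D.ball_χ
  obtain ⟨a, b, -, hab⟩ := D.annulus_θ
  obtain ⟨C, hC, h⟩ := exists_multiplierBound_of_contDiff D.smooth_χ (b := R) fun ξ hξ => by
    by_contra h0
    exact absurd (hR (subset_tsupport _ h0)) (not_le.2 hξ)
  obtain ⟨C', hC', h'⟩ := exists_multiplierBound_of_contDiff D.smooth_θ (b := b) fun ξ hξ => by
    by_contra h0
    exact absurd (hab (subset_tsupport _ h0)).2 (not_le.2 hξ)
  refine ⟨max C C', by positivity, fun n S => ?_⟩
  cases n with
  | zero => exact ((h 1 S).congr fun k _ => by simp [symbol]).mono le_rfl (le_max_left _ _)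
  | succ j => exact (h' (2 ^ j) S).mono le_rfl (le_max_right _ _)

lemma MultiplierBound.const_mul {S : Set Freq} {m : Freq → ℂ} {C : ℝ} (h : MultiplierBound S m C)
    {a : ℝ} (ha : 0 ≤ a) : MultiplierBound S (fun k => (a : ℂ) * m k) (a * C) := by
  intro ι I c κ A hI hA x
  have h1 := h ι I c κ A hI hA x
  simp only [mul_assoc, ← Finset.mul_sum] at h1 ⊢
  rw [norm_mul, Complex.norm_real, Real.norm_of_nonneg ha]
  gcongr

/-- This is Bernstein's inequality for a partial derivative: on the ball of radius `B r`, the symbol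
`k_l` is `r` times the dilate of the fixed compactly supported function `ξ_l ψ(ξ)`. -/
lemma exists_multiplierBound_coord {B : ℝ} (hB : 0 < B) : ∃ C : ℝ, 0 ≤ C ∧ ∀ (r : ℝ), 0 < r →
    ∀ l : Fin 3, MultiplierBound {k | ‖k.toE3‖ ≤ B * r} (fun k => (k l : ℂ)) (C * r) := by
  let ψ : ContDiffBump (0 : E3) := ⟨B, 2 * B, hB, by linarith⟩
  have hsm : ∀ l : Fin 3, ContDiff ℝ ∞ fun ξ : E3 => ξ l * ψ ξ := fun l => by
    have := ψ.contDiff (n := (⊤ : ℕ∞))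
    have h2 : ContDiff ℝ ∞ fun ξ : E3 => ξ l := by fun_prop
    exact h2.mul this
  have hb : ∀ l : Fin 3, ∀ ξ : E3, 2 * B < ‖ξ‖ → ξ l * ψ ξ = 0 := fun l ξ hξ => by
    rw [ψ.zero_of_le_dist (by simpa using hξ.le), mul_zero]
  have h := fun l => exists_multiplierBound_of_contDiff (hsm l) (hb l)
  choose C hC h using h
  refine ⟨∑ l, C l, Finset.sum_nonneg fun l _ => hC l, fun r hr l => ?_⟩
  refine (((h l r {k | ‖k.toE3‖ ≤ B * r}).const_mul hr.le).congr fun k hk => ?_).mono le_rfl ?_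
  · have h1 : ψ (r⁻¹ • k.toE3) = 1 := by
      apply ψ.one_of_mem_closedBall
      rw [Metric.mem_closedBall, dist_zero_right, norm_smul, norm_inv, Real.norm_of_nonneg hr.le,
        inv_mul_le_iff₀ hr, mul_comm]
      exact hk
    rw [h1]
    have hr' : (r : ℂ) ≠ 0 := by exact_mod_cast hr.ne'
    simp [Freq.toE3]
    field_simp
  · rw [mul_comm]
    gcongr
    exact Finset.single_le_sum (f := C) (fun i _ => hC i) (Finset.mem_univ l)

/-- Bernstein's inequality, as a Lipschitz bound. -/
lemma exists_lipschitz_bound {B : ℝ} (hB : 0 < B) : ∃ C : ℝ, 0 ≤ C ∧ ∀ (r : ℝ), 0 < r →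
    ∀ (ι : Type) (I : Finset ι) (c : ι → ℂ) (κ : ι → Freq) (A : ℝ),
      (∀ i ∈ I, ‖(κ i).toE3‖ ≤ B * r) → (∀ x, ‖∑ i ∈ I, c i * (char (κ i)).1 x‖ ≤ A) →
      ∀ (x : Pt) (y : E3), ‖∑ i ∈ I, c i * (char (κ i)).1 (x + y.ofLp) -
        ∑ i ∈ I, c i * (char (κ i)).1 x‖ ≤ C * r * A * ‖y‖ := by
  obtain ⟨C, hC, h⟩ := exists_multiplierBound_coord hB
  refine ⟨Real.pi * (3 * C), by positivity, fun r hr ι I c κ A hI hA x y => ?_⟩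
  have hA0 : 0 ≤ A := (norm_nonneg _).trans (hA x)
  -- Mean value inequality along the segment from `x` to `x + y`. The constant `π * (3 * C)`
  -- collects the `π` of the characters and the three coordinates.
  set g : ℝ → ℂ := fun s => ∑ i ∈ I, c i * (char (κ i)).1 (x + s • y.ofLp) with hg
  set g' : ℝ → ℂ := fun s => (Complex.I * Real.pi) *
    ∑ l, (y l : ℂ) * ∑ i ∈ I, (κ i l : ℂ) * c i * (char (κ i)).1 (x + s • y.ofLp) with hg'
  have hd : ∀ s, HasDerivAt g (g' s) s := by
    intro s
    have h1 : HasDerivAt g (∑ i ∈ I, c i * ((char (κ i)).1 (x + s • y.ofLp) *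
        (Complex.I * Real.pi * (phase (κ i) y.ofLp : ℂ)))) s := by
      refine HasDerivAt.fun_sum fun i _ => HasDerivAt.const_mul _ ?_
      have h2 : HasDerivAt (fun s : ℝ => x + s • y.ofLp) y.ofLp s := by
        simpa using ((hasDerivAt_id s).smul_const y.ofLp).const_add x
      have h3 := (hasFDerivAt_char (κ i) (x + s • y.ofLp)).comp_hasDerivAt s h2
      refine h3.congr_deriv ?_
      simp
    convert h1 using 1
    rw [hg']
    simp only [Finset.mul_sum, phase_apply]
    rw [Finset.sum_comm]
    refine Finset.sum_congr rfl fun i _ => ?_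
    push_cast
    simp only [Finset.mul_sum]
    refine Finset.sum_congr rfl fun l _ => ?_
    ring
  have hb : ∀ s, ‖g' s‖ ≤ Real.pi * (3 * C) * r * A * ‖y‖ := by
    intro s
    have h1 : ∀ l, ‖(y l : ℂ) * ∑ i ∈ I, (κ i l : ℂ) * c i * (char (κ i)).1 (x + s • y.ofLp)‖ ≤
        ‖y‖ * (C * r * A) := by
      intro l
      rw [norm_mul, Complex.norm_real]
      gcongr
      · exact PiLp.norm_apply_le y l
      · exact h r hr l ι I c κ A hI hA _
    rw [hg', norm_mul, norm_mul, Complex.norm_I, Complex.norm_real,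
      Real.norm_of_nonneg Real.pi_pos.le, one_mul]
    calc _ ≤ Real.pi * ∑ l : Fin 3, ‖y‖ * (C * r * A) := by
          gcongr
          exact (norm_sum_le _ _).trans (Finset.sum_le_sum fun l _ => h1 l)
      _ = _ := by
          simp
          ring
  have h4 := norm_image_sub_le_of_norm_deriv_le_segment_01' (f := g) (f' := g')
    (fun s _ => (hd s).hasDerivWithinAt) (fun s _ => hb s)
  simpa [hg] using h4

/-! ### Lipschitz bounds for the low-frequency part. -/

namespace DyadicPartition

variable (D : DyadicPartition)

/-- The coefficients of the Littlewood-Paley blocks. -/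
noncomputable def blockCoeff (u : TorusDistribution) (p : (_ : ℕ) × Freq) : ℂ :=
  D.symbol p.1 p.2.toE3 * distCoeff u p.2

/-- The frequencies of the Littlewood-Paley blocks below `n - 1`. -/
noncomputable def lowIndex (n : ℕ) : Finset ((_ : ℕ) × Freq) :=
  (Finset.range (n - 1)).sigma fun m => (D.finite_freq m).toFinset

lemma block_apply (n : ℕ) (u : TorusDistribution) (x : Pt) : (D.block n u).1 x =
    ∑ k ∈ (D.finite_freq n).toFinset, (D.symbol n k.toE3 * distCoeff u k) * (char k).1 x := by
  rw [block_eq_sum]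
  simp

lemma lowPart_apply (n : ℕ) (u : TorusDistribution) (x : Pt) : (D.lowPart n u).1 x =
    ∑ p ∈ D.lowIndex n, D.blockCoeff u p * (char p.2).1 x := by
  rw [lowPart, lowIndex, Finset.sum_sigma]
  simp only [Submodule.coe_sum, Finset.sum_apply, block_apply, blockCoeff]

/-- The low frequency part of a function of regularity `α < 1` has Lipschitz constant of order
`2^{n(1 - α)}`. -/
lemma exists_lipschitz_lowPart {α : ℝ} (hα : α < 1) : ∃ C : ℝ, 0 ≤ C ∧ ∀ (u : TorusDistribution)
    (U : ℝ), (∀ m x, ‖(D.block m u).1 x‖ ≤ ((2 : ℝ) ^ m) ^ (-α) * U) →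
    ∀ (n : ℕ) (x : Pt) (y : E3), ‖(D.lowPart n u).1 (x + y.ofLp) - (D.lowPart n u).1 x‖ ≤
      C * ((2 : ℝ) ^ n) ^ (1 - α) * U * ‖y‖ := by
  obtain ⟨B, hB, hB'⟩ := D.exists_norm_le
  obtain ⟨C, hC, h⟩ := exists_lipschitz_bound hB
  -- Since `α < 1` this ratio exceeds 1, so the sum of the Lipschitz constants of the blocks is
  -- comparable to its last term.
  set q : ℝ := 2 ^ (1 - α) with hq
  have hq1 : 1 < q := Real.one_lt_rpow one_lt_two (by linarith)
  have hqn : ∀ n : ℕ, ((2 : ℝ) ^ n) ^ (1 - α) = q ^ n := fun n => by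
    rw [hq, ← Real.rpow_natCast, ← Real.rpow_natCast, ← Real.rpow_mul (by norm_num),
      ← Real.rpow_mul (by norm_num), mul_comm]
  refine ⟨C / (q - 1), div_nonneg hC (by linarith), fun u U hU n x y => ?_⟩
  have hU0 : 0 ≤ U := by
    have := (norm_nonneg _).trans (hU 0 0)
    simpa using this
  have hm : ∀ m, ‖(D.block m u).1 (x + y.ofLp) - (D.block m u).1 x‖ ≤ C * U * ‖y‖ * q ^ m := by
    intro m
    have h1 := h (2 ^ m) (by positivity) Freq (D.finite_freq m).toFinset
      (fun k => D.symbol m k.toE3 * distCoeff u k) (fun k => k) (((2 : ℝ) ^ m) ^ (-α) * U)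
      (fun k hk => hB' m _ (by simpa using hk))
      (fun x => by simpa only [block_apply] using hU m x) x y
    rw [block_apply, block_apply]
    refine h1.trans (le_of_eq ?_)
    rw [← hqn, sub_eq_add_neg, Real.rpow_add (by positivity), Real.rpow_one]
    ring
  have e : (D.lowPart n u).1 (x + y.ofLp) - (D.lowPart n u).1 x =
      ∑ m ∈ Finset.range (n - 1), ((D.block m u).1 (x + y.ofLp) - (D.block m u).1 x) := by
    rw [Finset.sum_sub_distrib]
    simp [lowPart]
  rw [e, hqn]
  have hqp : q ^ (n - 1) ≤ q ^ n := pow_le_pow_right₀ hq1.le (by omega)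
  calc _ ≤ ∑ m ∈ Finset.range (n - 1), C * U * ‖y‖ * q ^ m :=
        (norm_sum_le _ _).trans (Finset.sum_le_sum fun m _ => hm m)
    _ = C * U * ‖y‖ * ((q ^ (n - 1) - 1) / (q - 1)) := by
        rw [← Finset.mul_sum, geom_sum_eq hq1.ne']
    _ ≤ C * U * ‖y‖ * (q ^ n / (q - 1)) := by
        have : 0 < q - 1 := by linarith
        gcongr
        linarith
    _ = _ := by ring

end DyadicPartition

/-! ### Smoothness of the lattice symbol -/

/-- The third order Taylor remainder of the sine is divisible by `x ^ 3`. -/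
lemma exists_sin_eq : ∃ S : ℝ → ℝ, ContDiff ℝ ∞ S ∧ ∀ x, Real.sin x = x + x ^ 3 * S x := by
  -- Divided differences are taken over `ℂ`, where they stay entire and are therefore smooth on the
  -- real line.
  set d1 : ℂ → ℂ := dslope Complex.sin 0 with hd1
  set d2 : ℂ → ℂ := dslope d1 0 with hd2
  set d3 : ℂ → ℂ := dslope d2 0 with hd3
  have step : ∀ f : ℂ → ℂ, Differentiable ℂ f → Differentiable ℂ (dslope f 0) := by
    intro f hf
    rw [← differentiableOn_univ] at hf ⊢
    exact (Complex.differentiableOn_dslope Filter.univ_mem).2 hf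
  have h1 : Differentiable ℂ d1 := step _ Complex.differentiable_sin
  have h3 : Differentiable ℂ d3 := step _ (step _ h1)
  have e1 : ∀ z, Complex.sin z = z * d1 z := fun z => by
    have := sub_smul_dslope Complex.sin 0 z
    simpa using this.symm
  have e2 : ∀ z, d1 z = 1 + z * d2 z := fun z => by
    have := sub_smul_dslope d1 0 z
    have h0 : d1 0 = 1 := by simp [hd1, dslope_same]
    rw [h0] at this
    simp only [sub_zero, smul_eq_mul] at this
    rw [hd2, this]
    ring
  -- Evenness of `sin z / z` removes the linear term of `d1`, that is, the quadratic term of the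
  -- sine.
  have hev : ∀ z, d1 (-z) = d1 z := fun z => by
    rcases eq_or_ne z 0 with rfl | hz
    · simp
    · have h4 := e1 (-z)
      rw [Complex.sin_neg, e1 z] at h4
      have : z * (d1 (-z) - d1 z) = 0 := by linear_combination h4
      rcases mul_eq_zero.1 this with h | h
      · exact absurd h hz
      · exact sub_eq_zero.1 h
  have h20 : d2 0 = 0 := by
    rw [hd2, dslope_same]
    have h4 := deriv_comp_neg d1 (0 : ℂ)
    simp only [hev, neg_zero] at h4
    linear_combination (1 / 2 : ℂ) * h4
  have e3 : ∀ z, d2 z = z * d3 z := fun z => by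
    have := sub_smul_dslope d2 0 z
    rw [h20] at this
    simpa using this.symm
  refine ⟨fun x => (d3 x).re, ?_, fun x => ?_⟩
  · exact (h3.contDiff).real_of_complex
  · have h5 : Complex.sin x = ((x : ℝ) : ℂ) + ((x ^ 3 : ℝ) : ℂ) * d3 x := by
      rw [e1, e2, e3]
      push_cast
      ring
    have h6 := congrArg Complex.re h5
    rwa [Complex.sin_ofReal_re, Complex.add_re, Complex.ofReal_re, Complex.re_ofReal_mul] at h6

/-- `4 sin²(π x / 2) = x² g(x)` where `g` is smooth, `g(x) = π² + O(x²)`, and `g` is positive away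
from the nonzero even integers. -/
lemma exists_sin_sq_eq : ∃ g r : ℝ → ℝ, ContDiff ℝ ∞ r ∧
    (∀ x, 4 * Real.sin (x * Real.pi / 2) ^ 2 = x ^ 2 * g x) ∧
    (∀ x, g x = Real.pi ^ 2 + x ^ 2 * r x) ∧
    ∃ c : ℝ, 0 < c ∧ ∀ x, |x| ≤ 1.8 → c ≤ g x := by
  obtain ⟨S, hS, hS'⟩ := exists_sin_eq
  -- Chosen so that `sin(πx/2) = (πx/2) (1 + x² v(x))`; squaring gives `g`.
  set v : ℝ → ℝ := fun x => Real.pi ^ 2 / 4 * S (x * Real.pi / 2) with hv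
  have hvc : ContDiff ℝ ∞ v := contDiff_const.mul (hS.comp (by fun_prop))
  set g : ℝ → ℝ := fun x => Real.pi ^ 2 * (1 + x ^ 2 * v x) ^ 2 with hg
  have hgc : Continuous g := by
    have := hvc.continuous
    fun_prop
  have hsin : ∀ x, 4 * Real.sin (x * Real.pi / 2) ^ 2 = x ^ 2 * g x := fun x => by
    rw [hS', hg, hv]
    ring
  -- As `1.8 < 2`, the sine vanishes on this interval only at `x = 0`, where `g = π²`. Compactness
  -- then yields the uniform lower bound.
  have hpos : ∀ x ∈ Set.Icc (-1.8 : ℝ) 1.8, 0 < g x := by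
    intro x hx
    have h0 : 0 ≤ g x := by
      simp only [hg]
      positivity
    refine h0.lt_of_ne' fun h => ?_
    have h1 := hsin x
    rw [h, mul_zero] at h1
    have h2 : Real.sin (x * Real.pi / 2) = 0 := by
      have : Real.sin (x * Real.pi / 2) ^ 2 = 0 := by linarith
      exact pow_eq_zero_iff (two_ne_zero) |>.1 this
    have h3 := (Real.sin_eq_zero_iff_of_lt_of_lt (x := x * Real.pi / 2)
      (by nlinarith [hx.1, Real.pi_pos]) (by nlinarith [hx.2, Real.pi_pos])).1 h2
    have h4 : x = 0 := by
      have : x * Real.pi = 0 := by linarith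
      exact (mul_eq_zero.1 this).resolve_right Real.pi_ne_zero
    rw [h4] at h
    simp [hg, Real.pi_ne_zero] at h
  obtain ⟨x₀, hx₀, hmin⟩ := isCompact_Icc.exists_isMinOn (Set.nonempty_Icc.2 (by norm_num))
    hgc.continuousOn (s := Set.Icc (-1.8 : ℝ) 1.8)
  refine ⟨g, fun x => Real.pi ^ 2 * (2 * v x + x ^ 2 * v x ^ 2), by fun_prop, hsin, fun x => ?_,
    g x₀, hpos x₀ hx₀, fun x hx => hmin (abs_le.1 hx)⟩
  simp only [hg]
  ring

/-! ### Derivative bounds -/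

lemma iteratedFDeriv_slice_le {P : Type*} [NormedAddCommGroup P] [NormedSpace ℝ P]
    {Φ : P × E3 → ℝ} (hΦ : ContDiff ℝ ∞ Φ) (p : P) (ξ : E3) (i : ℕ) :
    ‖iteratedFDeriv ℝ i (fun ξ => Φ (p, ξ)) ξ‖ ≤ ‖iteratedFDeriv ℝ i Φ (p, ξ)‖ := by
  have e : (fun ξ => Φ (p, ξ)) =
      (fun z => Φ (z + (p, 0))) ∘ (ContinuousLinearMap.inr ℝ P E3) := by
    funext ξ
    simp
  have hΦ' : ContDiff ℝ ∞ fun z => Φ (z + (p, 0)) := hΦ.comp (by fun_prop)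
  rw [e, ContinuousLinearMap.iteratedFDeriv_comp_right _ hΦ' ξ (i := i) (by exact_mod_cast le_top),
    iteratedFDeriv_comp_add_right]
  refine (ContinuousMultilinearMap.norm_compContinuousLinearMap_le _ _).trans ?_
  simp only [ContinuousLinearMap.inr_apply, Prod.mk_add_mk, zero_add, add_zero, Finset.prod_const,
    Finset.card_univ, Fintype.card_fin]
  refine mul_le_of_le_one_right (norm_nonneg _) (pow_le_one₀ (norm_nonneg _) ?_)
  exact ContinuousLinearMap.norm_inr_le_one ℝ P E3

/-- Joint smoothness on a compact set of parameters times a ball makes the bounds uniform in the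
parameter. This is how the later constants avoid depending on mesh and dyadic level. -/
lemma exists_bound_slice {P : Type*} [NormedAddCommGroup P] [NormedSpace ℝ P]
    {Φ : P × E3 → ℝ} (hΦ : ContDiff ℝ ∞ Φ) {K : Set P} (hK : IsCompact K) (b : ℝ) :
    ∃ C : ℝ, 1 ≤ C ∧ ∀ p ∈ K, ∀ ξ : E3, ‖ξ‖ ≤ b → ∀ i ≤ 5,
      ‖iteratedFDeriv ℝ i (fun ξ => Φ (p, ξ)) ξ‖ ≤ C := by
  have h1 : ∀ i : ℕ, ∃ G : ℝ, ∀ z ∈ K ×ˢ Metric.closedBall (0 : E3) b,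
      ‖iteratedFDeriv ℝ i Φ z‖ ≤ G := fun i =>
    (hK.prod (isCompact_closedBall _ _)).exists_bound_of_continuousOn
      (hΦ.continuous_iteratedFDeriv (by exact_mod_cast le_top)).continuousOn
  choose G hG using h1
  refine ⟨1 + ∑ i ∈ Finset.range 6, |G i|, by
    have : 0 ≤ ∑ i ∈ Finset.range 6, |G i| := by positivity
    linarith, fun p hp ξ hξ i hi => (iteratedFDeriv_slice_le hΦ p ξ i).trans
    ((hG i (p, ξ) ⟨hp, by simpa using hξ⟩).trans ((le_abs_self _).trans ?_))⟩
  have := Finset.single_le_sum (f := fun i => |G i|) (fun i _ => abs_nonneg _)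
    (Finset.mem_range.2 (by omega : i < 6))
  linarith

lemma norm_iteratedFDeriv_mul_le_of_le {f g : E3 → ℝ} (hf : ContDiff ℝ ∞ f) (hg : ContDiff ℝ ∞ g)
    {ξ : E3} {A B : ℝ} (hA : ∀ i ≤ 5, ‖iteratedFDeriv ℝ i f ξ‖ ≤ A)
    (hB : ∀ i ≤ 5, ‖iteratedFDeriv ℝ i g ξ‖ ≤ B) :
    ∀ i ≤ 5, ‖iteratedFDeriv ℝ i (fun ξ => f ξ * g ξ) ξ‖ ≤ 32 * A * B := by
  intro i hi
  have hA0 : 0 ≤ A := (norm_nonneg _).trans (hA 0 (by simp))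
  have hB0 : 0 ≤ B := (norm_nonneg _).trans (hB 0 (by simp))
  refine (norm_iteratedFDeriv_mul_le hf hg ξ (n := i) (by exact_mod_cast le_top)).trans ?_
  calc _ ≤ ∑ j ∈ Finset.range (i + 1), (i.choose j : ℝ) * A * B := by
        refine Finset.sum_le_sum fun j hj => ?_
        have := Finset.mem_range.1 hj
        gcongr
        · exact hA j (by omega)
        · exact hB _ (by omega)
    _ = 2 ^ i * A * B := by
        rw [← Finset.sum_mul, ← Finset.sum_mul]
        congr 2
        exact_mod_cast Nat.sum_range_choose i
    _ ≤ 2 ^ 5 * A * B := by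
        gcongr
        norm_num
    _ = _ := by norm_num

/-- Bound for derivatives of a composition, with `120 = 5!`. Each derivative of the outer
exponential brings one factor `s`, and `F ξ ≥ c` preserves the exponential decay. -/
lemma norm_iteratedFDeriv_exp_le {F : E3 → ℝ} (hF : ContDiff ℝ ∞ F) {ξ : E3} {s c A : ℝ}
    (hs : 0 ≤ s) (hA1 : 1 ≤ A) (hA : ∀ i ≤ 5, ‖iteratedFDeriv ℝ i F ξ‖ ≤ A) (hc : c ≤ F ξ) :
    ∀ i ≤ 5, ‖iteratedFDeriv ℝ i (fun ξ => Real.exp (-s * F ξ)) ξ‖ ≤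
      120 * A ^ 5 * ((1 + s) ^ 5 * Real.exp (-s * c)) := by
  intro i hi
  have hg : ContDiff ℝ ∞ fun y : ℝ => Real.exp (-s * y) := by fun_prop
  have h1 : ∀ j ≤ i, ‖iteratedFDeriv ℝ j (fun y : ℝ => Real.exp (-s * y)) (F ξ)‖ ≤
      (1 + s) ^ 5 * Real.exp (-s * c) := by
    intro j hj
    rw [norm_iteratedFDeriv_eq_norm_iteratedDeriv]
    have e : iteratedDeriv j (fun y : ℝ => Real.exp (-s * y)) =
        fun y => (-s) ^ j * Real.exp (-s * y) := iteratedDeriv_exp_const_mul j (-s)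
    rw [e, norm_mul, norm_pow, norm_neg, Real.norm_of_nonneg hs, Real.norm_of_nonneg (Real.exp_pos _).le]
    have h2 : s ^ j ≤ (1 + s) ^ 5 :=
      (pow_le_pow_left₀ hs (by linarith) j).trans (pow_le_pow_right₀ (by linarith) (by omega))
    have h3 : -s * F ξ ≤ -s * c := by nlinarith
    gcongr
  have h4 := norm_iteratedFDeriv_comp_le hg hF (n := i) (by exact_mod_cast le_top) ξ h1 (D := A)
    (fun j hj1 hj => (hA j (by omega)).trans (le_self_pow₀ hA1 (by omega)))
  refine h4.trans ?_
  have h5 : (i.factorial : ℝ) ≤ 120 := by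
    have := Nat.factorial_le hi
    exact_mod_cast this
  have h6 : A ^ i ≤ A ^ 5 := pow_le_pow_right₀ hA1 hi
  calc (i.factorial : ℝ) * ((1 + s) ^ 5 * Real.exp (-s * c)) * A ^ i
      ≤ 120 * ((1 + s) ^ 5 * Real.exp (-s * c)) * A ^ 5 := by gcongr
    _ = _ := by ring

/-! ### Commutators with the heat semigroups -/

/-- The commutator of the multiplier `M(D / r)` and the multiplication by a trigonometric polynomial
of Lipschitz constant `L`, applied to a trigonometric polynomial of size `B`, is of size
`G L B / r`, provided that `M` is only evaluated in `S`. -/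
def CommutatorBound (S : Set E3) (M : E3 → ℝ) (G : ℝ) : Prop :=
  ∀ (r : ℝ), 0 < r → ∀ (ι ι' : Type) (I : Finset ι) (J : Finset ι') (a : ι → ℂ) (a' : ι' → ℂ)
    (κ : ι → Freq) (κ' : ι' → Freq) (L B : ℝ), 0 ≤ L →
    (∀ p ∈ I ×ˢ J, r⁻¹ • (κ p.1 + κ' p.2).toE3 ∈ S ∧ r⁻¹ • (κ' p.2).toE3 ∈ S) →
    (∀ (x : Pt) (y : E3), ‖∑ i ∈ I, a i * (char (κ i)).1 (x + y.ofLp) -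
      ∑ i ∈ I, a i * (char (κ i)).1 x‖ ≤ L * ‖y‖) →
    (∀ x, ‖∑ j ∈ J, a' j * (char (κ' j)).1 x‖ ≤ B) →
    ∀ x, ‖∑ p ∈ I ×ˢ J, ((M (r⁻¹ • (κ p.1 + κ' p.2).toE3) : ℂ) - M (r⁻¹ • (κ' p.2).toE3)) *
      (a p.1 * a' p.2) * (char (κ p.1 + κ' p.2)).1 x‖ ≤ G * (L * B / r)

lemma CommutatorBound.congr {S : Set E3} {M M' : E3 → ℝ} {G : ℝ} (h : CommutatorBound S M G)
    (hM : ∀ ξ ∈ S, M' ξ = M ξ) : CommutatorBound S M' G := by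
  intro r hr ι ι' I J a a' κ κ' L B hL hS hA hB x
  refine le_trans (le_of_eq ?_) (h r hr ι ι' I J a a' κ κ' L B hL hS hA hB x)
  congr 1
  refine Finset.sum_congr rfl fun p hp => ?_
  rw [hM _ (hS p hp).1, hM _ (hS p hp).2]

lemma CommutatorBound.mono {S : Set E3} {M : E3 → ℝ} {G G' : ℝ} (h : CommutatorBound S M G)
    (hG : G ≤ G') : CommutatorBound S M G' := by
  intro r hr ι ι' I J a a' κ κ' L B hL hS hA hB x
  have hB0 : 0 ≤ B := (norm_nonneg _).trans (hB x)
  exact (h r hr ι ι' I J a a' κ κ' L B hL hS hA hB x).trans (by gcongr)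

lemma CommutatorBound.sub {S : Set E3} {M M' : E3 → ℝ} {G G' : ℝ} (h : CommutatorBound S M G)
    (h' : CommutatorBound S M' G') : CommutatorBound S (fun ξ => M ξ - M' ξ) (G + G') := by
  intro r hr ι ι' I J a a' κ κ' L B hL hS hA hB x
  have h1 := h r hr ι ι' I J a a' κ κ' L B hL hS hA hB x
  have h2 := h' r hr ι ι' I J a a' κ κ' L B hL hS hA hB x
  rw [add_mul]
  refine le_trans (le_of_eq ?_) ((norm_sub_le _ _).trans (add_le_add h1 h2))
  rw [← Finset.sum_sub_distrib]
  congr 1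
  refine Finset.sum_congr rfl fun p _ => ?_
  push_cast
  ring

lemma CommutatorBound.const_mul {S : Set E3} {M : E3 → ℝ} {G : ℝ} (h : CommutatorBound S M G)
    (c : ℝ) : CommutatorBound S (fun ξ => c * M ξ) (|c| * G) := by
  intro r hr ι ι' I J a a' κ κ' L B hL hS hA hB x
  have h1 := h r hr ι ι' I J a a' κ κ' L B hL hS hA hB x
  rw [mul_assoc, ← Real.norm_eq_abs, ← Complex.norm_real]
  refine le_trans (le_of_eq ?_) (mul_le_mul_of_nonneg_left h1 (norm_nonneg _))
  rw [← norm_mul, Finset.mul_sum]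
  congr 1
  refine Finset.sum_congr rfl fun p _ => ?_
  push_cast
  ring

/-- The mean value inequality for commutators. -/
lemma CommutatorBound.of_deriv {S : Set E3} {M N : ℝ → E3 → ℝ} {G : ℝ}
    (hM : ∀ τ ξ, HasDerivAt (fun τ => M τ ξ) (N τ ξ) τ)
    (h : ∀ τ ∈ Set.Icc (0 : ℝ) 1, CommutatorBound S (N τ) G) :
    CommutatorBound S (fun ξ => M 1 ξ - M 0 ξ) G := by
  intro r hr ι ι' I J a a' κ κ' L B hL hS hA hB x
  have hd : ∀ τ : ℝ, HasDerivAt (fun τ => ∑ p ∈ I ×ˢ J,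
      ((M τ (r⁻¹ • (κ p.1 + κ' p.2).toE3) : ℂ) - M τ (r⁻¹ • (κ' p.2).toE3)) *
      (a p.1 * a' p.2) * (char (κ p.1 + κ' p.2)).1 x) (∑ p ∈ I ×ˢ J,
      ((N τ (r⁻¹ • (κ p.1 + κ' p.2).toE3) : ℂ) - N τ (r⁻¹ • (κ' p.2).toE3)) *
      (a p.1 * a' p.2) * (char (κ p.1 + κ' p.2)).1 x) τ := fun τ =>
    HasDerivAt.fun_sum fun p _ =>
      ((((hM τ _).ofReal_comp).sub ((hM τ _).ofReal_comp)).mul_const _).mul_const _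
  have h1 := norm_image_sub_le_of_norm_deriv_le_segment_01'
    (fun τ _ => (hd τ).hasDerivWithinAt)
    (fun τ hτ => h τ ⟨hτ.1, hτ.2.le⟩ r hr ι ι' I J a a' κ κ' L B hL hS hA hB x)
  refine le_trans (le_of_eq ?_) h1
  rw [← Finset.sum_sub_distrib]
  congr 1
  refine Finset.sum_congr rfl fun p _ => ?_
  push_cast
  ring

lemma exists_commutatorBound (b : ℝ) : ∃ C : ℝ, 0 ≤ C ∧ ∀ (M : E3 → ℝ) (G : ℝ), ContDiff ℝ ∞ M →
    (∀ ξ, b < ‖ξ‖ → M ξ = 0) → (∀ i ≤ 5, ∀ ξ, ‖iteratedFDeriv ℝ i M ξ‖ ≤ G) →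
    ∀ S, CommutatorBound S M (C * G) := by
  obtain ⟨C, hC, h⟩ := exists_commutator_bound b
  exact ⟨C, hC, fun M G h1 h2 h3 S r hr ι ι' I J a a' κ κ' L B hL _ hA hB x =>
    h M G h1 h2 h3 r hr ι ι' I J a a' κ κ' L B hL hA hB x⟩

/-! ### Uniform estimates for the rescaled heat symbols. -/

/-- The exponent needs to be controlled only on `Z`: since `Z` is closed and contains the points
where `W` is nonzero, all derivatives of the product vanish off it. -/
lemma norm_iteratedFDeriv_exp_mul_le {E W : E3 → ℝ} (hE : ContDiff ℝ ∞ E) (hW : ContDiff ℝ ∞ W)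
    {Z : Set E3} (hZ : IsClosed Z) (hWZ : ∀ ξ, W ξ ≠ 0 → ξ ∈ Z) {s c A A' : ℝ} (hs : 0 ≤ s)
    (hA1 : 1 ≤ A) (hA : ∀ ξ ∈ Z, ∀ i ≤ 5, ‖iteratedFDeriv ℝ i E ξ‖ ≤ A) (hc : ∀ ξ ∈ Z, c ≤ E ξ)
    (hA0 : 0 ≤ A') (hA' : ∀ ξ ∈ Z, ∀ i ≤ 5, ‖iteratedFDeriv ℝ i W ξ‖ ≤ A') :
    ∀ i ≤ 5, ∀ ξ, ‖iteratedFDeriv ℝ i (fun ξ => Real.exp (-s * E ξ) * W ξ) ξ‖ ≤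
      32 * (120 * A ^ 5 * ((1 + s) ^ 5 * Real.exp (-s * c))) * A' := by
  intro i hi ξ
  by_cases hξ : ξ ∈ Z
  · exact norm_iteratedFDeriv_mul_le_of_le (by fun_prop) hW
      (norm_iteratedFDeriv_exp_le hE hs hA1 (hA ξ hξ) (hc ξ hξ)) (hA' ξ hξ) i hi
  · have h1 : iteratedFDeriv ℝ i (fun ξ => Real.exp (-s * E ξ) * W ξ) ξ = 0 := by
      by_contra h
      refine hξ (closure_minimal (fun η hη => hWZ η ?_) hZ (support_iteratedFDeriv_subset i h))
      exact right_ne_zero_of_mul hη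
    rw [h1, norm_zero]
    positivity

/-- The exponent interpolating between the continuous heat semigroup (`τ = 0`) and the lattice heat
semigroup (`τ = 1`). -/
noncomputable def heatExponent (ρ : ℝ → ℝ) (q : ℝ × ℝ) (ξ : E3) : ℝ :=
  ∑ l, (Real.pi ^ 2 * ξ l ^ 2 + q.1 * q.2 ^ 2 * (ξ l ^ 4 * ρ (q.2 * ξ l)))

lemma contDiff_heatExponent {ρ : ℝ → ℝ} (hρ : ContDiff ℝ ∞ ρ) :
    ContDiff ℝ ∞ fun z : (ℝ × ℝ) × E3 => heatExponent ρ z.1 z.2 := by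
  unfold heatExponent
  refine ContDiff.sum fun l _ => ?_
  have h1 : ContDiff ℝ ∞ fun z : (ℝ × ℝ) × E3 => z.2 l := by fun_prop
  have h2 : ContDiff ℝ ∞ fun z : (ℝ × ℝ) × E3 => ρ (z.1.2 * z.2 l) := hρ.comp (by fun_prop)
  fun_prop

/-- In each coordinate the exponent is a convex combination of `π² ξ_l²` and `g(h ξ_l) ξ_l²`, and
both are at least `c ξ_l²`. -/
lemma le_heatExponent {g ρ : ℝ → ℝ} (hg : ∀ x, g x = Real.pi ^ 2 + x ^ 2 * ρ x) {c : ℝ}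
    (hc : ∀ x, |x| ≤ 1.8 → c ≤ g x) (hc' : c ≤ Real.pi ^ 2) {τ h : ℝ} (hτ : τ ∈ Set.Icc (0 : ℝ) 1)
    {ξ : E3} (hξ : ‖h • ξ‖ ≤ 1.8) : c * ‖ξ‖ ^ 2 ≤ heatExponent ρ (τ, h) ξ := by
  rw [EuclideanSpace.real_norm_sq_eq, Finset.mul_sum, heatExponent]
  refine Finset.sum_le_sum fun l _ => ?_
  have h1 : |h * ξ l| ≤ 1.8 := (PiLp.norm_apply_le (h • ξ) l).trans hξ
  have h2 := hc _ h1
  rw [hg] at h2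
  have h3 : c ≤ (1 - τ) * Real.pi ^ 2 + τ * (Real.pi ^ 2 + (h * ξ l) ^ 2 * ρ (h * ξ l)) := by
    nlinarith [mul_le_mul_of_nonneg_left h2 hτ.1,
      mul_le_mul_of_nonneg_left hc' (sub_nonneg.2 hτ.2)]
  calc c * ξ l ^ 2 ≤ _ := mul_le_mul_of_nonneg_right h3 (sq_nonneg (ξ l))
    _ = _ := by ring

/-- Uniform commutator bounds for smooth weights times interpolated heat semigroups. -/
lemma exists_commutatorBound_weight {g ρ : ℝ → ℝ} (hρ : ContDiff ℝ ∞ ρ)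
    (hg : ∀ x, g x = Real.pi ^ 2 + x ^ 2 * ρ x) {c : ℝ} (hc0 : 0 < c)
    (hc : ∀ x, |x| ≤ 1.8 → c ≤ g x) {W : ℝ × E3 → ℝ} (hW : ContDiff ℝ ∞ W) {a b : ℝ} (H : ℝ)
    (ha : 0 < a) (hWs : ∀ h ∈ Set.Icc 0 H, ∀ ξ, W (h, ξ) ≠ 0 →
      a ≤ ‖ξ‖ ∧ ‖ξ‖ ≤ b ∧ ‖h • ξ‖ ≤ 1.8) :
    ∃ C c' : ℝ, 0 ≤ C ∧ 0 < c' ∧ ∀ s : ℝ, 0 ≤ s → ∀ τ ∈ Set.Icc (0 : ℝ) 1, ∀ h ∈ Set.Icc 0 H,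
      ∀ S, CommutatorBound S (fun ξ => Real.exp (-s * heatExponent ρ (τ, h) ξ) * W (h, ξ))
        (C * ((1 + s) ^ 5 * Real.exp (-s * c'))) := by
  obtain ⟨C, hC, hcomm⟩ := exists_commutatorBound b
  obtain ⟨A, hA1, hA⟩ := exists_bound_slice (contDiff_heatExponent hρ)
    (isCompact_Icc (a := (0 : ℝ)) (b := 1) |>.prod (isCompact_Icc (a := (0 : ℝ)) (b := H))) b
  obtain ⟨A', hA1', hA'⟩ := exists_bound_slice hW (isCompact_Icc (a := (0 : ℝ)) (b := H)) b
  set c1 := min c (Real.pi ^ 2) with hc1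
  have hc1' : 0 < c1 := lt_min hc0 (by positivity)
  -- The decay rate is the lower bound `c1 ‖ξ‖²` of the exponent evaluated at the inner radius `a`.
  refine ⟨C * (32 * (120 * A ^ 5) * A'), c1 * a ^ 2, by positivity, by positivity,
    fun s hs τ hτ h hh S => ?_⟩
  have hsE : ContDiff ℝ ∞ (heatExponent ρ (τ, h)) :=
    (contDiff_heatExponent hρ).comp (by fun_prop : ContDiff ℝ ∞ fun ξ : E3 => ((τ, h), ξ))
  have hsW : ContDiff ℝ ∞ fun ξ => W (h, ξ) := hW.comp (by fun_prop)
  have hZ : IsClosed {ξ : E3 | a ≤ ‖ξ‖ ∧ ‖ξ‖ ≤ b ∧ ‖h • ξ‖ ≤ 1.8} :=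
    (isClosed_le continuous_const continuous_norm).inter
      ((isClosed_le continuous_norm continuous_const).inter
        (isClosed_le (continuous_const_smul h).norm continuous_const))
  refine (hcomm _ (32 * (120 * A ^ 5 * ((1 + s) ^ 5 * Real.exp (-s * (c1 * a ^ 2)))) * A')
    (by fun_prop) ?_ ?_ S).mono (le_of_eq (by ring))
  · intro ξ hξ
    by_contra h0
    exact absurd (hWs h hh ξ (right_ne_zero_of_mul h0)).2.1 (not_le.2 hξ)
  · refine norm_iteratedFDeriv_exp_mul_le hsE hsW hZ (hWs h hh) hs hA1 ?_ ?_ (by linarith) ?_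
    · exact fun ξ hξ => hA (τ, h) ⟨hτ, hh⟩ ξ hξ.2.1
    · intro ξ hξ
      refine le_trans ?_ (le_heatExponent hg (c := c1)
        (fun x hx => (min_le_left _ _).trans (hc x hx)) (min_le_right _ _) hτ hξ.2.2)
      have := hξ.1
      gcongr
    · exact fun ξ hξ => hA' h hh ξ hξ.2.1

/-- Smooth cutoffs to annuli. -/
lemma exists_annulus_cutoff {a b : ℝ} (ha : 0 < a) (hb : 0 < b) : ∃ ψ : E3 → ℝ, ContDiff ℝ ∞ ψ ∧
    (∀ ξ, a ≤ ‖ξ‖ → ‖ξ‖ ≤ b → ψ ξ = 1) ∧ ∀ ξ, ψ ξ ≠ 0 → a / 2 ≤ ‖ξ‖ ∧ ‖ξ‖ ≤ 2 * b := by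
  let ψ₁ : ContDiffBump (0 : E3) := ⟨b, 2 * b, hb, by linarith⟩
  let ψ₂ : ContDiffBump (0 : E3) := ⟨a / 2, a, by linarith, by linarith⟩
  refine ⟨fun ξ => ψ₁ ξ * (1 - ψ₂ ξ), ψ₁.contDiff.mul (contDiff_const.sub ψ₂.contDiff),
    fun ξ h1 h2 => ?_, fun ξ hξ => ⟨?_, ?_⟩⟩
  · beta_reduce
    rw [ψ₁.one_of_mem_closedBall (by simpa using h2), ψ₂.zero_of_le_dist (by simpa using h1)]
    simp
  · by_contra h
    refine hξ ?_
    beta_reduce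
    rw [ψ₂.one_of_mem_closedBall (by simpa using (not_le.1 h).le)]
    simp
  · by_contra h
    refine hξ ?_
    beta_reduce
    rw [ψ₁.zero_of_le_dist (by simpa using (not_le.1 h).le), zero_mul]

/-- The rescaled symbol of `P̃_t^ε`. -/
noncomputable def latticeSymbol (φ : Cutoff) (s h : ℝ) (ξ : E3) : ℝ :=
  Real.exp (-s * (4 / h ^ 2 * ∑ l, Real.sin (h * ξ l * Real.pi / 2) ^ 2)) * φ.toFun (h • ξ)

/-- The rescaled symbol of `P_t`. -/
noncomputable def heatSymbol (s : ℝ) (ξ : E3) : ℝ := Real.exp (-s * (Real.pi ^ 2 * ‖ξ‖ ^ 2))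

lemma heatExponent_zero (ρ : ℝ → ℝ) (h : ℝ) (ξ : E3) :
    heatExponent ρ (0, h) ξ = Real.pi ^ 2 * ‖ξ‖ ^ 2 := by
  rw [EuclideanSpace.real_norm_sq_eq, Finset.mul_sum, heatExponent]
  simp

lemma heatExponent_one {g ρ : ℝ → ℝ} (hg : ∀ x, g x = Real.pi ^ 2 + x ^ 2 * ρ x)
    (hs : ∀ x, 4 * Real.sin (x * Real.pi / 2) ^ 2 = x ^ 2 * g x) {h : ℝ} (hh : h ≠ 0) (ξ : E3) :
    heatExponent ρ (1, h) ξ = 4 / h ^ 2 * ∑ l, Real.sin (h * ξ l * Real.pi / 2) ^ 2 := by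
  rw [Finset.mul_sum, heatExponent]
  refine Finset.sum_congr rfl fun l _ => ?_
  have h1 := hs (h * ξ l)
  rw [hg] at h1
  rw [div_mul_eq_mul_div, h1]
  field_simp

/-- Commutator bounds for the lattice heat semigroup, the heat semigroup, and their difference. -/
lemma exists_heat_commutatorBound (φ : Cutoff) {a b : ℝ} (ha : 0 < a) (hb : 0 < b) :
    ∃ C c : ℝ, 0 ≤ C ∧ 0 < c ∧ ∀ s h : ℝ, 0 < s → 0 < h →
      CommutatorBound {ξ | a ≤ ‖ξ‖ ∧ ‖ξ‖ ≤ b} (latticeSymbol φ s h)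
        (C * ((1 + s) ^ 6 * Real.exp (-s * c))) ∧
      CommutatorBound {ξ | a ≤ ‖ξ‖ ∧ ‖ξ‖ ≤ b} (heatSymbol s)
        (C * ((1 + s) ^ 6 * Real.exp (-s * c))) ∧
      CommutatorBound {ξ | a ≤ ‖ξ‖ ∧ ‖ξ‖ ≤ b} (fun ξ => latticeSymbol φ s h ξ - heatSymbol s ξ)
        (C * min 1 (h ^ 2) * ((1 + s) ^ 6 * Real.exp (-s * c))) := by
  obtain ⟨g, ρ, hρ, hs, hg, c, hc0, hc⟩ := exists_sin_sq_eq
  obtain ⟨ψ, hψ, hψ1, hψs⟩ := exists_annulus_cutoff ha hb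
  have hψ' : ContDiff ℝ ∞ fun z : ℝ × E3 => ψ z.2 := hψ.comp contDiff_snd
  have hφ' : ContDiff ℝ ∞ fun z : ℝ × E3 => φ.toFun (z.1 • z.2) :=
    φ.smooth.comp (contDiff_fst.smul contDiff_snd)
  have hρ' : ContDiff ℝ ∞ fun z : ℝ × E3 => ∑ l, z.2 l ^ 4 * ρ (z.1 * z.2 l) := by
    refine ContDiff.sum fun l _ => ?_
    have h1 : ContDiff ℝ ∞ fun z : ℝ × E3 => z.2 l := by fun_prop
    have h2 : ContDiff ℝ ∞ fun z : ℝ × E3 => ρ (z.1 * z.2 l) := hρ.comp (by fun_prop)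
    fun_prop
  -- For `h > H` and `‖ξ‖ ≥ a`, the point `h • ξ` is outside the support of `φ`. Only the compact
  -- range `[0, H]` of mesh parameters remains.
  set H : ℝ := 3.6 / a with hH
  -- For `h ≤ h₀` the cutoff `φ` equals 1 on the whole support of `ψ`, so the two semigroups differ
  -- only in their exponents.
  set h₀ : ℝ := min (1 / (2 * b)) 1 with hh₀
  have hh₀' : 0 < h₀ := by positivity
  have hsmall : ∀ h ∈ Set.Icc 0 h₀, ∀ ξ : E3, ‖ξ‖ ≤ 2 * b → ‖h • ξ‖ ≤ 1 := by
    intro h hh ξ hξ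
    rw [norm_smul, Real.norm_of_nonneg hh.1]
    calc h * ‖ξ‖ ≤ 1 / (2 * b) * (2 * b) :=
          mul_le_mul (hh.2.trans (min_le_left _ _)) hξ (norm_nonneg _) (by positivity)
      _ = 1 := by field_simp
  have hφsupp : ∀ ξ, φ.toFun ξ ≠ 0 → ‖ξ‖ ≤ 1.8 := fun ξ hξ => φ.support (subset_tsupport _ hξ)
  -- Three weights: `φ(hξ) ψ` for the lattice symbol, `ψ` for the heat symbol with `h = 0`, and `ψ`
  -- times the quartic term from the derivative of the exponent for their difference.
  obtain ⟨C1, c1, hC1, hc1, h1⟩ := exists_commutatorBound_weight hρ hg hc0 hc (hφ'.mul hψ')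
    (a := a / 2) (b := 2 * b) H (by positivity) (fun h _ ξ hξ =>
      ⟨(hψs ξ (right_ne_zero_of_mul hξ)).1, (hψs ξ (right_ne_zero_of_mul hξ)).2,
        hφsupp _ (left_ne_zero_of_mul hξ)⟩)
  obtain ⟨C2, c2, hC2, hc2, h2⟩ := exists_commutatorBound_weight hρ hg hc0 hc hψ'
    (a := a / 2) (b := 2 * b) 0 (by positivity) (fun h hh ξ hξ =>
      ⟨(hψs ξ hξ).1, (hψs ξ hξ).2, by
        have : h = 0 := le_antisymm hh.2 hh.1
        rw [this]
        norm_num⟩)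
  obtain ⟨C3, c3, hC3, hc3, h3⟩ := exists_commutatorBound_weight hρ hg hc0 hc (hρ'.mul hψ')
    (a := a / 2) (b := 2 * b) h₀ (by positivity) (fun h hh ξ hξ =>
      ⟨(hψs ξ (right_ne_zero_of_mul hξ)).1, (hψs ξ (right_ne_zero_of_mul hξ)).2,
        (hsmall h hh ξ (hψs ξ (right_ne_zero_of_mul hξ)).2).trans (by norm_num)⟩)
  set c' := min c1 (min c2 c3) with hc'
  have hc'0 : 0 < c' := by positivity
  -- Brings all bounds to a common constant and the slowest decay rate. The sixth power leaves room
  -- for one more factor `s`.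
  have hexp : ∀ s c'' C : ℝ, 0 < s → 0 ≤ C → c' ≤ c'' → ∀ C', C ≤ C' →
      C * ((1 + s) ^ 5 * Real.exp (-s * c'')) ≤ C' * ((1 + s) ^ 6 * Real.exp (-s * c')) := by
    intro s c'' C hs hC hcc C' hCC
    have h4 : -s * c'' ≤ -s * c' := by nlinarith
    have h5 : (1 + s) ^ 5 ≤ (1 + s) ^ 6 := pow_le_pow_right₀ (by linarith) (by norm_num)
    have h6 : 0 ≤ C' := hC.trans hCC
    gcongr
  have h01 : (0 : ℝ) ∈ Set.Icc (0 : ℝ) 1 := by simp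
  have h11 : (1 : ℝ) ∈ Set.Icc (0 : ℝ) 1 := by simp
  set K := C1 + C2 + C3 with hK
  set Q := max 1 (1 / h₀ ^ 2) with hQ
  have hQ1 : 1 ≤ Q := le_max_left _ _
  have hK0 : 0 ≤ K := by positivity
  have hlat : ∀ s h : ℝ, 0 < s → 0 < h → CommutatorBound {ξ | a ≤ ‖ξ‖ ∧ ‖ξ‖ ≤ b}
      (latticeSymbol φ s h) (K * ((1 + s) ^ 6 * Real.exp (-s * c'))) := by
    intro s h hs0 hh
    rcases le_or_gt h H with hhH | hhH
    · refine ((h1 s hs0.le 1 h11 h ⟨hh.le, hhH⟩ _).congr fun ξ hξ => ?_).mono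
        (hexp s c1 C1 hs0 hC1 (min_le_left _ _) K (by linarith))
      rw [latticeSymbol, ← heatExponent_one hg hs hh.ne', hψ1 ξ hξ.1 hξ.2, mul_one]
    · have h4 := ((h2 s hs0.le 0 h01 0 (by simp) {ξ | a ≤ ‖ξ‖ ∧ ‖ξ‖ ≤ b}).const_mul 0).mono
        (G' := K * ((1 + s) ^ 6 * Real.exp (-s * c'))) (by
          rw [abs_zero, zero_mul]
          positivity)
      refine h4.congr fun ξ hξ => ?_
      rw [zero_mul, latticeSymbol]
      refine mul_eq_zero_of_right _ ?_
      by_contra h0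
      have h5 := hφsupp _ h0
      rw [norm_smul, Real.norm_of_nonneg hh.le] at h5
      have h6 : H * a < h * ‖ξ‖ := by
        have := hξ.1
        have hH0 : 0 < H := by positivity
        nlinarith
      have h7 : H * a = 3.6 := by rw [hH]; field_simp
      norm_num at h5 h7
      linarith
  have hheat : ∀ s : ℝ, 0 < s → CommutatorBound {ξ | a ≤ ‖ξ‖ ∧ ‖ξ‖ ≤ b}
      (heatSymbol s) (K * ((1 + s) ^ 6 * Real.exp (-s * c'))) := by
    intro s hs0
    refine ((h2 s hs0.le 0 h01 0 (by simp) _).congr fun ξ hξ => ?_).mono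
      (hexp s c2 C2 hs0 hC2 ((min_le_right _ _).trans (min_le_left _ _)) K (by linarith))
    rw [heatSymbol, heatExponent_zero, hψ1 ξ hξ.1 hξ.2, mul_one]
  refine ⟨2 * K * Q, c', by positivity, hc'0, fun s h hs0 hh => ⟨?_, ?_, ?_⟩⟩
  · refine (hlat s h hs0 hh).mono ?_
    gcongr
    nlinarith
  · refine (hheat s hs0).mono ?_
    gcongr
    nlinarith
  · rcases le_or_gt h h₀ with hhh | hhh
    -- The derivative along the interpolation produces the gain `h²`, together with a factor `s`
    -- that is absorbed into `(1 + s)^6`.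
    · have hder : ∀ (τ : ℝ) (ξ : E3),
          HasDerivAt (fun τ => Real.exp (-s * heatExponent ρ (τ, h) ξ) * ψ ξ)
          (-(s * h ^ 2) * (Real.exp (-s * heatExponent ρ (τ, h) ξ) *
            ((∑ l, ξ l ^ 4 * ρ (h * ξ l)) * ψ ξ))) τ := by
        intro τ ξ
        have e : ∀ τ, heatExponent ρ (τ, h) ξ =
            ∑ l, Real.pi ^ 2 * ξ l ^ 2 + τ * (h ^ 2 * ∑ l, ξ l ^ 4 * ρ (h * ξ l)) := by
          intro τ
          rw [heatExponent, Finset.sum_add_distrib, Finset.mul_sum, Finset.mul_sum]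
          congr 1
          refine Finset.sum_congr rfl fun l _ => ?_
          ring
        simp only [e]
        have h4 := ((((hasDerivAt_id τ).mul_const (h ^ 2 * ∑ l, ξ l ^ 4 * ρ (h * ξ l))).const_add
          (∑ l, Real.pi ^ 2 * ξ l ^ 2)).const_mul (-s)).exp.mul_const (ψ ξ)
        refine h4.congr_deriv ?_
        simp only [id]
        ring
      have h5 := CommutatorBound.of_deriv (S := {ξ | a ≤ ‖ξ‖ ∧ ‖ξ‖ ≤ b}) hder
        (fun τ hτ => (h3 s hs0.le τ hτ h ⟨hh.le, hhh⟩ _).const_mul (-(s * h ^ 2)))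
      refine (h5.congr fun ξ hξ => ?_).mono ?_
      · have h6 : φ.toFun (h • ξ) = 1 := φ.eq_one _ fun i =>
          (PiLp.norm_apply_le (h • ξ) i).trans
            (hsmall h ⟨hh.le, hhh⟩ ξ (hξ.2.trans (by linarith)))
        rw [latticeSymbol, ← heatExponent_one hg hs hh.ne', h6, heatSymbol,
          ← heatExponent_zero ρ h, hψ1 ξ hξ.1 hξ.2, mul_one, mul_one]
      · rw [abs_neg, abs_of_nonneg (by positivity)]
        have h7 : min 1 (h ^ 2) = h ^ 2 :=
          min_eq_right (pow_le_one₀ hh.le (hhh.trans (min_le_right _ _)))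
        have h8 : -s * c3 ≤ -s * c' := by
          have : c' ≤ c3 := (min_le_right _ _).trans (min_le_right _ _)
          nlinarith
        have h9 : C3 ≤ 2 * K * Q := by nlinarith
        rw [h7]
        calc s * h ^ 2 * (C3 * ((1 + s) ^ 5 * Real.exp (-s * c3)))
            ≤ (1 + s) * h ^ 2 * (2 * K * Q * ((1 + s) ^ 5 * Real.exp (-s * c'))) := by
              gcongr
              linarith
          _ = _ := by ring
    -- For `h > h₀` the quantity `min 1 (h²)` is at least `1 / Q`, so the triangle inequality
    -- suffices.
    · refine ((hlat s h hs0 hh).sub (hheat s hs0)).mono ?_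
      have h7 : 1 ≤ Q * min 1 (h ^ 2) := by
        rcases le_total 1 (h ^ 2) with h8 | h8
        · rw [min_eq_left h8, mul_one]
          exact hQ1
        · rw [min_eq_right h8]
          have h9 : h₀ ^ 2 ≤ h ^ 2 := by gcongr
          calc (1 : ℝ) = 1 / h₀ ^ 2 * h₀ ^ 2 := by field_simp
            _ ≤ Q * h ^ 2 := by
              gcongr
              exact le_max_right _ _
      calc _ = 2 * K * 1 * ((1 + s) ^ 6 * Real.exp (-s * c')) := by ring
        _ ≤ 2 * K * (Q * min 1 (h ^ 2)) * ((1 + s) ^ 6 * Real.exp (-s * c')) := by gcongr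
        _ = _ := by ring

/-! ### Fourier coefficients -/

lemma integralTorus_char (k : Freq) : integralTorus (char k).1 = if k = 0 then 8 else 0 := by
  split_ifs with h
  · have h1 : ∀ x, (char k).1 x = 1 := fun x => by simp [char, h]
    have hv : (MeasureTheory.volume : MeasureTheory.Measure Pt).real (Set.Icc (-1 : Pt) 1) = 8 := by
      rw [MeasureTheory.measureReal_def, Real.volume_Icc_pi]
      simp
      norm_num
    unfold integralTorus
    simp only [h1]
    rw [MeasureTheory.setIntegral_const, hv]
    norm_num
  · obtain ⟨i, hi⟩ : ∃ i, k i ≠ 0 := by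
      by_contra! h0
      exact h (funext h0)
    have h1 := integralTorus_deriv (char k) i
    have e : ∀ x, fderiv ℝ (char k).1 x (Pi.single i 1) =
        (Complex.I * Real.pi * k i) * (char k).1 x := by
      intro x
      rw [(hasFDerivAt_char k x).fderiv]
      simp [phase_single]
      ring
    unfold integralTorus at h1 ⊢
    simp only [e] at h1
    rw [MeasureTheory.integral_const_mul] at h1
    refine (mul_eq_zero.1 h1).resolve_left ?_
    simp [Real.pi_ne_zero, hi]

lemma integralTorus_char_mul_char (l k : Freq) :
    integralTorus (fun x => (char l).1 x * (char (-k)).1 x) = if l = k then 8 else 0 := by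
  simp only [char_mul]
  rw [integralTorus_char]
  simp only [← sub_eq_add_neg, sub_eq_zero]

lemma distCoeff_sub (u v : TorusDistribution) (k : Freq) :
    distCoeff (u - v) k = distCoeff u k - distCoeff v k := by
  simp [distCoeff, mul_sub]

lemma distCoeff_multiplier (m : Freq → ℂ) (hm : ∃ C : ℝ, ∀ k, ‖m k‖ ≤ C) (u : TorusDistribution)
    (k : Freq) : distCoeff (multiplier m hm u) k = m k * distCoeff u k := by
  have e : (multiplier m hm u).1 (char (-k)) =
      ∑' l, m l * distCoeff u l * integralTorus (fun x => (char l).1 x * (char (-k)).1 x) := rfl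
  rw [distCoeff, e, tsum_eq_single k]
  · rw [integralTorus_char_mul_char, if_pos rfl]
    ring
  · intro l hl
    rw [integralTorus_char_mul_char, if_neg hl, mul_zero]

lemma distCoeff_specProj (N : ℕ) (u : TorusDistribution) (k : Freq) :
    distCoeff (specProj N u) k = specSymbol N k * distCoeff u k := distCoeff_multiplier _ _ _ _

lemma distCoeff_tildeHeat (φ : Cutoff) (N : ℕ) (t : ℝ≥0) (u : TorusDistribution) (k : Freq) :
    distCoeff (tildeHeat φ N t u) k = tildeSymbol φ N t k * distCoeff u k :=
  distCoeff_multiplier _ _ _ _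

/-- The rescaled lattice heat symbol. -/
lemma tildeSymbol_eq (φ : Cutoff) (N : ℕ) (t : ℝ≥0) (k : Freq) {r : ℝ} (hr : 0 < r) :
    tildeSymbol φ N t k = latticeSymbol φ (t * r ^ 2) (mesh N * r) (r⁻¹ • k.toE3) := by
  have hm := mesh_pos N
  have e1 : (mesh N * r) • r⁻¹ • k.toE3 = mesh N • k.toE3 := by
    rw [smul_smul, mul_assoc, mul_inv_cancel₀ hr.ne', mul_one]
  have e2 : ∀ l, mesh N * r * (r⁻¹ • k.toE3) l = (mesh N • k.toE3) l := fun l => by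
    rw [← e1]
    rfl
  rw [tildeSymbol, latticeSymbol, e1]
  simp only [e2]
  suffices h : -(t : ℝ) * ‖k.toE3‖ ^ 2 * latticeF (mesh N • k.toE3) = -(t * r ^ 2) *
      (4 / (mesh N * r) ^ 2 * ∑ l, Real.sin ((mesh N • k.toE3) l * Real.pi / 2) ^ 2) by rw [h]
  rw [latticeF, norm_smul, Real.norm_of_nonneg hm.le]
  -- The zero frequency is separate because `latticeF` divides by `‖x‖²`; both exponents vanish
  -- there.
  rcases eq_or_ne k 0 with rfl | hk
  · have h0 : (0 : Freq).toE3 = 0 := by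
      ext i
      simp [Freq.toE3]
    simp [h0]
  · generalize (∑ l, Real.sin ((mesh N • k.toE3) l * Real.pi / 2) ^ 2) = Q
    have hk0 : ‖k.toE3‖ ≠ 0 := by
      intro h0
      apply hk
      have h1 := norm_le_norm_toE3 k
      rw [h0] at h1
      exact norm_le_zero_iff.1 h1
    field_simp

lemma distCoeff_heat (t : ℝ≥0) (u : TorusDistribution) (k : Freq) {r : ℝ} (hr : 0 < r) :
    distCoeff (heat t u) k = heatSymbol (t * r ^ 2) (r⁻¹ • k.toE3) * distCoeff u k := by
  rw [heat, distCoeff_multiplier, heatSymbol, norm_smul, norm_inv, Real.norm_of_nonneg hr.le]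
  have h : -(t : ℝ) * Real.pi ^ 2 * ‖k.toE3‖ ^ 2 =
      -(t * r ^ 2) * (Real.pi ^ 2 * (r⁻¹ * ‖k.toE3‖) ^ 2) := by
    field_simp
  rw [h]

/-! ### Fourier coefficients and frequency localisation of the paraproduct. -/

namespace DyadicPartition

variable (D : DyadicPartition)

/-- The pairs of frequencies entering `S_{j-1} u Δ_j v` for `j = n - 1`. -/
noncomputable def paraIndex (n : ℕ) : Finset (((_ : ℕ) × Freq) × Freq) :=
  D.lowIndex n ×ˢ (D.finite_freq n).toFinset

/-- The coefficients of `S_{j-1} u Δ_j v` for `j = n - 1`. -/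
noncomputable def paraCoeff (u v : TorusDistribution) (n : ℕ) (p : ((_ : ℕ) × Freq) × Freq) : ℂ :=
  D.blockCoeff u p.1 * (D.symbol n p.2.toE3 * distCoeff v p.2)

lemma mem_paraIndex {n : ℕ} {p : ((_ : ℕ) × Freq) × Freq} (hp : p ∈ D.paraIndex n) :
    p.1.1 + 1 < n ∧ D.symbol p.1.1 p.1.2.toE3 ≠ 0 ∧ D.symbol n p.2.toE3 ≠ 0 := by
  simp only [paraIndex, lowIndex, Finset.mem_product, Finset.mem_sigma, Finset.mem_range,
    Set.Finite.mem_toFinset, Set.mem_ofPred_eq] at hp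
  exact ⟨by omega, hp.1.2, hp.2⟩

lemma integralTorus_paraproduct (u v : TorusDistribution) (n : ℕ) (k : Freq) :
    integralTorus (fun x => (mulTorus (D.lowPart n u) (D.block n v)).1 x * (char (-k)).1 x) =
      8 * ∑ p ∈ D.paraIndex n, if p.1.2 + p.2 = k then D.paraCoeff u v n p else 0 := by
  have e : ∀ x, (mulTorus (D.lowPart n u) (D.block n v)).1 x * (char (-k)).1 x =
      ∑ p ∈ D.paraIndex n, D.paraCoeff u v n p *
        ((char (p.1.2 + p.2)).1 x * (char (-k)).1 x) := by
    intro x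
    have e1 : (mulTorus (D.lowPart n u) (D.block n v)).1 x =
      (D.lowPart n u).1 x * (D.block n v).1 x := rfl
    rw [e1, lowPart_apply, block_apply, Finset.sum_mul_sum, ← Finset.sum_product', Finset.sum_mul]
    refine Finset.sum_congr rfl fun p _ => ?_
    rw [← char_mul, paraCoeff]
    ring
  have hi : ∀ (a : ℂ) (l : Freq), MeasureTheory.IntegrableOn
      (fun x => a * ((char l).1 x * (char (-k)).1 x)) (Set.Icc (-1 : Pt) 1) := fun a l =>
    integrableOn_torus (continuous_const.mul ((continuous_torus _).mul (continuous_torus _)))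
  unfold integralTorus
  simp only [e]
  rw [MeasureTheory.integral_finsetSum _ fun p _ => hi _ _, Finset.mul_sum]
  refine Finset.sum_congr rfl fun p _ => ?_
  rw [MeasureTheory.integral_const_mul]
  have h := integralTorus_char_mul_char (p.1.2 + p.2) k
  unfold integralTorus at h
  rw [h]
  split_ifs <;> ring

/-- The Fourier coefficients of the paraproduct. -/
lemma distCoeff_paraproduct (u v : TorusDistribution) (k : Freq) (J : Finset ℕ)
    (hJ : ∀ n, n ∉ J → ∀ p ∈ D.paraIndex n, p.1.2 + p.2 ≠ k) :
    distCoeff (D.paraproduct u v) k =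
      ∑ n ∈ J, ∑ p ∈ D.paraIndex n, if p.1.2 + p.2 = k then D.paraCoeff u v n p else 0 := by
  have e : (D.paraproduct u v).1 (char (-k)) = ∑' n : ℕ, 1 * integralTorus
      (fun x => (mulTorus (D.lowPart n u) (D.block n v)).1 x * (char (-k)).1 x) := rfl
  rw [distCoeff, e, tsum_eq_sum (s := J)]
  · simp only [one_mul, integralTorus_paraproduct, ← Finset.mul_sum]
    ring
  · intro n hn
    rw [integralTorus_paraproduct, Finset.sum_eq_zero]
    · ring
    · intro p hp
      rw [if_neg (hJ n hn p hp)]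

/-- The blocks of a distribution whose Fourier coefficients are given by a finite sum over pairs of
frequencies. -/
lemma block_apply_of_distCoeff (w : TorusDistribution) (n : ℕ) (J : Finset ℕ)
    (F : ℕ → ((_ : ℕ) × Freq) × Freq → ℂ)
    (hw : ∀ k, D.symbol n k.toE3 ≠ 0 → distCoeff w k =
      ∑ m ∈ J, ∑ p ∈ D.paraIndex m, if p.1.2 + p.2 = k then F m p else 0) (x : Pt) :
    (D.block n w).1 x = ∑ m ∈ J, ∑ p ∈ D.paraIndex m,
      D.symbol n (p.1.2 + p.2).toE3 * F m p * (char (p.1.2 + p.2)).1 x := by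
  have h1 : (D.block n w).1 x = ∑ k ∈ (D.finite_freq n).toFinset, ∑ m ∈ J, ∑ p ∈ D.paraIndex m,
      if p.1.2 + p.2 = k then D.symbol n (p.1.2 + p.2).toE3 * F m p * (char (p.1.2 + p.2)).1 x
        else 0 := by
    rw [block_apply]
    refine Finset.sum_congr rfl fun k hk => ?_
    rw [hw k (by simpa using hk), Finset.mul_sum, Finset.sum_mul]
    refine Finset.sum_congr rfl fun m _ => ?_
    rw [Finset.mul_sum, Finset.sum_mul]
    refine Finset.sum_congr rfl fun p _ => ?_
    split_ifs with h
    · rw [h]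
    · simp
  rw [h1, Finset.sum_comm]
  refine Finset.sum_congr rfl fun m _ => ?_
  rw [Finset.sum_comm]
  refine Finset.sum_congr rfl fun p _ => ?_
  -- Each pair selects one output frequency. If that frequency is missing from the finite set, the
  -- symbol of the block vanishes at it.
  rw [Finset.sum_ite_eq]
  split_ifs with h
  · rfl
  · simp only [Set.Finite.mem_toFinset, Set.mem_ofPred_eq, not_not] at h
    simp [h]

/-- Only boundedly many terms of the paraproduct contribute to each block. -/
lemma exists_window : ∃ K : ℕ, ∀ (n m : ℕ) (p : ((_ : ℕ) × Freq) × Freq), p ∈ D.paraIndex m →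
    D.symbol n (p.1.2 + p.2).toE3 ≠ 0 → m ∈ Finset.Icc (n - K) (n + K) := by
  obtain ⟨B, hB, hB'⟩ := D.exists_norm_le
  obtain ⟨a, ha, ha'⟩ := D.exists_le_norm
  obtain ⟨c, hc, hc'⟩ := D.exists_annulus
  -- The output frequency lies between `c 2^m` and `2B 2^m` in size, and is at most `B 2^n`; for `n
  -- ≥ 1` it is also at least `a 2^(n-1)`. `K₁` and `K₂` convert these comparisons into bounds on `m
  -- - n` and `n - m`.
  obtain ⟨K₁, hK₁⟩ := pow_unbounded_of_one_lt (B / c) (one_lt_two (α := ℝ))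
  obtain ⟨K₂, hK₂⟩ := pow_unbounded_of_one_lt (4 * B / a) (one_lt_two (α := ℝ))
  rw [div_lt_iff₀ hc] at hK₁
  rw [div_lt_iff₀ ha] at hK₂
  refine ⟨K₁ + K₂, fun n m p hp hn => ?_⟩
  obtain ⟨h1, h2, h3⟩ := D.mem_paraIndex hp
  have h4 := hc' _ _ _ _ h1 h2 h3
  rw [← toE3_add] at h4
  have h5 := hB' _ _ hn
  rw [Finset.mem_Icc]
  have hmn : m ≤ n + K₁ := by
    have h6 : c * (2 : ℝ) ^ m < c * 2 ^ (n + K₁) := by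
      rw [pow_add]
      have : (0 : ℝ) < 2 ^ n := by positivity
      nlinarith
    exact ((pow_lt_pow_iff_right₀ one_lt_two).1 (lt_of_mul_lt_mul_left h6 hc.le)).le
  have hnm : n ≤ m + K₂ := by
    cases n with
    | zero => omega
    | succ j =>
      have h6 := ha' _ _ hn
      have h7 : ‖(p.1.2 + p.2).toE3‖ ≤ 2 * B * 2 ^ m := by
        rw [toE3_add]
        have h8 : (2 : ℝ) ^ p.1.1 ≤ 2 ^ m := pow_le_pow_right₀ one_le_two (by omega)
        have h9 := hB' _ _ h2
        have h10 := hB' _ _ h3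
        refine (norm_add_le _ _).trans ?_
        nlinarith
      have h8 : a * (2 : ℝ) ^ (j + 1) < a * 2 ^ (m + K₂) := by
        rw [pow_add, pow_add, pow_one]
        have : (0 : ℝ) < 2 ^ m := by positivity
        nlinarith
      exact ((pow_lt_pow_iff_right₀ one_lt_two).1 (lt_of_mul_lt_mul_left h8 ha.le)).le
  omega

/-- The frequencies in `S_{j-1} u Δ_j v` and `Δ_j v` lie in an annulus of size `2 ^ j`. -/
lemma exists_annulus_bounds : ∃ a b : ℝ, 0 < a ∧ 0 < b ∧ ∀ (m : ℕ), ∀ p ∈ D.paraIndex m,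
    (a ≤ ‖((2 : ℝ) ^ m)⁻¹ • (p.1.2 + p.2).toE3‖ ∧ ‖((2 : ℝ) ^ m)⁻¹ • (p.1.2 + p.2).toE3‖ ≤ b) ∧
    (a ≤ ‖((2 : ℝ) ^ m)⁻¹ • p.2.toE3‖ ∧ ‖((2 : ℝ) ^ m)⁻¹ • p.2.toE3‖ ≤ b) := by
  obtain ⟨B, hB, hB'⟩ := D.exists_norm_le
  obtain ⟨a, ha, ha'⟩ := D.exists_le_norm
  obtain ⟨c, hc, hc'⟩ := D.exists_annulus
  refine ⟨min c (a / 2), 2 * B, by positivity, by positivity, fun m p hp => ?_⟩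
  obtain ⟨h1, h2, h3⟩ := D.mem_paraIndex hp
  have h4 := hc' _ _ _ _ h1 h2 h3
  rw [← toE3_add] at h4
  have hm : (0 : ℝ) < 2 ^ m := by positivity
  have h8 : (2 : ℝ) ^ p.1.1 ≤ 2 ^ m := pow_le_pow_right₀ one_le_two (by omega)
  have h9 := hB' _ _ h2
  have h10 := hB' _ _ h3
  have h7 : ‖(p.1.2 + p.2).toE3‖ ≤ 2 * B * 2 ^ m := by
    rw [toE3_add]
    refine (norm_add_le _ _).trans ?_
    nlinarith
  -- A pair exists only for `m ≥ 2`, so `v` enters through an annular block and never through `χ`.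
  have h11 : a / 2 * 2 ^ m ≤ ‖p.2.toE3‖ := by
    obtain ⟨j, rfl⟩ : ∃ j, m = j + 1 := ⟨m - 1, by omega⟩
    have := ha' _ _ h3
    rw [pow_succ]
    linarith
  simp only [norm_smul, norm_inv, norm_pow, Real.norm_ofNat]
  refine ⟨⟨?_, ?_⟩, ?_, ?_⟩
  · rw [le_inv_mul_iff₀ hm]
    have := min_le_left c (a / 2)
    nlinarith
  · rw [inv_mul_le_iff₀ hm]
    linarith
  · rw [le_inv_mul_iff₀ hm]
    have := min_le_right c (a / 2)
    nlinarith
  · rw [inv_mul_le_iff₀ hm]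
    nlinarith

end DyadicPartition

/-! ### The paraproduct commutator estimates -/

/-- The exponential dominates every power. The condition `0 ≤ γ`, which becomes `α + β ≤ δ`, is what
permits `s^γ ≤ (1 + s)^⌈γ⌉`, including for small `s`. -/
lemma exists_exp_decay {γ c : ℝ} (hγ : 0 ≤ γ) (hc : 0 < c) : ∃ C : ℝ, 0 ≤ C ∧ ∀ s : ℝ, 0 < s →
    (1 + s) ^ 6 * Real.exp (-s * c) ≤ C * s ^ (-γ) := by
  set m := ⌈γ⌉₊
  -- From `x^n / n! ≤ exp x` at `x = c (1 + s)`; the factor `exp c` corrects the shift from `s` to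
  -- `1 + s`.
  refine ⟨(6 + m).factorial / c ^ (6 + m) * Real.exp c, by positivity, fun s hs => ?_⟩
  have h1 : s ^ γ ≤ (1 + s) ^ m := by
    calc s ^ γ ≤ (1 + s) ^ γ := by
          gcongr
          linarith
      _ ≤ (1 + s) ^ (m : ℝ) := Real.rpow_le_rpow_of_exponent_le (by linarith) (Nat.le_ceil γ)
      _ = _ := Real.rpow_natCast _ _
  have h2 := Real.pow_div_factorial_le_exp (c * (1 + s)) (by positivity) (6 + m)
  have h3 : (1 + s) ^ (6 + m) ≤ (6 + m).factorial / c ^ (6 + m) * Real.exp (c * (1 + s)) := by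
    rw [div_mul_eq_mul_div, le_div_iff₀ (by positivity)]
    rw [div_le_iff₀ (by positivity), mul_pow] at h2
    linarith
  rw [Real.rpow_neg hs.le, ← div_eq_mul_inv, le_div_iff₀ (by positivity)]
  calc (1 + s) ^ 6 * Real.exp (-s * c) * s ^ γ
      ≤ (1 + s) ^ 6 * Real.exp (-s * c) * (1 + s) ^ m := by gcongr
    _ = (1 + s) ^ (6 + m) * Real.exp (-s * c) := by ring
    _ ≤ (6 + m).factorial / c ^ (6 + m) * Real.exp (c * (1 + s)) * Real.exp (-s * c) := by gcongr
    _ = (6 + m).factorial / c ^ (6 + m) * Real.exp c := by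
        rw [mul_assoc, ← Real.exp_add]
        congr 2
        ring

/-! ### Besov norms through blocks, and a single paraproduct level. -/

namespace DyadicPartition

variable (D : DyadicPartition)

/-- The factor `2^α` is due to the index shift: block `m` has weight `2^((m-1)α)` in the norm. -/
lemma norm_block_le_of_besovNorm {α : ℝ} {u : TorusDistribution} (hu : D.besovNorm α u < ⊤)
    (m : ℕ) (x : Pt) :
    ‖(D.block m u).1 x‖ ≤ ((2 : ℝ) ^ m) ^ (-α) * (2 ^ α * (D.besovNorm α u).toReal) := by
  have h1 : ENNReal.ofReal ((2 : ℝ) ^ (((m : ℝ) - 1) * α)) * ‖(D.block m u).1 x‖ₑ ≤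
      D.besovNorm α u := by
    refine le_trans ?_ (le_iSup _ m)
    gcongr
    exact le_iSup (fun x : Pt => ‖(D.block m u).1 x‖ₑ) x
  have h2 := ENNReal.toReal_mono hu.ne h1
  rw [ENNReal.toReal_mul, ENNReal.toReal_ofReal (by positivity), toReal_enorm] at h2
  have e : (2 : ℝ) ^ (((m : ℝ) - 1) * α) = ((2 : ℝ) ^ m) ^ α * (2 ^ α)⁻¹ := by
    rw [← Real.rpow_natCast, ← Real.rpow_mul (by norm_num), ← Real.rpow_neg (by norm_num),
      ← Real.rpow_add (by norm_num)]
    congr 1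
    ring
  rw [e] at h2
  rw [Real.rpow_neg (by positivity), inv_mul_eq_div, le_div_iff₀ (by positivity)]
  have h3 : (0 : ℝ) < 2 ^ α := by positivity
  calc ‖(D.block m u).1 x‖ * ((2 : ℝ) ^ m) ^ α
      = 2 ^ α * (((2 : ℝ) ^ m) ^ α * (2 ^ α)⁻¹ * ‖(D.block m u).1 x‖) := by field_simp
    _ ≤ _ := by gcongr

/-- At most `2K + 1` levels contribute, and moving from `m` to `n` changes the weight by at most
`2^(K|e|)`. The remaining `2^(-e)` is the index shift. -/
lemma exists_besovNorm_le (e : ℝ) (K : ℕ) : ∃ C : ℝ, 0 ≤ C ∧ ∀ (w : TorusDistribution) (A : ℝ),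
    0 ≤ A → (∀ n x, ‖(D.block n w).1 x‖ ≤
      ∑ m ∈ Finset.Icc (n - K) (n + K), A * ((2 : ℝ) ^ m) ^ (-e)) →
    D.besovNorm e w ≤ ENNReal.ofReal (C * A) := by
  refine ⟨(2 * K + 1) * 2 ^ (K * |e| - e), by positivity, fun w A hA h => ?_⟩
  refine iSup_le fun n => ?_
  have h1 : ∀ x, ‖(D.block n w).1 x‖ ≤ (2 * K + 1) * (A * 2 ^ (K * |e| - n * e)) := by
    intro x
    refine (h n x).trans ?_
    have h2 : ∀ m ∈ Finset.Icc (n - K) (n + K), A * ((2 : ℝ) ^ m) ^ (-e) ≤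
        A * 2 ^ (K * |e| - n * e) := by
      intro m hm
      rw [Finset.mem_Icc] at hm
      have h3 : |(n : ℝ) - m| ≤ K := by
        have h4 : (n : ℝ) ≤ m + K := by exact_mod_cast (by omega : n ≤ m + K)
        have h5 : (m : ℝ) ≤ n + K := by exact_mod_cast hm.2
        rw [abs_le]
        constructor <;> linarith
      have h4 : ((n : ℝ) - m) * e ≤ K * |e| :=
        (le_abs_self _).trans (by rw [abs_mul]; gcongr)
      rw [← Real.rpow_natCast, ← Real.rpow_mul (by norm_num)]
      gcongr
      · norm_num
      · linarith
    refine (Finset.sum_le_card_nsmul _ _ _ h2).trans ?_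
    rw [nsmul_eq_mul]
    gcongr
    have h6 : (Finset.Icc (n - K) (n + K)).card ≤ 2 * K + 1 := by
      rw [Nat.card_Icc]
      omega
    exact_mod_cast h6
  have h7 : ⨆ x : Pt, ‖(D.block n w).1 x‖ₑ ≤
      ENNReal.ofReal ((2 * K + 1) * (A * 2 ^ (K * |e| - n * e))) := by
    refine iSup_le fun x => ?_
    rw [← ofReal_norm]
    exact ENNReal.ofReal_le_ofReal (h1 x)
  refine (mul_le_mul_right h7 _).trans (le_of_eq ?_)
  rw [← ENNReal.ofReal_mul (by positivity)]
  congr 1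
  have e1 : (2 : ℝ) ^ (K * |e| - e) = 2 ^ (((n : ℝ) - 1) * e) * 2 ^ (K * |e| - n * e) := by
    rw [← Real.rpow_add (by norm_num)]
    congr 1
    ring
  rw [e1]
  ring

/-- The contribution of one term of the paraproduct to the commutator. -/
lemma exists_paraproduct_commutator_bound {α : ℝ} (hα : α < 1) (β : ℝ) : ∃ C a b : ℝ,
    0 ≤ C ∧ 0 < a ∧ 0 < b ∧
    ∀ (u v : TorusDistribution) (U V : ℝ), (∀ m x, ‖(D.block m u).1 x‖ ≤ ((2 : ℝ) ^ m) ^ (-α) * U) →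
      (∀ m x, ‖(D.block m v).1 x‖ ≤ ((2 : ℝ) ^ m) ^ (-β) * V) →
    ∀ (m : ℕ) (q : Freq → ℂ) (Q : ℝ) (M : E3 → ℝ) (G : ℝ), 0 ≤ Q →
      MultiplierBound {k | ‖k.toE3‖ ≤ b * 2 ^ m} q Q →
      CommutatorBound {ξ | a ≤ ‖ξ‖ ∧ ‖ξ‖ ≤ b} M G →
    ∀ x, ‖∑ p ∈ D.paraIndex m, q (p.1.2 + p.2) *
        (((M (((2 : ℝ) ^ m)⁻¹ • (p.1.2 + p.2).toE3) : ℂ) - M (((2 : ℝ) ^ m)⁻¹ • p.2.toE3)) *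
          D.paraCoeff u v m p) * (char (p.1.2 + p.2)).1 x‖ ≤
      C * (U * V) * (Q * G * (((2 : ℝ) ^ m) ^ (1 - α) * ((2 : ℝ) ^ m) ^ (-β) / 2 ^ m)) := by
  obtain ⟨C, hC, hL⟩ := D.exists_lipschitz_lowPart hα
  obtain ⟨a, b, ha, hb, hab⟩ := D.exists_annulus_bounds
  refine ⟨C, a, b, hC, ha, hb, fun u v U V hU hV m q Q M G hQ hq hM x => ?_⟩
  have hU0 : 0 ≤ U := by simpa using (norm_nonneg _).trans (hU 0 0)
  have h2m : (0 : ℝ) < 2 ^ m := by positivity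
  have h1 := hM (2 ^ m) h2m _ _ (D.lowIndex m) (D.finite_freq m).toFinset (D.blockCoeff u)
    (fun k => D.symbol m k.toE3 * distCoeff v k) (fun p => p.2) (fun k => k)
    (C * ((2 : ℝ) ^ m) ^ (1 - α) * U) (((2 : ℝ) ^ m) ^ (-β) * V) (by positivity)
    (fun p hp => hab m p hp) (fun x y => by simpa only [lowPart_apply] using hL u U hU m x y)
    (fun x => by simpa only [block_apply] using hV m x)
  -- The commutator bound is uniform in `x`, so it serves as the sup-norm input of the outer
  -- multiplier, whose frequencies lie in the ball of radius `b 2^m`.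
  have h2 := hq _ (D.paraIndex m) _ (fun p => p.1.2 + p.2) _ (fun p hp => by
    have h3 := (hab m p hp).1.2
    rw [norm_smul, norm_inv, norm_pow, Real.norm_ofNat, inv_mul_le_iff₀ h2m, mul_comm] at h3
    exact h3) h1 x
  refine h2.trans (le_of_eq ?_)
  ring

end DyadicPartition

/-! ### Power counting and conclusion. -/

/-- With `X = 2^m`, the factors are the loss of the spectral projection, the decay of the heat
symbol and the size of the commutator. -/
lemma rpow_balance {t X α β δ κ : ℝ} (ht : 0 < t) (hX : 0 < X) :
    X ^ κ * (t * X ^ 2) ^ (-((δ - α - β) / 2)) * (X ^ (1 - α) * X ^ (-β) / X) =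
      t ^ ((α + β - δ) / 2) * X ^ (-(δ - κ)) := by
  have e1 : (t * X ^ 2) ^ (-((δ - α - β) / 2)) = t ^ ((α + β - δ) / 2) * X ^ (α + β - δ) := by
    rw [Real.mul_rpow ht.le (by positivity), ← Real.rpow_natCast X 2, ← Real.rpow_mul hX.le]
    congr 2
    · ring
    · push_cast
      ring
  have e2 : X ^ κ * X ^ (α + β - δ) * (X ^ (1 - α) * X ^ (-β) * X ^ (-1 : ℝ)) = X ^ (-(δ - κ)) := by
    rw [← Real.rpow_add hX, ← Real.rpow_add hX, ← Real.rpow_add hX, ← Real.rpow_add hX]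
    congr 1
    ring
  rw [e1, ← e2, Real.rpow_neg_one, div_eq_mul_inv]
  ring

lemma heatSymbol_rescale (t : ℝ) {r : ℝ} (hr : r ≠ 0) (ξ : E3) :
    heatSymbol (t * r ^ 2) (r⁻¹ • ξ) = heatSymbol t ξ := by
  rw [heatSymbol, heatSymbol, norm_smul, norm_inv, mul_pow, inv_pow, Real.norm_eq_abs, sq_abs]
  congr 1
  field_simp

/-- Used with `η = κ / 2`, for which `η ≤ 2` is the condition `κ ≤ 4`. -/
lemma min_one_sq_le_rpow {h η : ℝ} (hh : 0 < h) (h0 : 0 ≤ η) (h2 : η ≤ 2) :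
    min 1 (h ^ 2) ≤ h ^ η := by
  rcases le_total 1 h with h1 | h1
  · exact (min_le_left _ _).trans (Real.one_le_rpow h1 h0)
  · refine (min_le_right _ _).trans ?_
    rw [← Real.rpow_natCast]
    exact Real.rpow_le_rpow_of_exponent_ge hh h1 (by exact_mod_cast h2)

/-- Each level is bounded by the commutator estimate composed with the block symbol and `P_N`. The
levels near `n` then sum to the block `n` of the difference. -/
lemma exists_commutator_discreteHeat (D : DyadicPartition) (φ : Cutoff) (α β δ κ : ℝ)
    (hα : α < 1) (hδ : α + β ≤ δ) (hκ : 0 < κ) :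
    ∃ C : ℝ, ∀ (N : ℕ), 1 ≤ N → ∀ (t : ℝ≥0), 0 < t → ∀ (u v : TorusDistribution),
      D.besovNorm α u < ⊤ → D.besovNorm β v < ⊤ →
      D.besovNorm (δ - κ)
          (discreteHeat φ N t (D.paraproduct u v)
            - specProj N (D.paraproduct u (tildeHeat φ N t v)))
        ≤ ENNReal.ofReal (C * (t : ℝ) ^ ((α + β - δ) / 2))
          * D.besovNorm α u * D.besovNorm β v := by
  obtain ⟨C₁, a, b, hC₁, ha, hb, h₁⟩ := D.exists_paraproduct_commutator_bound hα β
  obtain ⟨C₂, c, hC₂, hc, h₂⟩ := exists_heat_commutatorBound φ ha hb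
  obtain ⟨C₃, hC₃, h₃⟩ := exists_multiplierBound_specSymbol hb hκ
  obtain ⟨C₄, hC₄, h₄⟩ := D.exists_multiplierBound_symbol
  obtain ⟨C₅, hC₅, h₅⟩ := exists_exp_decay (γ := (δ - α - β) / 2) (by linarith) hc
  obtain ⟨K, hK⟩ := D.exists_window
  obtain ⟨C₆, hC₆, h₆⟩ := D.exists_besovNorm_le (δ - κ) K
  refine ⟨C₆ * (C₁ * C₄ * C₃ * C₂ * C₅ * (2 ^ α * 2 ^ β)), fun N hN t ht u v hu hv => ?_⟩
  set U := (D.besovNorm α u).toReal with hU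
  set V := (D.besovNorm β v).toReal with hV
  have hU0 : 0 ≤ U := ENNReal.toReal_nonneg
  have hV0 : 0 ≤ V := ENNReal.toReal_nonneg
  have ht' : (0 : ℝ) < t := ht
  rw [← ENNReal.ofReal_toReal hu.ne, ← ENNReal.ofReal_toReal hv.ne,
    ← ENNReal.ofReal_mul (by positivity), ← ENNReal.ofReal_mul (by positivity)]
  refine (h₆ _ (C₁ * C₄ * C₃ * C₂ * C₅ * (2 ^ α * U * (2 ^ β * V)) * (t : ℝ) ^ ((α + β - δ) / 2))
    (by positivity) fun n x => ?_).trans (le_of_eq (by congr 1; ring))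
  rw [D.block_apply_of_distCoeff _ n (Finset.Icc (n - K) (n + K)) (fun m p => specSymbol N (p.1.2 + p.2) *
    ((tildeSymbol φ N t (p.1.2 + p.2) - tildeSymbol φ N t p.2) * D.paraCoeff u v m p))]
  · refine (norm_sum_le _ _).trans (Finset.sum_le_sum fun m _ => ?_)
    have h2m : (0 : ℝ) < 2 ^ m := by positivity
    have h7 := h₁ u v _ _ (D.norm_block_le_of_besovNorm hu) (D.norm_block_le_of_besovNorm hv) m _ _ _ _
      (by positivity) ((h₄ n _).mul (h₃ N m hN))
      (h₂ (t * (2 ^ m) ^ 2) (mesh N * 2 ^ m) (by positivity) (mul_pos (mesh_pos N) h2m)).1 x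
    simp only [← tildeSymbol_eq φ N t _ h2m] at h7
    simp only [← mul_assoc] at h7 ⊢
    refine h7.trans ?_
    have h8 := h₅ (t * (2 ^ m) ^ 2) (by positivity)
    have h9 := rpow_balance (α := α) (β := β) (δ := δ) (κ := κ) ht' h2m
    calc _ = C₁ * C₄ * C₃ * C₂ * (2 ^ α * U * (2 ^ β * V)) * (((2 : ℝ) ^ m) ^ κ *
          ((1 + t * (2 ^ m) ^ 2) ^ 6 * Real.exp (-(t * (2 ^ m) ^ 2) * c)) *
          (((2 : ℝ) ^ m) ^ (1 - α) * ((2 : ℝ) ^ m) ^ (-β) / 2 ^ m)) := by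
          rw [hU, hV]
          ring
      _ ≤ C₁ * C₄ * C₃ * C₂ * (2 ^ α * U * (2 ^ β * V)) * (((2 : ℝ) ^ m) ^ κ *
          (C₅ * (t * (2 ^ m) ^ 2) ^ (-((δ - α - β) / 2))) *
          (((2 : ℝ) ^ m) ^ (1 - α) * ((2 : ℝ) ^ m) ^ (-β) / 2 ^ m)) := by gcongr
      _ = C₁ * C₄ * C₃ * C₂ * C₅ * (2 ^ α * U * (2 ^ β * V)) * (((2 : ℝ) ^ m) ^ κ *
          (t * (2 ^ m) ^ 2) ^ (-((δ - α - β) / 2)) *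
          (((2 : ℝ) ^ m) ^ (1 - α) * ((2 : ℝ) ^ m) ^ (-β) / 2 ^ m)) := by ring
      _ = _ := by
          rw [h9]
          ring
  · intro k hk
    -- Frequencies seen by block `n` arise only from levels in the window, so one finite sum
    -- represents both paraproducts.
    have hJ : ∀ m, m ∉ Finset.Icc (n - K) (n + K) → ∀ p ∈ D.paraIndex m, p.1.2 + p.2 ≠ k :=
      fun m hm p hp hpk => hm (hK n m p hp (by rwa [hpk]))
    rw [distCoeff_sub, discreteHeat, distCoeff_specProj, distCoeff_specProj, distCoeff_tildeHeat,
      D.distCoeff_paraproduct u v k _ hJ, D.distCoeff_paraproduct u _ k _ hJ, ← mul_sub,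
      Finset.mul_sum, ← Finset.sum_sub_distrib, Finset.mul_sum]
    refine Finset.sum_congr rfl fun m _ => ?_
    rw [Finset.mul_sum, ← Finset.sum_sub_distrib, Finset.mul_sum]
    refine Finset.sum_congr rfl fun p _ => ?_
    split_ifs with h
    · rw [h, DyadicPartition.paraCoeff, DyadicPartition.paraCoeff, distCoeff_tildeHeat]
      ring
    · simp

/-- The gain in `ε` appears as `(ε 2^m)^(κ/2)`, whose dyadic factor uses half of the allowed loss
`κ`. The projections are therefore estimated with exponent `κ / 2`. -/
lemma exists_commutator_discreteHeat_sub_heat (D : DyadicPartition) (φ : Cutoff) (α β δ κ : ℝ)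
    (hα : α < 1) (hδ : α + β ≤ δ) (hκ : 0 < κ) (hκ4 : κ ≤ 4) :
    ∃ C : ℝ, ∀ (N : ℕ), 1 ≤ N → ∀ (t : ℝ≥0), 0 < t → ∀ (u v : TorusDistribution),
        D.besovNorm α u < ⊤ → D.besovNorm β v < ⊤ →
        D.besovNorm (δ - κ)
            ((discreteHeat φ N t (D.paraproduct u v) - heat t (D.paraproduct u v))
              - (specProj N (D.paraproduct u (tildeHeat φ N t v))
                - D.paraproduct u (heat t v)))
          ≤ ENNReal.ofReal (C * mesh N ^ (κ / 2) * (t : ℝ) ^ ((α + β - δ) / 2))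
            * D.besovNorm α u * D.besovNorm β v := by
  obtain ⟨C₁, a, b, hC₁, ha, hb, h₁⟩ := D.exists_paraproduct_commutator_bound hα β
  obtain ⟨C₂, c, hC₂, hc, h₂⟩ := exists_heat_commutatorBound φ ha hb
  obtain ⟨C₃, hC₃, h₃⟩ := exists_multiplierBound_specSymbol hb (half_pos hκ)
  obtain ⟨C₃', hC₃', h₃'⟩ := exists_multiplierBound_one_sub_specSymbol hb (half_pos hκ) (half_pos hκ).le
  obtain ⟨C₄, hC₄, h₄⟩ := D.exists_multiplierBound_symbol
  obtain ⟨C₅, hC₅, h₅⟩ := exists_exp_decay (γ := (δ - α - β) / 2) (by linarith) hc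
  obtain ⟨K, hK⟩ := D.exists_window
  obtain ⟨C₆, hC₆, h₆⟩ := D.exists_besovNorm_le (δ - κ) K
  refine ⟨C₆ * (C₁ * C₄ * (C₃ + C₃') * C₂ * C₅ * (2 ^ α * 2 ^ β)), fun N hN t ht u v hu hv => ?_⟩
  set U := (D.besovNorm α u).toReal with hU
  set V := (D.besovNorm β v).toReal with hV
  have hU0 : 0 ≤ U := ENNReal.toReal_nonneg
  have hV0 : 0 ≤ V := ENNReal.toReal_nonneg
  have ht' : (0 : ℝ) < t := ht
  have hm0 := mesh_pos N
  rw [← ENNReal.ofReal_toReal hu.ne, ← ENNReal.ofReal_toReal hv.ne,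
    ← ENNReal.ofReal_mul (by positivity), ← ENNReal.ofReal_mul (by positivity)]
  refine (h₆ _ (C₁ * C₄ * (C₃ + C₃') * C₂ * C₅ * (2 ^ α * U * (2 ^ β * V)) * mesh N ^ (κ / 2) *
    (t : ℝ) ^ ((α + β - δ) / 2)) (by positivity) fun n x => ?_).trans
      (le_of_eq (by congr 1; ring))
  -- With `S`, `L`, `H` the symbols of `P_N`, the lattice semigroup and the heat semigroup, the
  -- factor `S(k)(L(k) - L(k')) - (H(k) - H(k'))` is written as `S(k)` times the increment of `L -
  -- H`, minus `1 - S(k)` times the increment of `H`.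
  rw [D.block_apply_of_distCoeff _ n (Finset.Icc (n - K) (n + K)) (fun m p =>
    specSymbol N (p.1.2 + p.2) *
      ((((latticeSymbol φ (t * (2 ^ m) ^ 2) (mesh N * 2 ^ m) (((2 : ℝ) ^ m)⁻¹ • (p.1.2 + p.2).toE3) -
          heatSymbol (t * (2 ^ m) ^ 2) (((2 : ℝ) ^ m)⁻¹ • (p.1.2 + p.2).toE3) : ℝ) : ℂ) -
        ((latticeSymbol φ (t * (2 ^ m) ^ 2) (mesh N * 2 ^ m) (((2 : ℝ) ^ m)⁻¹ • p.2.toE3) -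
          heatSymbol (t * (2 ^ m) ^ 2) (((2 : ℝ) ^ m)⁻¹ • p.2.toE3) : ℝ) : ℂ)) *
        D.paraCoeff u v m p) -
    (1 - specSymbol N (p.1.2 + p.2)) *
      (((heatSymbol (t * (2 ^ m) ^ 2) (((2 : ℝ) ^ m)⁻¹ • (p.1.2 + p.2).toE3) : ℂ) -
          heatSymbol (t * (2 ^ m) ^ 2) (((2 : ℝ) ^ m)⁻¹ • p.2.toE3)) * D.paraCoeff u v m p))]
  · refine (norm_sum_le _ _).trans (Finset.sum_le_sum fun m _ => ?_)
    have h2m : (0 : ℝ) < 2 ^ m := by positivity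
    have hcomm := h₂ (t * (2 ^ m) ^ 2) (mesh N * 2 ^ m) (by positivity) (by positivity)
    have h7 := h₁ u v _ _ (D.norm_block_le_of_besovNorm hu) (D.norm_block_le_of_besovNorm hv) m _ _ _ _
      (by positivity) ((h₄ n _).mul (h₃ N m hN)) hcomm.2.2 x
    have h7' := h₁ u v _ _ (D.norm_block_le_of_besovNorm hu) (D.norm_block_le_of_besovNorm hv) m _ _ _ _
      (by positivity) ((h₄ n _).mul (h₃' N m hN)) hcomm.2.1 x
    have h8 := h₅ (t * (2 ^ m) ^ 2) (by positivity)
    have h9 := rpow_balance (α := α) (β := β) (δ := δ) (κ := κ) ht' h2m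
    have h10 := min_one_sq_le_rpow (h := mesh N * 2 ^ m) (η := κ / 2) (by positivity) (by linarith)
      (by linarith)
    have h11 : (mesh N * 2 ^ m) ^ (κ / 2) = mesh N ^ (κ / 2) * ((2 : ℝ) ^ m) ^ (κ / 2) :=
      Real.mul_rpow hm0.le h2m.le
    have h12 : ((2 : ℝ) ^ m) ^ κ = ((2 : ℝ) ^ m) ^ (κ / 2) * ((2 : ℝ) ^ m) ^ (κ / 2) := by
      rw [← Real.rpow_add h2m, add_halves]
    set X : ℝ := 2 ^ m with hX
    set Y : ℝ := X ^ (1 - α) * X ^ (-β) / X with hY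
    set E : ℝ := (1 + t * X ^ 2) ^ 6 * Real.exp (-(t * X ^ 2) * c) with hE
    have hY0 : 0 ≤ Y := by positivity
    have hE0 : 0 ≤ E := by positivity
    rw [Finset.sum_congr rfl fun p _ => by rw [mul_sub, sub_mul, ← mul_assoc, ← mul_assoc,
      ← mul_assoc, ← mul_assoc], Finset.sum_sub_distrib]
    simp only [← mul_assoc] at h7 h7' ⊢
    refine (norm_sub_le _ _).trans ((add_le_add h7 h7').trans ?_)
    calc _ = C₁ * C₄ * C₂ * (2 ^ α * U * (2 ^ β * V)) * E * Y * X ^ (κ / 2) *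
          (C₃ * min 1 ((mesh N * X) ^ 2) + C₃' * (mesh N * X) ^ (κ / 2)) := by
          rw [hU, hV]
          ring
      _ ≤ C₁ * C₄ * C₂ * (2 ^ α * U * (2 ^ β * V)) * (C₅ * (t * X ^ 2) ^ (-((δ - α - β) / 2))) *
          Y * X ^ (κ / 2) *
          (C₃ * (mesh N * X) ^ (κ / 2) + C₃' * (mesh N * X) ^ (κ / 2)) := by gcongr
      _ = C₁ * C₄ * (C₃ + C₃') * C₂ * C₅ * (2 ^ α * U * (2 ^ β * V)) * mesh N ^ (κ / 2) *
          (X ^ κ * (t * X ^ 2) ^ (-((δ - α - β) / 2)) * Y) := by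
          rw [h11, h12]
          ring
      _ = _ := by
          rw [h9]
          ring
  · intro k hk
    have hJ : ∀ m, m ∉ Finset.Icc (n - K) (n + K) → ∀ p ∈ D.paraIndex m, p.1.2 + p.2 ≠ k :=
      fun m hm p hp hpk => hm (hK n m p hp (by rwa [hpk]))
    have h2 : ∀ m : ℕ, (0 : ℝ) < 2 ^ m := fun m => by positivity
    rw [distCoeff_sub, distCoeff_sub, distCoeff_sub, discreteHeat, distCoeff_specProj,
      distCoeff_specProj, distCoeff_tildeHeat, distCoeff_heat t _ k one_pos,
      D.distCoeff_paraproduct u v k _ hJ, D.distCoeff_paraproduct u _ k _ hJ,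
      D.distCoeff_paraproduct u _ k _ hJ]
    simp only [Finset.mul_sum, ← Finset.sum_sub_distrib]
    refine Finset.sum_congr rfl fun m _ => Finset.sum_congr rfl fun p _ => ?_
    split_ifs with h
    -- The outer heat coefficient was expanded at scale 1, before the level `m` was available; scale
    -- invariance moves it to scale `2^m`.
    · have e : (heatSymbol (t * 1 ^ 2) ((1 : ℝ)⁻¹ • k.toE3)) =
          heatSymbol (t * (2 ^ m) ^ 2) (((2 : ℝ) ^ m)⁻¹ • k.toE3) := by
        rw [heatSymbol_rescale _ one_ne_zero, heatSymbol_rescale _ (h2 m).ne']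
      rw [h, DyadicPartition.paraCoeff, DyadicPartition.paraCoeff, DyadicPartition.paraCoeff,
        distCoeff_tildeHeat, distCoeff_heat t _ p.2 (h2 m), e, tildeSymbol_eq φ N t k (h2 m),
        tildeSymbol_eq φ N t p.2 (h2 m)]
      push_cast
      ring
    · simp

end LatticeHeat

theorem lemma3p3 (D : DyadicPartition) (φ : Cutoff) (α β δ κ : ℝ)
    (hα : α < 1) (hδ : α + β ≤ δ) (hκ : 0 < κ) :
    (∃ C : ℝ, ∀ (N : ℕ), 1 ≤ N → ∀ (t : ℝ≥0), 0 < t → ∀ (u v : TorusDistribution),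
      D.besovNorm α u < ⊤ → D.besovNorm β v < ⊤ →
      D.besovNorm (δ - κ)
          (discreteHeat φ N t (D.paraproduct u v)
            - specProj N (D.paraproduct u (tildeHeat φ N t v)))
        ≤ ENNReal.ofReal (C * (t : ℝ) ^ ((α + β - δ) / 2))
          * D.besovNorm α u * D.besovNorm β v) ∧
    (κ ≤ 4 →
      ∃ C : ℝ, ∀ (N : ℕ), 1 ≤ N → ∀ (t : ℝ≥0), 0 < t → ∀ (u v : TorusDistribution),
        D.besovNorm α u < ⊤ → D.besovNorm β v < ⊤ →
        D.besovNorm (δ - κ)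
            ((discreteHeat φ N t (D.paraproduct u v) - heat t (D.paraproduct u v))
              - (specProj N (D.paraproduct u (tildeHeat φ N t v))
                - D.paraproduct u (heat t v)))
          ≤ ENNReal.ofReal (C * mesh N ^ (κ / 2) * (t : ℝ) ^ ((α + β - δ) / 2))
            * D.besovNorm α u * D.besovNorm β v) :=
  ⟨exists_commutator_discreteHeat D φ α β δ κ hα hδ hκ,
    exists_commutator_discreteHeat_sub_heat D φ α β δ κ hα hδ hκ⟩
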